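/- Setting. A state of $n$ modes is a density operator $\rho$ on $L^2(\mathbb R^n)$. Phase-space coordinates are ordered mode by mode, $x=(q_1,p_1,\dots,q_n,p_n)$, and $J=\bigoplus_{k=1}^n J_1$ with $J_1=\begin{pmatrix}0&-1\\1&0\end{pmatrix}$. The characteristic function of $\rho$ is $\chi_\rho(x)=\operatorname{tr}[\rho D(x)]$ with $D(x)=\exp(-i\sum_k(q_kX_k+p_kP_k))$, $[X_k,P_k]=i$. The state $\rho$ is Gaussian with correlation matrix $\gamma$ (real, symmetric, strictly positive) and displacement $d\in\mathbb R^{2n}$ if $\chi_\rho(x)=e^{-\frac14x^T\gamma x-id^Tx}$. A three-mode state is fully separable if it is a mixture $\int\rho_A(\omega)\otimes\rho_B(\omega)\otimes\rho_C(\omega)\,d\mu(\omega)$ of products of one-mode states, $\mu$ a probability measure. Let $\rho$ be a Gaussian state of three modes $A,B,C$ with correlation matrix $\gamma$ and any displacement, and suppose that all partial transposes of $\gamma$ are physical: $\Lambda_x\gamma\Lambda_x\ge iJ$ for $x=A,B,C$, where $\Lambda_x$ changes the sign of the momentum coordinate of mode $x$. Write $$\gamma=\begin{pmatrix}A&C\\C^T&B\end{pmatrix},\qquad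 A\in\mathbb R^{2\times2},\ B\in\mathbb R^{4\times4},$$ and put $$N=A-C\,(B-iJ)^{-1}C^T,\qquad \tilde N=A-C\,(B-i\tilde J)^{-1}C^T,$$ where now $J=J_1\oplus J_1$, $\tilde J=J_1\oplus(-J_1)$, and the inverses are pseudoinverses (inversion on the range). These are Hermitian $2\times2$ matrices. For $N=\begin{pmatrix}a&b\\b^*&c\end{pmatrix}$ put $L=(a-c,\,2\operatorname{Re}b)^T$ and $k_1=4[\det N+(\operatorname{Im}b)^2]$, and let $\tilde L$, $\tilde k_1$ be the same quantities for $\tilde N$. For $\xi\in\mathbb R^2$ consider the inequalities $$\min\{\operatorname{tr}N,\operatorname{tr}\tilde N\}\ge2\sqrt{1+\|\xi\|^2},\quad \det N+1+L^T\xi\ge\operatorname{tr}N\sqrt{1+\|\xi\|^2},\quad \det\tilde N+1+\tilde L^T\xi\ge\operatorname{tr}\tilde N\sqrt{1+\|\xi\|^2},\tag{1}$$ which describe a disk and two filled ellipses. The candidate points (at most nine) are: * the centres $m_c=0$, $m_e=\frac{\det N+1}{k_1}L$, $m_{\tilde e}=\frac{\det\tilde N+1}{\tilde k_1}\tilde L$;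 * $i^\pm_{ce}=g+s^\pm f$ with $g=(\operatorname{tr}N\sqrt{r_c^2+1}-\det N-1)\,L/\|L\|^2$, $r_c=\min\{\sqrt{(\operatorname{tr}N)^2/4-1},\sqrt{(\operatorname{tr}\tilde N)^2/4-1}\}$, $f\ne0$ orthogonal to $L$, and $s^\pm$ the real roots of $r_c^2-\|g+sf\|^2$; these points are omitted if $L=0$; * $i^\pm_{c\tilde e}$, defined likewise with $\tilde N,\tilde L$ in place of $N,L$ (the same $r_c$), and omitted if $\tilde L=0$; * $i^\pm_{e\tilde e}=g+s^\pm f$ with $L'=\tilde L/\operatorname{tr}\tilde N-L/\operatorname{tr}N$, $g=\left(\frac{\det N+1}{\operatorname{tr}N}-\frac{\det\tilde N+1}{\operatorname{tr}\tilde N}\right)L'/\|L'\|^2$, $f\ne0$ orthogonal to $L'$, and $s^\pm$ the real roots of $(L^T(g+sf)+\det N+1)^2-(\operatorname{tr}N)^2(1+\|g+sf\|^2)$; these points are omitted if $L'=0$. Then $\rho$ is fully separable if and only if $\det N>0$, $\det\tilde N>0$, and at least one of the candidate points $\xi$ satisfies the three inequalities (1). -/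

import Mathlib

open MeasureTheory
open scoped Matrix ComplexConjugate ComplexOrder

noncomputable section

/-! ### States of `n` modes and their characteristic functions -/

/-- Indices of the phase-space coordinates of `n` modes: `(k, 0)` is the position-type coordinate
`q_k` and `(k, 1)` the momentum-type coordinate `p_k` of the mode `k`. -/
abbrev PhaseIdx (n : ℕ) : Type := Fin n × Fin 2

/-- The Weyl operator `D(q, p) = exp (-i ∑ₖ (qₖ Xₖ + pₖ Pₖ))` of `n` modes acting on wave functions
on `ℝⁿ`, where `Xₖ` is multiplication by `sₖ` and `Pₖ = -i ∂ₖ`, so that `[Xₖ, Pₖ] = i`: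
`(D(q, p) ψ)(s) = exp (-i q·s + i q·p / 2) ψ(s - p)`. -/
def weylOp {n : ℕ} (x : PhaseIdx n → ℝ) (ψ : (Fin n → ℝ) → ℂ) : (Fin n → ℝ) → ℂ := fun s =>
  Complex.exp (-Complex.I * ((∑ k, x (k, 0) * s k : ℝ) : ℂ)
      + Complex.I * ((∑ k, x (k, 0) * x (k, 1) : ℝ) : ℂ) / 2)
    * ψ (fun k => s k - x (k, 1))

/-- A (pure or mixed) state of `n` modes: the density operator `ρ = ∑ⱼ wⱼ |ψⱼ⟩⟨ψⱼ|` on the Hilbert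
space `L²(ℝⁿ)`, given by weights `wⱼ ≥ 0` of sum one and unit vectors `ψⱼ`.
Every positive trace-class operator of trace one has this form. -/
structure ModeState (n : ℕ) where
  weight : ℕ → ℝ
  vec : ℕ → Lp ℂ 2 (volume : Measure (Fin n → ℝ))
  weight_nonneg : ∀ j, 0 ≤ weight j
  weight_hasSum : HasSum weight 1
  norm_vec : ∀ j, ‖vec j‖ = 1

/-- The characteristic function `χ(x) = tr (ρ D(x)) = ∑ⱼ wⱼ ⟨ψⱼ, D(x) ψⱼ⟩` of a state; it determines
the density operator. The series converges absolutely, since `D(x)` is unitary. -/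
def ModeState.charFn {n : ℕ} (ρ : ModeState n) (x : PhaseIdx n → ℝ) : ℂ :=
  ∑' j, (ρ.weight j : ℂ) * ∫ s, conj (ρ.vec j s) * weylOp x (ρ.vec j) s

/-- `ρ` is the Gaussian state with correlation matrix `γ` (real, symmetric, strictly positive) and
displacement `d`, i.e. `χ(x) = exp (-xᵀγx / 4 - i dᵀx)`. -/
def ModeState.IsGaussian {n : ℕ} (ρ : ModeState n) (γ : Matrix (PhaseIdx n) (PhaseIdx n) ℝ)
    (d : PhaseIdx n → ℝ) : Prop :=
  γ.PosDef ∧ ∀ x : PhaseIdx n → ℝ,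
    ρ.charFn x = Complex.exp (-(((x ⬝ᵥ γ *ᵥ x : ℝ) : ℂ)) / 4 - Complex.I * ((d ⬝ᵥ x : ℝ) : ℂ))

/-- Full separability: `ρ = ∫ σ₁(ω) ⊗ ⋯ ⊗ σₙ(ω) dμ(ω)` is a mixture of product states, where the
`σₖ(ω)` are arbitrary states of one mode. This is expressed by characteristic functions: that of the
product state `σ₁ ⊗ ⋯ ⊗ σₙ` is the product of those of the factors, and that of a mixture is the
average of those of its components. -/
def ModeState.IsFullySeparable {n : ℕ} (ρ : ModeState n) : Prop :=
  ∃ (Ω : Type) (_ : MeasurableSpace Ω) (μ : Measure Ω) (_ : IsProbabilityMeasure μ)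
    (σ : Fin n → Ω → ModeState 1),
    (∀ k y, Measurable fun ω => (σ k ω).charFn y) ∧
    ∀ x : PhaseIdx n → ℝ,
      ρ.charFn x = ∫ ω, ∏ k, (σ k ω).charFn (fun j => x (k, j.2)) ∂μ

/-! ### Correlation matrices -/

/-- The matrix `⊕ₖ εₖ J₁` with `J₁ = (0 -1; 1 0)`, one summand for each mode. -/
def signedJ {n : ℕ} (ε : Fin n → ℝ) : Matrix (PhaseIdx n) (PhaseIdx n) ℝ := fun j l =>
  if j.1 = l.1 then ε j.1 * (!![0, -1; 1, 0] : Matrix (Fin 2) (Fin 2) ℝ) j.2 l.2 else 0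

/-- The antisymmetric matrix `J` of `n` modes. -/
def symplJ (n : ℕ) : Matrix (PhaseIdx n) (PhaseIdx n) ℝ := signedJ fun _ => 1

/-- The partially transposed `J̃ = J₁ ⊕ (-J₁)` of two modes. -/
def symplJTilde : Matrix (PhaseIdx 2) (PhaseIdx 2) ℝ := signedJ ![1, -1]

/-- `Λₖ`: changes the sign of the momentum coordinate of the mode `k`. -/
def flipP {n : ℕ} (k : Fin n) : Matrix (PhaseIdx n) (PhaseIdx n) ℝ :=
  Matrix.diagonal fun j => if j = (k, 1) then -1 else 1

/-- The partial transpose `γ̃ₖ = Λₖ γ Λₖ` with respect to the mode `k`. -/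
def partialTranspose {n : ℕ} (k : Fin n) (γ : Matrix (PhaseIdx n) (PhaseIdx n) ℝ) :
    Matrix (PhaseIdx n) (PhaseIdx n) ℝ :=
  flipP k * γ * flipP k

/-- The Hermitian complex matrix `γ - i K`, for real matrices `γ` and `K`. -/
def subI {m : Type*} (γ K : Matrix m m ℝ) : Matrix m m ℂ :=
  γ.map Complex.ofReal - Complex.I • K.map Complex.ofReal

/-- All partial transposes of the three-mode correlation matrix `γ` are physical: `γ̃ₖ ≥ iJ` for
each of the three modes. -/
def IsPPT (γ : Matrix (PhaseIdx 3) (PhaseIdx 3) ℝ) : Prop :=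
  ∀ k, (subI (partialTranspose k γ) (symplJ 3)).PosSemidef

/-! ### The matrices `N` and `Ñ` -/

/-- The pseudoinverse (inversion on the range, zero on the kernel) of a Hermitian matrix; note that
`0⁻¹ = 0` for the zero eigenvalues. -/
def hermPinv {m : Type*} [Fintype m] [DecidableEq m] (M : Matrix m m ℂ) : Matrix m m ℂ :=
  open Classical in
  if h : M.IsHermitian then
    (h.eigenvectorUnitary : Matrix m m ℂ)
      * Matrix.diagonal (fun i => (((h.eigenvalues i)⁻¹ : ℝ) : ℂ))
      * star (h.eigenvectorUnitary : Matrix m m ℂ)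
  else 0

/-- The block `A` of `γ = (A C; Cᵀ B)`, belonging to the first mode. -/
def blockA (γ : Matrix (PhaseIdx 3) (PhaseIdx 3) ℝ) : Matrix (Fin 2) (Fin 2) ℝ :=
  γ.submatrix (fun a => (0, a)) (fun a => (0, a))

/-- The block `B` of `γ = (A C; Cᵀ B)`, belonging to the last two modes. -/
def blockB (γ : Matrix (PhaseIdx 3) (PhaseIdx 3) ℝ) : Matrix (PhaseIdx 2) (PhaseIdx 2) ℝ :=
  γ.submatrix (fun j => (j.1.succ, j.2)) (fun j => (j.1.succ, j.2))

/-- The block `C` of `γ = (A C; Cᵀ B)`. -/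
def blockC (γ : Matrix (PhaseIdx 3) (PhaseIdx 3) ℝ) : Matrix (Fin 2) (PhaseIdx 2) ℝ :=
  γ.submatrix (fun a => (0, a)) (fun j => (j.1.succ, j.2))

/-- `A - C (B - iK)⁻¹ Cᵀ`, with the pseudoinverse. -/
def schurN (γ : Matrix (PhaseIdx 3) (PhaseIdx 3) ℝ) (K : Matrix (PhaseIdx 2) (PhaseIdx 2) ℝ) :
    Matrix (Fin 2) (Fin 2) ℂ :=
  (blockA γ).map Complex.ofReal
    - (blockC γ).map Complex.ofReal * hermPinv (subI (blockB γ) K)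
      * ((blockC γ).map Complex.ofReal)ᵀ

/-- `N = A - C (B - iJ)⁻¹ Cᵀ`. -/
def matN (γ : Matrix (PhaseIdx 3) (PhaseIdx 3) ℝ) : Matrix (Fin 2) (Fin 2) ℂ :=
  schurN γ (symplJ 2)

/-- `Ñ = A - C (B - iJ̃)⁻¹ Cᵀ`. -/
def matNTilde (γ : Matrix (PhaseIdx 3) (PhaseIdx 3) ℝ) : Matrix (Fin 2) (Fin 2) ℂ :=
  schurN γ symplJTilde

/-! ### The circle, the two ellipses and the candidate points

In this section `R = (a b; b* c)` and `S` are Hermitian 2×2 matrices (later `N` and `Ñ`). Their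
traces and determinants are real, and `trR`, `detR` below are these real numbers. -/

/-- The trace of a Hermitian matrix, as a real number. -/
def trR (R : Matrix (Fin 2) (Fin 2) ℂ) : ℝ := R.trace.re

/-- The determinant of a Hermitian matrix, as a real number. -/
def detR (R : Matrix (Fin 2) (Fin 2) ℂ) : ℝ := R.det.re

/-- `L = (a - c, 2 Re b)`. -/
def vecL (R : Matrix (Fin 2) (Fin 2) ℂ) : Fin 2 → ℝ :=
  ![(R 0 0).re - (R 1 1).re, 2 * (R 0 1).re]

/-- The three inequalities for the point `ξ = (y, z)`, describing the circular disk and the two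
filled ellipses. -/
def SepCond (R S : Matrix (Fin 2) (Fin 2) ℂ) (ξ : Fin 2 → ℝ) : Prop :=
  2 * √(1 + ξ ⬝ᵥ ξ) ≤ min (trR R) (trR S) ∧
  trR R * √(1 + ξ ⬝ᵥ ξ) ≤ detR R + 1 + vecL R ⬝ᵥ ξ ∧
  trR S * √(1 + ξ ⬝ᵥ ξ) ≤ detR S + 1 + vecL S ⬝ᵥ ξ

/-- The centre `(det R + 1) / k₁ • L` of an ellipse, with `k₁ = 4 (det R + (Im b)²)`. -/
def ellipseCenter (R : Matrix (Fin 2) (Fin 2) ℂ) : Fin 2 → ℝ :=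
  ((detR R + 1) / (4 * (detR R + (R 0 1).im ^ 2))) • vecL R

/-- The radius of the circle, the smaller of the two radii `√((tr R)² / 4 - 1)`. -/
def circleRadius (R S : Matrix (Fin 2) (Fin 2) ℂ) : ℝ :=
  min (√(trR R ^ 2 / 4 - 1)) (√(trR S ^ 2 / 4 - 1))

/-- A vector orthogonal to `v`, of the same length. -/
def perp (v : Fin 2 → ℝ) : Fin 2 → ℝ := ![-v 1, v 0]

/-- The intersection points of a circle of radius `r` around the origin with the border of the
ellipse given by `R`: the points `g + s f` with `g = (tr R √(r² + 1) - det R - 1) L / ‖L‖²`,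
`f ⊥ L`, for the real roots `s` of `r² - ‖g + s f‖²`. There are none if `L = 0`. -/
def circleEllipsePoints (r : ℝ) (R : Matrix (Fin 2) (Fin 2) ℂ) : Set (Fin 2 → ℝ) :=
  {ξ | vecL R ≠ 0 ∧ ∃ s : ℝ,
    ξ = ((trR R * √(r ^ 2 + 1) - detR R - 1) / (vecL R ⬝ᵥ vecL R)) • vecL R + s • perp (vecL R) ∧
    r ^ 2 - ξ ⬝ᵥ ξ = 0}

/-- `L' = L̃ / tr Ñ - L / tr N`. -/
def vecL' (R S : Matrix (Fin 2) (Fin 2) ℂ) : Fin 2 → ℝ :=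
  (trR S)⁻¹ • vecL S - (trR R)⁻¹ • vecL R

/-- The intersection points of the borders of the two ellipses: the points `g + s f` with
`g = ((det R + 1) / tr R - (det S + 1) / tr S) L' / ‖L'‖²`, `f ⊥ L'`, for the real roots `s` of
`(Lᵀ(g + s f) + det R + 1)² - (tr R)² (1 + ‖g + s f‖²)`. There are none if `L' = 0`. -/
def ellipseEllipsePoints (R S : Matrix (Fin 2) (Fin 2) ℂ) : Set (Fin 2 → ℝ) :=
  {ξ | vecL' R S ≠ 0 ∧ ∃ s : ℝ,
    ξ = (((detR R + 1) / trR R - (detR S + 1) / trR S) / (vecL' R S ⬝ᵥ vecL' R S)) • vecL' R S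
      + s • perp (vecL' R S) ∧
    (vecL R ⬝ᵥ ξ + detR R + 1) ^ 2 - trR R ^ 2 * (1 + ξ ⬝ᵥ ξ) = 0}

/-- The (at most) nine candidate points: the three centres and the pairwise intersections of the
borders of the circle and the two ellipses. -/
def candidatePoints (R S : Matrix (Fin 2) (Fin 2) ℂ) : Set (Fin 2 → ℝ) :=
  {0, ellipseCenter R, ellipseCenter S} ∪ ellipseEllipsePoints R S
    ∪ circleEllipsePoints (circleRadius R S) R ∪ circleEllipsePoints (circleRadius R S) S

end

/-! The key equivalence: ρ is fully separable exactly when `γ ≥ g_A ⊕ g_B ⊕ g_C` for one-mode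
correlation matrices `g_k`. Given such a bound, the `g_k` can be lowered to determinant one, where
they belong to pure Gaussian states; Gaussian random displacements of the product of these states
add the remaining positive matrix (`ModeState.IsGaussian.isFullySeparable`). Conversely, the
components of a separable decomposition are arbitrary states and may lack second moments. Their
characteristic functions still obey a finite-difference uncertainty relation whose error is uniform
over all states (`product_uncertainty`). It can be integrated over the mixture, and letting the
scale tend to zero gives linear inequalities for γ (`ModeState.IsGaussian.le_of_isFullySeparable`).
By Hahn-Banach these inequalities force γ into the closed convex set `aboveProduct 3`
(`mem_aboveProduct`).

Only `D = g_A` has to be searched for. By Schur complements, with the range conditions supplied by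
the PPT property, `D ≤ N` and `D ≤ Ñ` say that subtracting D from the block A leaves a two-mode
matrix dominating both `iJ` and `iJ̃`, and such a matrix already lies above a product
(`exists_product_le`). This is `mem_aboveProduct_iff`. Moreover D can be lowered to determinant one,
`D = pureCM ξ`; then nonnegativity of the traces and determinants of `N - D` and `Ñ - D` is the
system (1) for ξ.

The rest is plane geometry. Positive determinants, forced by `0 < D ≤ N, Ñ`, make the sets in (1)
convex with connected elliptic borders. If they have a common point but the origin is not one, some
border curve passes through the intersection. Either that whole curve belongs to the intersection,
and by convexity so does its centre, or moving along it leads to a second border at a common point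
(`exists_conicCenter_or_corner`). All points obtained in this way are candidates. -/

/-! ### Twisted positivity of characteristic functions -/

/-- The symplectic form of phase space. -/
def symplForm {n : ℕ} (x y : PhaseIdx n → ℝ) : ℝ :=
  ∑ k, (x (k, 0) * y (k, 1) - x (k, 1) * y (k, 0))

/-- The properties of a characteristic function used below: normalization, symmetry, and
positivity twisted by the form `s`. -/
structure IsTwistedPos {V : Type} [AddCommGroup V] (s : V → V → ℝ) (χ : V → ℂ) : Prop where
  map_zero : χ 0 = 1
  map_neg : ∀ x, χ (-x) = conj (χ x)
  pos : ∀ (ι : Type) [Fintype ι] (x : ι → V) (c : ι → ℂ),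
    0 ≤ (∑ a, ∑ b, conj (c a) * c b * (Complex.exp (Complex.I * (s (x a) (x b) : ℝ) / 2)
      * χ (x b - x a))).re

/-- The matrix element `⟨ψ, D(x) ψ⟩`. -/
noncomputable def weylExp {n : ℕ} (ψ : (Fin n → ℝ) → ℂ) (x : PhaseIdx n → ℝ) : ℂ :=
  ∫ s, conj (ψ s) * weylOp x ψ s

lemma norm_weylOp {n : ℕ} (x : PhaseIdx n → ℝ) (ψ : (Fin n → ℝ) → ℂ) (s : Fin n → ℝ) :
    ‖weylOp x ψ s‖ = ‖ψ (fun k => s k - x (k, 1))‖ := by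
  rw [weylOp, norm_mul, Complex.norm_exp]
  simp

lemma weylOp_zero {n : ℕ} (ψ : (Fin n → ℝ) → ℂ) : weylOp 0 ψ = ψ := by
  funext s
  simp [weylOp]

lemma memLp_weylOp {n : ℕ} (x : PhaseIdx n → ℝ) {ψ : (Fin n → ℝ) → ℂ} (hψ : MemLp ψ 2) :
    MemLp (weylOp x ψ) 2 := by
  have h1 : MemLp (fun s : Fin n → ℝ => ψ (s - fun k => x (k, 1))) 2 :=
    hψ.comp_measurePreserving (measurePreserving_sub_right volume _)
  refine (memLp_congr_norm ?_ h1.1 ?_).2 h1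
  · refine AEStronglyMeasurable.mul (Continuous.aestronglyMeasurable ?_) h1.1
    fun_prop
  · filter_upwards with s
    exact norm_weylOp x ψ s

lemma integrable_conj_mul {n : ℕ} {f g : (Fin n → ℝ) → ℂ} (hf : MemLp f 2) (hg : MemLp g 2) :
    Integrable fun s => conj (f s) * g s := by
  have := hf.star.integrable_mul hg
  exact this

/-- The Weyl relation `D(a)* D(b) = exp (i s(a,b)/2) D(b - a)` under the integral. Shifting the
argument by the momentum part of `a` turns `D(a)ψ` into a phase times `ψ(s)`, so the relation holds
pointwise. -/
lemma conj_weylOp_mul {n : ℕ} (a b : PhaseIdx n → ℝ) (ψ : (Fin n → ℝ) → ℂ) (s : Fin n → ℝ) :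
    conj (weylOp a ψ (s + fun k => a (k, 1))) * weylOp b ψ (s + fun k => a (k, 1)) =
      Complex.exp (Complex.I * (symplForm a b : ℝ) / 2) * (conj (ψ s) * weylOp (b - a) ψ s) := by
  have e1 : (fun k => (s + fun k => a (k, 1)) k - a (k, 1)) = s := by funext k; simp
  have e2 : (fun k => (s + fun k => a (k, 1)) k - b (k, 1)) = fun k => s k - (b - a) (k, 1) := by
    funext k; simp; ring
  rw [weylOp, weylOp, weylOp, e1, e2, map_mul, ← Complex.exp_conj]
  rw [show ∀ p q r t : ℂ, p * q * (r * t) = (p * r) * (q * t) by intros; ring, ← Complex.exp_add,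
    show ∀ p q r t : ℂ, p * (q * (r * t)) = (p * r) * (q * t) by intros; ring, ← Complex.exp_add]
  congr 2
  simp only [map_add, map_mul, map_neg, map_div₀, Complex.conj_I, Complex.conj_ofReal, symplForm,
    Pi.sub_apply, Pi.add_apply, map_ofNat]
  have key : -(∑ k, a (k, 0) * (s k + a (k, 1))) * (-1) + -(1/2) * (∑ k, a (k, 0) * a (k, 1))
      - (∑ k, b (k, 0) * (s k + a (k, 1))) + (1/2) * (∑ k, b (k, 0) * b (k, 1)) =
      (1/2) * (∑ k, (a (k, 0) * b (k, 1) - a (k, 1) * b (k, 0)))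
      - (∑ k, (b (k, 0) - a (k, 0)) * s k)
      + (1/2) * ∑ k, (b (k, 0) - a (k, 0)) * (b (k, 1) - a (k, 1)) := by
    simp only [Finset.mul_sum, Finset.sum_mul, ← Finset.sum_neg_distrib, ← Finset.sum_add_distrib,
      ← Finset.sum_sub_distrib]
    exact Finset.sum_congr rfl fun k _ => by ring
  have key' := congrArg (fun r : ℝ => Complex.I * (r : ℂ)) key
  simp only [Complex.ofReal_add, Complex.ofReal_sub, Complex.ofReal_mul, Complex.ofReal_neg,
    Complex.ofReal_one, Complex.ofReal_div, Complex.ofReal_ofNat] at key'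
  linear_combination key'

lemma integral_conj_weylOp_mul {n : ℕ} (a b : PhaseIdx n → ℝ) (ψ : (Fin n → ℝ) → ℂ) :
    ∫ s, conj (weylOp a ψ s) * weylOp b ψ s =
      Complex.exp (Complex.I * (symplForm a b : ℝ) / 2) * weylExp ψ (b - a) := by
  rw [weylExp, ← integral_const_mul,
    ← integral_add_right_eq_self _ (fun k => a (k, 1))]
  exact integral_congr_ae (.of_forall fun s => conj_weylOp_mul a b ψ s)

lemma symplForm_zero_right {n : ℕ} (x : PhaseIdx n → ℝ) : symplForm x 0 = 0 := by
  simp [symplForm]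

lemma weylExp_neg {n : ℕ} (ψ : (Fin n → ℝ) → ℂ) (x : PhaseIdx n → ℝ) :
    weylExp ψ (-x) = conj (weylExp ψ x) := by
  have h := integral_conj_weylOp_mul x 0 ψ
  rw [symplForm_zero_right, weylOp_zero, zero_sub] at h
  simp only [Complex.ofReal_zero, mul_zero, zero_div, Complex.exp_zero, one_mul] at h
  rw [← h, weylExp, ← integral_conj]
  refine integral_congr_ae (.of_forall fun s => ?_)
  simp [mul_comm]

/-- The twisted sum is the squared norm of `∑ c_a D(x_a) ψ`; this is the source of positivity. -/
lemma weylExp_sum_eq {n : ℕ} {ψ : (Fin n → ℝ) → ℂ} (hψ : MemLp ψ 2) {ι : Type} [Fintype ι]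
    (x : ι → PhaseIdx n → ℝ) (c : ι → ℂ) :
    ∑ a, ∑ b, conj (c a) * c b * (Complex.exp (Complex.I * (symplForm (x a) (x b) : ℝ) / 2)
      * weylExp ψ (x b - x a)) = ((∫ s, ‖∑ a, c a * weylOp (x a) ψ s‖ ^ 2 : ℝ) : ℂ) := by
  rw [← integral_complex_ofReal]
  have hi : ∀ a b, Integrable fun s => conj (c a) * c b *
      (conj (weylOp (x a) ψ s) * weylOp (x b) ψ s) := fun a b =>
    (integrable_conj_mul (memLp_weylOp _ hψ) (memLp_weylOp _ hψ)).const_mul _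
  have : ∀ s, ((‖∑ a, c a * weylOp (x a) ψ s‖ ^ 2 : ℝ) : ℂ) = ∑ a, ∑ b, conj (c a) * c b *
      (conj (weylOp (x a) ψ s) * weylOp (x b) ψ s) := by
    intro s
    rw [Complex.ofReal_pow, ← Complex.conj_mul', map_sum, Finset.sum_mul_sum]
    refine Finset.sum_congr rfl fun a _ => Finset.sum_congr rfl fun b _ => ?_
    rw [map_mul]; ring
  simp_rw [this]
  rw [integral_finsetSum _ fun a _ => integrable_finsetSum _ fun b _ => hi a b]
  refine Finset.sum_congr rfl fun a _ => ?_
  rw [integral_finsetSum _ fun b _ => hi a b]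
  refine Finset.sum_congr rfl fun b _ => ?_
  rw [integral_const_mul, integral_conj_weylOp_mul]

lemma integral_norm_sq_eq_one {n : ℕ} (f : Lp ℂ 2 (volume : Measure (Fin n → ℝ))) (hf : ‖f‖ = 1) :
    ∫ s, ‖f s‖ ^ 2 = 1 := by
  have h := L2.inner_def (𝕜 := ℂ) f f
  rw [inner_self_eq_norm_sq_to_K, hf] at h
  have h2 : ∀ s, inner ℂ (f s) (f s) = ((‖f s‖ ^ 2 : ℝ) : ℂ) := fun s => by
    rw [inner_self_eq_norm_sq_to_K]; simp
  simp_rw [h2] at h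
  rw [integral_complex_ofReal] at h
  have h3 : ((1 : ℝ) : ℂ) = ((∫ s, ‖f s‖ ^ 2 : ℝ) : ℂ) := by
    rw [← h]; simp
  exact (Complex.ofReal_injective h3).symm

lemma weylExp_zero {n : ℕ} (f : Lp ℂ 2 (volume : Measure (Fin n → ℝ))) (hf : ‖f‖ = 1) :
    weylExp f 0 = 1 := by
  rw [weylExp, weylOp_zero]
  have h2 : ∀ s, conj (f s) * f s = ((‖f s‖ ^ 2 : ℝ) : ℂ) := fun s => by
    rw [Complex.conj_mul']; simp
  simp_rw [h2]
  rw [integral_complex_ofReal, integral_norm_sq_eq_one f hf]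
  simp

lemma isTwistedPos_weylExp {n : ℕ} (f : Lp ℂ 2 (volume : Measure (Fin n → ℝ))) (hf : ‖f‖ = 1) :
    IsTwistedPos symplForm (weylExp (n := n) f) where
  map_zero := weylExp_zero f hf
  map_neg := weylExp_neg f
  pos ι _ x c := by
    rw [weylExp_sum_eq (Lp.memLp f), Complex.ofReal_re]
    exact integral_nonneg fun s => sq_nonneg _

/-- A twisted positive function is bounded by one. -/
lemma IsTwistedPos.norm_le_one {V : Type} [AddCommGroup V] {s : V → V → ℝ} {χ : V → ℂ}
    (h : IsTwistedPos s χ) (hs0 : ∀ x, s x 0 = 0) (hs0' : ∀ x, s 0 x = 0) (hss : ∀ x, s x x = 0)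
    (x : V) : ‖χ x‖ ≤ 1 := by
  by_cases hx : χ x = 0
  · simp [hx]
  have hn : ‖χ x‖ ≠ 0 := by simpa using hx
  -- Points `0` and `x`, with a coefficient whose phase turns `χ x` into its modulus: positivity
  -- then reads `0 ≤ 2 - 2‖χ x‖`.
  have hp := h.pos (Fin 2) ![0, x] ![1, -(conj (χ x) / ‖χ x‖)]
  have e1 : conj (χ x) / ‖χ x‖ * χ x = ‖χ x‖ := by
    rw [div_mul_eq_mul_div, Complex.conj_mul']
    field_simp
  have e2 : χ x / ‖χ x‖ * conj (χ x) = ‖χ x‖ := by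
    rw [div_mul_eq_mul_div, Complex.mul_conj']
    field_simp
  have e3 : χ x / ‖χ x‖ * (conj (χ x) / ‖χ x‖) = 1 := by
    rw [div_mul_div_comm, Complex.mul_conj']
    field_simp
  have e4 : conj (-(conj (χ x) / ‖χ x‖)) = -(χ x / ‖χ x‖) := by simp
  have : (∑ a : Fin 2, ∑ b : Fin 2, conj ((![1, -(conj (χ x) / ‖χ x‖)] : Fin 2 → ℂ) a)
      * (![1, -(conj (χ x) / ‖χ x‖)] : Fin 2 → ℂ) b
      * (Complex.exp (Complex.I * (s ((![0, x] : Fin 2 → V) a) ((![0, x] : Fin 2 → V) b) : ℝ) / 2)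
      * χ ((![0, x] : Fin 2 → V) b - (![0, x] : Fin 2 → V) a))) = 2 - 2 * ‖χ x‖ := by
    simp only [Fin.sum_univ_two, Matrix.cons_val_zero, Matrix.cons_val_one, hs0, hs0', hss,
      sub_self, h.map_zero, zero_sub, sub_zero, h.map_neg, map_one, e4, Complex.ofReal_zero, mul_zero, zero_div,
      Complex.exp_zero]
    linear_combination e3 - e1 - e2
  rw [this] at hp
  have h2 : ((2 : ℂ) - 2 * ‖χ x‖).re = 2 - 2 * ‖χ x‖ := by
    simp
  rw [h2] at hp
  linarith

lemma symplForm_zero_left {n : ℕ} (x : PhaseIdx n → ℝ) : symplForm 0 x = 0 := by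
  simp [symplForm]

lemma symplForm_self {n : ℕ} (x : PhaseIdx n → ℝ) : symplForm x x = 0 := by
  simp [symplForm, mul_comm]

lemma ModeState.summable_weylExp {n : ℕ} (ρ : ModeState n) (x : PhaseIdx n → ℝ) :
    Summable fun j => (ρ.weight j : ℂ) * weylExp (ρ.vec j) x := by
  refine Summable.of_norm_bounded ρ.weight_hasSum.summable fun j => ?_
  rw [norm_mul, Complex.norm_real, Real.norm_of_nonneg (ρ.weight_nonneg j)]
  exact mul_le_of_le_one_right (ρ.weight_nonneg j)
    ((isTwistedPos_weylExp _ (ρ.norm_vec j)).norm_le_one symplForm_zero_right symplForm_zero_left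
      symplForm_self x)

lemma ModeState.charFn_eq {n : ℕ} (ρ : ModeState n) (x : PhaseIdx n → ℝ) :
    ρ.charFn x = ∑' j, (ρ.weight j : ℂ) * weylExp (ρ.vec j) x := rfl

lemma ModeState.isTwistedPos_charFn {n : ℕ} (ρ : ModeState n) :
    IsTwistedPos symplForm ρ.charFn where
  map_zero := by
    rw [ρ.charFn_eq]
    simp_rw [weylExp_zero _ (ρ.norm_vec _), mul_one]
    have := Complex.hasSum_ofReal.2 ρ.weight_hasSum
    simpa using this.tsum_eq
  map_neg x := by
    rw [ρ.charFn_eq, ρ.charFn_eq, Complex.conj_tsum]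
    simp [weylExp_neg]
  pos ι _ x c := by
    have key : ∑ a, ∑ b, conj (c a) * c b *
        (Complex.exp (Complex.I * (symplForm (x a) (x b) : ℝ) / 2) * ρ.charFn (x b - x a)) =
        ∑' j, (ρ.weight j : ℂ) * ∑ a, ∑ b, conj (c a) * c b *
        (Complex.exp (Complex.I * (symplForm (x a) (x b) : ℝ) / 2) *
          weylExp (ρ.vec j) (x b - x a)) := by
      have hs : ∀ a b, HasSum (fun j => (ρ.weight j : ℂ) * (conj (c a) * c b *
        (Complex.exp (Complex.I * (symplForm (x a) (x b) : ℝ) / 2) *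
          weylExp (ρ.vec j) (x b - x a)))) (conj (c a) * c b *
        (Complex.exp (Complex.I * (symplForm (x a) (x b) : ℝ) / 2) * ρ.charFn (x b - x a))) := by
        intro a b
        have h1 := ((ρ.summable_weylExp (x b - x a)).hasSum.mul_left
          (conj (c a) * c b * Complex.exp (Complex.I * (symplForm (x a) (x b) : ℝ) / 2)))
        rw [← ρ.charFn_eq] at h1
        have h2 : ∀ j, (ρ.weight j : ℂ) * (conj (c a) * c b *
            (Complex.exp (Complex.I * (symplForm (x a) (x b) : ℝ) / 2) *
              weylExp (ρ.vec j) (x b - x a))) = conj (c a) * c b *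
            Complex.exp (Complex.I * (symplForm (x a) (x b) : ℝ) / 2) *
              ((ρ.weight j : ℂ) * weylExp (ρ.vec j) (x b - x a)) := fun j => by ring
        simp_rw [h2]
        rw [← mul_assoc (conj (c a) * c b)]
        exact h1
      have := hasSum_sum (s := Finset.univ) fun a _ =>
        hasSum_sum (s := Finset.univ) fun b _ => hs a b
      rw [← this.tsum_eq]
      simp_rw [Finset.mul_sum]
    rw [key]
    have h2 : ∀ j, (ρ.weight j : ℂ) * ∑ a, ∑ b, conj (c a) * c b *
        (Complex.exp (Complex.I * (symplForm (x a) (x b) : ℝ) / 2) *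
          weylExp (ρ.vec j) (x b - x a)) =
        ((ρ.weight j * ∫ s, ‖∑ a, c a * weylOp (x a) (ρ.vec j) s‖ ^ 2 : ℝ) : ℂ) := by
      intro j
      rw [weylExp_sum_eq (Lp.memLp _)]
      push_cast; rfl
    simp_rw [h2]
    rw [← Complex.ofReal_tsum, Complex.ofReal_re]
    exact tsum_nonneg fun j => mul_nonneg (ρ.weight_nonneg j) (integral_nonneg fun s => sq_nonneg _)

lemma ModeState.norm_charFn_le_one {n : ℕ} (ρ : ModeState n) (x : PhaseIdx n → ℝ) :
    ‖ρ.charFn x‖ ≤ 1 :=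
  ρ.isTwistedPos_charFn.norm_le_one symplForm_zero_right symplForm_zero_left symplForm_self x

/-! ### A uniform uncertainty relation -/

lemma symplForm_add_left {n : ℕ} (x y z : PhaseIdx n → ℝ) :
    symplForm (x + y) z = symplForm x z + symplForm y z := by
  simp only [symplForm, ← Finset.sum_add_distrib, Pi.add_apply]
  exact Finset.sum_congr rfl fun k _ => by ring

lemma symplForm_smul_left {n : ℕ} (t : ℝ) (x y : PhaseIdx n → ℝ) :
    symplForm (t • x) y = t * symplForm x y := by
  simp only [symplForm, Finset.mul_sum, Pi.smul_apply, smul_eq_mul]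
  exact Finset.sum_congr rfl fun k _ => by ring

lemma symplForm_swap {n : ℕ} (x y : PhaseIdx n → ℝ) : symplForm x y = -symplForm y x := by
  simp only [symplForm, ← Finset.sum_neg_distrib]
  exact Finset.sum_congr rfl fun k _ => by ring

lemma symplForm_smul_right {n : ℕ} (t : ℝ) (x y : PhaseIdx n → ℝ) :
    symplForm x (t • y) = t * symplForm x y := by
  rw [symplForm_swap, symplForm_smul_left, symplForm_swap y]; ring

lemma symplForm_add_right {n : ℕ} (x y z : PhaseIdx n → ℝ) :
    symplForm x (y + z) = symplForm x y + symplForm x z := by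
  rw [symplForm_swap, symplForm_add_left, symplForm_swap y, symplForm_swap z]; ring

lemma symplForm_sum_left {n : ℕ} {ι : Type} (s : Finset ι) (x : ι → PhaseIdx n → ℝ)
    (y : PhaseIdx n → ℝ) : symplForm (∑ a ∈ s, x a) y = ∑ a ∈ s, symplForm (x a) y := by
  classical
  induction s using Finset.induction_on with
  | empty => simp [symplForm_zero_left]
  | insert a s ha ih => rw [Finset.sum_insert ha, Finset.sum_insert ha, symplForm_add_left, ih]

lemma symplForm_sum_right {n : ℕ} {ι : Type} (s : Finset ι) (x : ι → PhaseIdx n → ℝ)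
    (y : PhaseIdx n → ℝ) : symplForm y (∑ a ∈ s, x a) = ∑ a ∈ s, symplForm y (x a) := by
  rw [symplForm_swap, symplForm_sum_left, ← Finset.sum_neg_distrib]
  exact Finset.sum_congr rfl fun a _ => (symplForm_swap _ _).symm

/-- A twisted positive function is represented, on finitely many points, by vectors of a Hilbert
space. -/
lemma IsTwistedPos.exists_vectors {n : ℕ} {χ : (PhaseIdx n → ℝ) → ℂ}
    (h : IsTwistedPos symplForm χ) {ι : Type} [Fintype ι] (x : ι → PhaseIdx n → ℝ) :
    ∃ (m : ℕ) (v : ι → EuclideanSpace ℂ (Fin m)), ∀ a b, inner ℂ (v a) (v b) =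
      Complex.exp (Complex.I * (symplForm (x a) (x b) : ℝ) / 2) * χ (x b - x a) := by
  let M : Matrix ι ι ℂ := Matrix.of fun a b =>
    Complex.exp (Complex.I * (symplForm (x a) (x b) : ℝ) / 2) * χ (x b - x a)
  have hH : M.IsHermitian := by
    ext a b
    simp only [M, Matrix.conjTranspose_apply, Matrix.of_apply, RCLike.star_def, map_mul, ← Complex.exp_conj,
      ← h.map_neg, neg_sub]
    congr 2
    rw [symplForm_swap (x b)]
    simp [Complex.conj_ofNat]
  have hP : M.PosSemidef := by
    refine Matrix.PosSemidef.of_dotProduct_mulVec_nonneg hH fun c => ?_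
    rw [RCLike.nonneg_iff]
    refine ⟨?_, hH.im_star_dotProduct_mulVec_self c⟩
    have := h.pos ι x c
    have e : star c ⬝ᵥ M *ᵥ c = ∑ a, ∑ b, conj (c a) * c b *
        (Complex.exp (Complex.I * (symplForm (x a) (x b) : ℝ) / 2) * χ (x b - x a)) := by
      simp only [dotProduct, Matrix.mulVec, Finset.mul_sum, Pi.star_apply, RCLike.star_def]
      refine Finset.sum_congr rfl fun a _ => Finset.sum_congr rfl fun b _ => ?_
      simp only [M, Matrix.of_apply]; ring
    rw [e]
    exact this
  obtain ⟨m, A, hA⟩ := Matrix.posSemidef_iff_eq_sum_vecMulVec.1 hP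
  -- Conjugated entries, because the inner product is conjugate-linear in its first argument.
  refine ⟨m, fun a => WithLp.toLp 2 fun k => conj (A k a), fun a b => ?_⟩
  have := congrFun (congrFun hA a) b
  rw [Matrix.sum_apply] at this
  simp only [M, Matrix.of_apply] at this
  rw [this, PiLp.inner_apply]
  refine Finset.sum_congr rfl fun k _ => ?_
  simp [Matrix.vecMulVec_apply, mul_comm]

lemma abs_sin_sub_le (x : ℝ) : |Real.sin x - x| ≤ 2 * x ^ 2 := by
  rcases le_or_gt |x| 1 with hx | hx
  · have h := Complex.norm_exp_sub_one_sub_id_le (x := x * Complex.I) (by simpa using hx)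
    have h2 := (Complex.abs_im_le_norm _).trans h
    have h3 : (Complex.exp (x * Complex.I) - 1 - x * Complex.I).im = Real.sin x - x := by
      simp [Complex.exp_ofReal_mul_I_im]
    rw [h3] at h2
    simp at h2
    nlinarith [sq_nonneg x]
  · have h1 : |Real.sin x| ≤ 1 := Real.abs_sin_le_one x
    have h2 := abs_sub (Real.sin x) x
    have : x ^ 2 = |x| ^ 2 := (sq_abs x).symm
    nlinarith

lemma norm_sum_smul_sq_le {E ι : Type} [NormedAddCommGroup E] [NormedSpace ℂ E]
    [Fintype ι] (w : ι → ℂ) (hw : ∑ a, ‖w a‖ ^ 2 ≤ 1) (φ : ι → E) :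
    ‖∑ a, w a • φ a‖ ^ 2 ≤ ∑ a, ‖φ a‖ ^ 2 := by
  have h1 : ‖∑ a, w a • φ a‖ ≤ ∑ a, ‖w a‖ * ‖φ a‖ :=
    (norm_sum_le _ _).trans (Finset.sum_le_sum fun a _ => (norm_smul_le _ _))
  have h2 := Finset.sum_mul_sq_le_sq_mul_sq Finset.univ (fun a => ‖w a‖) (fun a => ‖φ a‖)
  have h3 : 0 ≤ ∑ a, ‖φ a‖ ^ 2 := Finset.sum_nonneg fun a _ => sq_nonneg _
  have h4 := pow_le_pow_left₀ (norm_nonneg _) h1 2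
  nlinarith

lemma exists_phase (z : ℂ) : ∃ u : ℂ, ‖u‖ = 1 ∧ u * z = ‖z‖ := by
  by_cases hz : z = 0
  · exact ⟨1, by simp, by simp [hz]⟩
  · have : (‖z‖ : ℂ) ≠ 0 := by simpa using hz
    refine ⟨conj z / ‖z‖, by simp [hz], ?_⟩
    rw [div_mul_eq_mul_div, Complex.conj_mul']
    field_simp

/-- Let `v_x` play the role of `D(x)ψ`. The differences `φ = v_0 - u v_z` and `φ' = v_0 - ū v_{-z}`
have Gram matrices that agree, after a transposition, up to the sign of the twisting phase. Hence
`‖∑ w φ‖² - ‖∑ w̄ φ'‖²` isolates the commutator factor `2i sin (s/2)`. The second square is dropped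
and the first is bounded by Cauchy-Schwarz. All errors are explicit in the defects `1 - ‖χ‖`, so no
second moments are required. -/
lemma IsTwistedPos.uncertainty {n : ℕ} {χ : (PhaseIdx n → ℝ) → ℂ} (h : IsTwistedPos symplForm χ)
    {ι : Type} [Fintype ι] (z : ι → PhaseIdx n → ℝ) (w : ι → ℂ) (hw : ∑ a, ‖w a‖ ^ 2 ≤ 1) :
    (∑ a, ∑ b, conj (w a) * w b * (Complex.I * (symplForm (z a) (z b) : ℝ))).re
      - ∑ a, ∑ b, |symplForm (z a) (z b)| *
        (2 * √(2 * ∑ a, (1 - ‖χ (z a)‖)) + 2 * |symplForm (z a) (z b)|) ≤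
      2 * ∑ a, (1 - ‖χ (z a)‖) := by
  obtain ⟨m, v, hv⟩ := h.exists_vectors
    (fun o : Option (ι ⊕ ι) => o.elim 0 (Sum.elim z fun a => -z a))
  -- These phases remove displacements: only the moduli of χ remain in the norms of `φ` and `φ'`.
  choose u hu huχ using fun a => exists_phase (χ (z a))
  have huu : ∀ a, conj (u a) * u a = 1 := fun a => by rw [Complex.conj_mul', hu]; simp
  set S := ∑ a, (1 - ‖χ (z a)‖) with hS
  let φ : ι → EuclideanSpace ℂ (Fin m) := fun a => v none - u a • v (some (.inl a))
  let φ' : ι → EuclideanSpace ℂ (Fin m) := fun a => v none - conj (u a) • v (some (.inr a))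
  have h00 : inner ℂ (v none) (v none) = 1 := by
    rw [hv]; simp [symplForm_zero_left, h.map_zero]
  have h0l : ∀ a, inner ℂ (v none) (v (some (.inl a))) = χ (z a) := fun a => by
    rw [hv]; simp [symplForm_zero_left]
  have hl0 : ∀ a, inner ℂ (v (some (.inl a))) (v none) = conj (χ (z a)) := fun a => by
    rw [hv]; simp [symplForm_zero_right, h.map_neg]
  have h0r : ∀ a, inner ℂ (v none) (v (some (.inr a))) = conj (χ (z a)) := fun a => by
    rw [hv]; simp [symplForm_zero_left, h.map_neg]
  have hr0 : ∀ a, inner ℂ (v (some (.inr a))) (v none) = χ (z a) := fun a => by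
    rw [hv]; simp [symplForm_zero_right]
  have hll : ∀ a b, inner ℂ (v (some (.inl a))) (v (some (.inl b))) =
      Complex.exp (Complex.I * (symplForm (z a) (z b) : ℝ) / 2) * χ (z b - z a) := fun a b => by
    rw [hv]; simp
  have hrr : ∀ a b, inner ℂ (v (some (.inr b))) (v (some (.inr a))) =
      Complex.exp (-(Complex.I * (symplForm (z a) (z b) : ℝ) / 2)) * χ (z b - z a) := fun a b => by
    rw [hv]
    have : symplForm (-z b) (-z a) = -symplForm (z a) (z b) := by
      rw [← neg_one_smul ℝ, ← neg_one_smul ℝ (z a), symplForm_smul_left, symplForm_smul_right,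
        symplForm_swap (z a)]
      ring
    simp only [Option.elim_some, Sum.elim_inr, this]
    congr 2
    · push_cast; ring
    · abel
  have hχu : ∀ a, conj (u a) * conj (χ (z a)) = ‖χ (z a)‖ := fun a => by
    rw [← map_mul, huχ, Complex.conj_ofReal]
  let κ : ι → ι → ℂ := fun a b => conj (u a) * u b * χ (z b - z a)
  have hφφ : ∀ a b, inner ℂ (φ a) (φ b) = 1 - ‖χ (z b)‖ - ‖χ (z a)‖ +
      Complex.exp (Complex.I * (symplForm (z a) (z b) : ℝ) / 2) * κ a b := by
    intro a b
    simp only [φ, κ, inner_sub_left, inner_sub_right, inner_smul_left, inner_smul_right, h00, h0l,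
      hl0, hll]
    linear_combination -(hχu a) - huχ b
  have hφφ' : ∀ a b, inner ℂ (φ' b) (φ' a) = 1 - ‖χ (z b)‖ - ‖χ (z a)‖ +
      Complex.exp (-(Complex.I * (symplForm (z a) (z b) : ℝ) / 2)) * κ a b := by
    intro a b
    simp only [φ', κ, inner_sub_left, inner_sub_right, inner_smul_left, inner_smul_right, h00, h0r,
      hr0, hrr, Complex.conj_conj]
    linear_combination -(hχu a) - huχ b
  have hnφ : ∀ a, ‖φ a‖ ^ 2 = 2 * (1 - ‖χ (z a)‖) := by
    intro a
    have h1 := hφφ a a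
    rw [inner_self_eq_norm_sq_to_K] at h1
    simp only [symplForm_self, κ, sub_self, h.map_zero, huu] at h1
    have h2 := congrArg Complex.re h1
    simp [← Complex.ofReal_pow] at h2
    linarith
  have hSφ : ∑ a, ‖φ a‖ ^ 2 = 2 * S := by
    rw [hS, Finset.mul_sum]; exact Finset.sum_congr rfl fun a _ => hnφ a
  have hφle : ∀ a, ‖φ a‖ ≤ √(2 * S) := by
    intro a
    apply Real.le_sqrt_of_sq_le
    rw [← hSφ]
    exact Finset.single_le_sum (f := fun a => ‖φ a‖ ^ 2) (fun a _ => sq_nonneg _)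
      (Finset.mem_univ a)
  -- Up to the twisting phase, `κ a b` is the inner product of the unit vectors `u a • v_a` and `u b
  -- • v_b`, both within `√(2 * S)` of `v_0`.
  have hκ : ∀ a b, ‖Complex.exp (Complex.I * (symplForm (z a) (z b) : ℝ) / 2) * κ a b - 1‖ ≤
      2 * √(2 * S) := by
    intro a b
    have e : Complex.exp (Complex.I * (symplForm (z a) (z b) : ℝ) / 2) * κ a b - 1 =
        - inner ℂ (φ a) (v none) - inner ℂ (u a • v (some (.inl a))) (φ b) := by
      simp only [φ, κ, inner_sub_left, inner_sub_right, inner_smul_left, inner_smul_right, h00,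
        hl0, hll]
      ring
    have hv0 : ‖v none‖ = 1 := by
      have h2 := norm_sq_eq_re_inner (𝕜 := ℂ) (v none)
      rw [h00] at h2
      have h3 : ‖v none‖ ^ 2 = 1 := by simpa using h2
      exact (pow_eq_one_iff_of_nonneg (norm_nonneg _) two_ne_zero).1 h3
    have hva : ‖u a • v (some (.inl a))‖ = 1 := by
      have h2 := norm_sq_eq_re_inner (𝕜 := ℂ) (v (some (.inl a)))
      rw [hll a a, symplForm_self, sub_self, h.map_zero] at h2
      have h3 : ‖v (some (.inl a))‖ ^ 2 = 1 := by simpa using h2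
      rw [norm_smul, hu, (pow_eq_one_iff_of_nonneg (norm_nonneg _) two_ne_zero).1 h3, one_mul]
    rw [e]
    calc _ ≤ ‖inner ℂ (φ a) (v none)‖ + ‖inner ℂ (u a • v (some (.inl a))) (φ b)‖ := by
          refine (norm_sub_le _ _).trans ?_
          rw [norm_neg]
      _ ≤ ‖φ a‖ * ‖v none‖ + ‖u a • v (some (.inl a))‖ * ‖φ b‖ :=
          add_le_add (norm_inner_le_norm _ _) (norm_inner_le_norm _ _)
      _ ≤ _ := by rw [hv0, hva]; linarith [hφle a, hφle b]
  have hdiff : ((‖∑ a, w a • φ a‖ ^ 2 - ‖∑ a, conj (w a) • φ' a‖ ^ 2 : ℝ) : ℂ) =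
      ∑ a, ∑ b, conj (w a) * w b *
        (2 * Complex.I * (Real.sin (symplForm (z a) (z b) / 2) : ℝ) * κ a b) := by
    have e1 : ((‖∑ a, w a • φ a‖ ^ 2 : ℝ) : ℂ) =
        ∑ a, ∑ b, conj (w a) * w b * inner ℂ (φ a) (φ b) := by
      have := inner_self_eq_norm_sq_to_K (𝕜 := ℂ) (∑ a, w a • φ a)
      rw [Complex.ofReal_pow]
      refine this.symm.trans ?_
      rw [sum_inner]
      refine Finset.sum_congr rfl fun a _ => ?_
      rw [inner_sum]
      refine Finset.sum_congr rfl fun b _ => ?_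
      rw [inner_smul_left, inner_smul_right]; ring
    have e2 : ((‖∑ a, conj (w a) • φ' a‖ ^ 2 : ℝ) : ℂ) =
        ∑ a, ∑ b, conj (w a) * w b * inner ℂ (φ' b) (φ' a) := by
      have := inner_self_eq_norm_sq_to_K (𝕜 := ℂ) (∑ a, conj (w a) • φ' a)
      rw [Complex.ofReal_pow]
      refine this.symm.trans ?_
      rw [inner_sum]
      refine Finset.sum_congr rfl fun a _ => ?_
      rw [sum_inner]
      refine Finset.sum_congr rfl fun b _ => ?_
      rw [inner_smul_left, inner_smul_right, Complex.conj_conj]; ring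
    rw [Complex.ofReal_sub, e1, e2, ← Finset.sum_sub_distrib]
    refine Finset.sum_congr rfl fun a _ => ?_
    rw [← Finset.sum_sub_distrib]
    refine Finset.sum_congr rfl fun b _ => ?_
    rw [hφφ, hφφ']
    have e3 : (2 * Complex.I * (Real.sin (symplForm (z a) (z b) / 2) : ℝ) : ℂ) =
        Complex.exp (Complex.I * (symplForm (z a) (z b) : ℝ) / 2) -
        Complex.exp (-(Complex.I * (symplForm (z a) (z b) : ℝ) / 2)) := by
      rw [show (Complex.I * (symplForm (z a) (z b) : ℝ) / 2 : ℂ) =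
        ((symplForm (z a) (z b) / 2 : ℝ) : ℂ) * Complex.I by push_cast; ring,
        ← neg_mul, ← Complex.ofReal_neg, Complex.exp_ofReal_mul_I, Complex.exp_ofReal_mul_I,
        Real.cos_neg, Real.sin_neg]
      push_cast; ring
    rw [e3]; ring
  have hw1 : ∀ a, ‖w a‖ ≤ 1 := by
    intro a
    have := (Finset.single_le_sum (f := fun a => ‖w a‖ ^ 2) (fun a _ => sq_nonneg _)
      (Finset.mem_univ a)).trans hw
    exact (sq_le_one_iff₀ (norm_nonneg _)).1 this
  have hterm : ∀ a b, (conj (w a) * w b * (Complex.I * (symplForm (z a) (z b) : ℝ))).re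
      - |symplForm (z a) (z b)| * (2 * √(2 * S) + 2 * |symplForm (z a) (z b)|) ≤
      (conj (w a) * w b *
        (2 * Complex.I * (Real.sin (symplForm (z a) (z b) / 2) : ℝ) * κ a b)).re := by
    intro a b
    set s := symplForm (z a) (z b) with hs
    have e1 : ‖Complex.exp (Complex.I * (s : ℝ) / 2)‖ = 1 := by
      rw [show (Complex.I * (s : ℝ) / 2 : ℂ) = ((s / 2 : ℝ) : ℂ) * Complex.I by push_cast; ring,
        Complex.norm_exp_ofReal_mul_I]
    have e2 : ‖Complex.exp (Complex.I * (s : ℝ) / 2) - 1‖ ≤ |s| / 2 := by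
      have := Real.norm_exp_I_mul_ofReal_sub_one_le (x := s / 2)
      rw [show (Complex.I * (s : ℝ) / 2 : ℂ) = Complex.I * ((s / 2 : ℝ) : ℂ) by push_cast; ring]
      refine this.trans ?_
      rw [Real.norm_eq_abs, abs_div]; simp
    have e3 : ‖κ a b - 1‖ ≤ 2 * √(2 * S) + |s| / 2 := by
      have : ‖κ a b - 1‖ = ‖Complex.exp (Complex.I * (s : ℝ) / 2) * (κ a b - 1)‖ := by
        rw [norm_mul, e1, one_mul]
      rw [this, show Complex.exp (Complex.I * (s : ℝ) / 2) * (κ a b - 1) =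
        (Complex.exp (Complex.I * (s : ℝ) / 2) * κ a b - 1) -
          (Complex.exp (Complex.I * (s : ℝ) / 2) - 1) by ring]
      exact (norm_sub_le _ _).trans (add_le_add (hκ a b) e2)
    have e4 : |2 * Real.sin (s / 2)| ≤ |s| := by
      rw [abs_mul]
      have : |Real.sin (s / 2)| ≤ |s / 2| := Real.abs_sin_le_abs
      rw [abs_div] at this
      simp only [abs_two] at *
      linarith
    have e5 : |2 * Real.sin (s / 2) - s| ≤ s ^ 2 := by
      have := abs_sin_sub_le (s / 2)
      rw [show 2 * Real.sin (s / 2) - s = 2 * (Real.sin (s / 2) - s / 2) by ring, abs_mul, abs_two]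
      nlinarith
    have e6 : ‖conj (w a) * w b‖ ≤ 1 := by
      rw [norm_mul, RCLike.norm_conj]
      exact mul_le_one₀ (hw1 a) (norm_nonneg _) (hw1 b)
    have e7 : conj (w a) * w b * (Complex.I * (s : ℝ)) - conj (w a) * w b *
        (2 * Complex.I * (Real.sin (s / 2) : ℝ) * κ a b) = -(conj (w a) * w b) * Complex.I *
        (((2 * Real.sin (s / 2) : ℝ) : ℂ) * (κ a b - 1) + ((2 * Real.sin (s / 2) - s : ℝ) : ℂ)) := by
      push_cast; ring
    have e8 : ‖conj (w a) * w b * (Complex.I * (s : ℝ)) - conj (w a) * w b *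
        (2 * Complex.I * (Real.sin (s / 2) : ℝ) * κ a b)‖ ≤ |s| * (2 * √(2 * S) + 2 * |s|) := by
      rw [e7, norm_mul, norm_mul, norm_neg, Complex.norm_I, mul_one]
      refine (mul_le_of_le_one_left (norm_nonneg _) e6).trans ((norm_add_le _ _).trans ?_)
      rw [norm_mul, Complex.norm_real, Complex.norm_real, Real.norm_eq_abs, Real.norm_eq_abs]
      have := mul_le_mul e4 e3 (norm_nonneg _) (abs_nonneg _)
      nlinarith [sq_abs s, abs_nonneg s]
    have e9 := (Complex.re_le_norm _).trans e8
    rw [Complex.sub_re] at e9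
    linarith
  have h1 := norm_sum_smul_sq_le w hw φ
  have h2 := congrArg Complex.re hdiff
  rw [Complex.ofReal_re] at h2
  calc _ = ∑ a, ∑ b, ((conj (w a) * w b * (Complex.I * (symplForm (z a) (z b) : ℝ))).re
      - |symplForm (z a) (z b)| * (2 * √(2 * S) + 2 * |symplForm (z a) (z b)|)) := by
        simp only [Complex.re_sum, Finset.sum_sub_distrib]
    _ ≤ ∑ a, ∑ b, (conj (w a) * w b *
        (2 * Complex.I * (Real.sin (symplForm (z a) (z b) / 2) : ℝ) * κ a b)).re :=
        Finset.sum_le_sum fun a _ => Finset.sum_le_sum fun b _ => hterm a b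
    _ = ‖∑ a, w a • φ a‖ ^ 2 - ‖∑ a, conj (w a) • φ' a‖ ^ 2 := by
        rw [h2]; simp only [Complex.re_sum]
    _ ≤ 2 * S := by
        rw [← hSφ]
        linarith [sq_nonneg ‖∑ a, conj (w a) • φ' a‖]

/-- The choice `w = q + i p` makes the commutator term `2 s(∑ p z, ∑ q z)`. The constant depends on
the points only, not on χ or `t`; this permits integration over the components of a mixture. -/
lemma IsTwistedPos.uncertainty_scaled {n : ℕ} {ι : Type} [Fintype ι] (z : ι → PhaseIdx n → ℝ)
    (p q : ι → ℝ) (hpq : ∑ a, (p a ^ 2 + q a ^ 2) ≤ 1) :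
    ∃ C : ℝ, 0 ≤ C ∧ ∀ χ : (PhaseIdx n → ℝ) → ℂ, IsTwistedPos symplForm χ → ∀ t : ℝ,
      t ^ 2 * (2 * symplForm (∑ a, p a • z a) (∑ a, q a • z a)
        - C * (√(∑ a, (1 - ‖χ (t • z a)‖)) + t ^ 2)) ≤ 2 * ∑ a, (1 - ‖χ (t • z a)‖) := by
  refine ⟨∑ a, ∑ b, |symplForm (z a) (z b)| * (4 + 2 * |symplForm (z a) (z b)|),
    Finset.sum_nonneg fun a _ => Finset.sum_nonneg fun b _ => by positivity, fun χ h t => ?_⟩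
  have h1 := h.uncertainty (fun a => t • z a) (fun a => (⟨q a, p a⟩ : ℂ)) (by
    refine le_trans (le_of_eq (Finset.sum_congr rfl fun a _ => ?_)) hpq
    rw [← Complex.normSq_eq_norm_sq, Complex.normSq_mk]; ring)
  set S := ∑ a, (1 - ‖χ (t • z a)‖)
  refine le_trans ?_ h1
  have e1 : (∑ a, ∑ b, conj (⟨q a, p a⟩ : ℂ) * (⟨q b, p b⟩ : ℂ) *
      (Complex.I * (symplForm (t • z a) (t • z b) : ℝ))).re =
      t ^ 2 * (2 * symplForm (∑ a, p a • z a) (∑ a, q a • z a)) := by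
    have e2 : 2 * symplForm (∑ a, p a • z a) (∑ a, q a • z a) =
        ∑ a, ∑ b, (p a * q b - q a * p b) * symplForm (z a) (z b) := by
      have e3 : symplForm (∑ a, p a • z a) (∑ a, q a • z a) =
          ∑ a, ∑ b, p a * q b * symplForm (z a) (z b) := by
        rw [symplForm_sum_left]
        refine Finset.sum_congr rfl fun a _ => ?_
        rw [symplForm_sum_right]
        refine Finset.sum_congr rfl fun b _ => ?_
        rw [symplForm_smul_left, symplForm_smul_right]; ring
      have e4 : symplForm (∑ a, p a • z a) (∑ a, q a • z a) =
          -∑ a, ∑ b, q a * p b * symplForm (z a) (z b) := by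
        rw [symplForm_swap, symplForm_sum_left]
        congr 1
        refine Finset.sum_congr rfl fun a _ => ?_
        rw [symplForm_sum_right]
        refine Finset.sum_congr rfl fun b _ => ?_
        rw [symplForm_smul_left, symplForm_smul_right]; ring
      rw [two_mul]
      nth_rewrite 1 [e3]
      rw [e4, ← sub_eq_add_neg, ← Finset.sum_sub_distrib]
      refine Finset.sum_congr rfl fun a _ => ?_
      rw [← Finset.sum_sub_distrib]
      exact Finset.sum_congr rfl fun b _ => by ring
    rw [e2, Finset.mul_sum, Complex.re_sum]
    refine Finset.sum_congr rfl fun a _ => ?_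
    rw [Finset.mul_sum, Complex.re_sum]
    refine Finset.sum_congr rfl fun b _ => ?_
    rw [symplForm_smul_left, symplForm_smul_right]
    simp [Complex.mul_re, Complex.mul_im]
    ring
  have e5 : ∑ a, ∑ b, |symplForm (t • z a) (t • z b)| *
      (2 * √(2 * S) + 2 * |symplForm (t • z a) (t • z b)|) ≤
      t ^ 2 * ((∑ a, ∑ b, |symplForm (z a) (z b)| * (4 + 2 * |symplForm (z a) (z b)|)) *
        (√S + t ^ 2)) := by
    simp only [Finset.sum_mul, Finset.mul_sum]
    refine Finset.sum_le_sum fun a _ => Finset.sum_le_sum fun b _ => ?_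
    have h2 : ∀ r : ℝ, |t * (t * r)| = t * t * |r| := fun r => by
      rw [← mul_assoc, abs_mul, abs_of_nonneg (mul_self_nonneg t)]
    rw [symplForm_smul_left, symplForm_smul_right, h2]
    have h3 : √(2 * S) ≤ 2 * √S := by
      have : (2 : ℝ) * √S = √(2 ^ 2 * S) := by
        rw [Real.sqrt_mul (by norm_num), Real.sqrt_sq (by norm_num)]
      rcases le_or_gt 0 S with hS | hS
      · rw [this]; exact Real.sqrt_le_sqrt (by linarith)
      · rw [Real.sqrt_eq_zero_of_nonpos (by linarith), Real.sqrt_eq_zero_of_nonpos hS.le]; simp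
    generalize symplForm (z a) (z b) = σ
    have h4 : 2 * √(2 * S) + 2 * (t * t * |σ|) ≤ (4 + 2 * |σ|) * (√S + t ^ 2) := by
      nlinarith [Real.sqrt_nonneg S, abs_nonneg σ, sq_nonneg t,
        mul_nonneg (abs_nonneg σ) (Real.sqrt_nonneg S)]
    have h5 := mul_le_mul_of_nonneg_left h4 (mul_nonneg (mul_self_nonneg t) (abs_nonneg σ))
    nlinarith
  rw [e1]
  linarith

/-- Either `2 S` already reaches `t² R`, or `S = O(t²)`; in the second case the errors `t² C (√S +
t²)` and `18 S²` are both `O(t³)` and are absorbed. -/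
lemma le_of_quadratic_remainder {R C S t : ℝ} (hC : 0 ≤ C) (ht : 0 < t) (ht1 : t ≤ 1)
    (hS : 0 ≤ S) (h : t ^ 2 * (R - C * (√S + t ^ 2)) ≤ 2 * S + 18 * S ^ 2) :
    t ^ 2 * (R - t * (C * (√R + 1) + 5 * R ^ 2)) ≤ 2 * S := by
  rcases le_or_gt (t ^ 2 * R) (2 * S) with h1 | h1
  · have : 0 ≤ t ^ 2 * (t * (C * (√R + 1) + 5 * R ^ 2)) := by positivity
    linarith
  · have hR : 0 < R := by
      by_contra hR
      nlinarith [sq_nonneg t]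
    have h2 : √S ≤ t * √R := by
      rw [← Real.sqrt_sq ht.le, ← Real.sqrt_mul (sq_nonneg t)]
      exact Real.sqrt_le_sqrt (by linarith)
    have h3 : S ^ 2 ≤ (t ^ 2 * R / 2) ^ 2 := pow_le_pow_left₀ hS (by linarith) 2
    have h4 : √S + t ^ 2 ≤ t * (√R + 1) := by nlinarith
    have h5 := mul_le_mul_of_nonneg_left (mul_le_mul_of_nonneg_left h4 hC) (sq_nonneg t)
    -- `18 (t² R / 2)² = (9/2) t⁴ R²`, rounded up to `5 t³ R²`.
    have h6 : 18 * S ^ 2 ≤ t ^ 2 * (t * (5 * R ^ 2)) := by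
      have : t ^ 4 ≤ t ^ 3 := pow_le_pow_of_le_one ht.le ht1 (by norm_num)
      nlinarith [mul_le_mul_of_nonneg_right this (sq_nonneg R),
        mul_nonneg (pow_nonneg ht.le 3) (sq_nonneg R)]
    nlinarith

/-- The coordinates of the mode `k`. -/
def modePart {n : ℕ} (k : Fin n) (x : PhaseIdx n → ℝ) : PhaseIdx 1 → ℝ := fun j => x (k, j.2)

/-- In the elementary symmetric functions of the defects, `1 - a b c = e₁ - e₂ + e₃`, with `e₂ ≤
e₁²` and `e₃ ≥ 0`. To first order the defects of a product add up. -/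
lemma one_sub_mul_mul_ge {a b c : ℝ} (ha : a ≤ 1) (hb : b ≤ 1) (hc : c ≤ 1) :
    ((1 - a) + (1 - b) + (1 - c)) - ((1 - a) + (1 - b) + (1 - c)) ^ 2 ≤ 1 - a * b * c := by
  have h1 := mul_nonneg (sub_nonneg.2 ha) (sub_nonneg.2 hb)
  have h2 := mul_nonneg (sub_nonneg.2 ha) (sub_nonneg.2 hc)
  have h3 := mul_nonneg (sub_nonneg.2 hb) (sub_nonneg.2 hc)
  have h4 := mul_nonneg h1 (sub_nonneg.2 hc)
  nlinarith [sq_nonneg (1 - a), sq_nonneg (1 - b), sq_nonneg (1 - c)]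

/-- A bound for products of one-mode characteristic functions, uniform in these functions. -/
lemma product_uncertainty {ι : Type} [Fintype ι] (z : ι → PhaseIdx 3 → ℝ)
    (p q : Fin 3 → ι → ℝ) (hpq : ∀ k, ∑ a, (p k a ^ 2 + q k a ^ 2) ≤ 1) :
    ∃ D : ℝ, ∀ χ : Fin 3 → (PhaseIdx 1 → ℝ) → ℂ, (∀ k, IsTwistedPos symplForm (χ k)) →
      ∀ t : ℝ, 0 < t → t ≤ 1 →
      t ^ 2 * ((∑ k, 2 * symplForm (∑ a, p k a • modePart k (z a)) (∑ a, q k a • modePart k (z a)))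
        - t * D) ≤ 2 * ∑ a, (1 - ∏ k, ‖χ k (t • modePart k (z a))‖) := by
  choose C hC0 hC using fun k =>
    IsTwistedPos.uncertainty_scaled (fun a => modePart k (z a)) (p k) (q k) (hpq k)
  refine ⟨_, fun χ hχ t ht ht1 => le_of_quadratic_remainder (C := ∑ k, C k)
    (Finset.sum_nonneg fun k _ => hC0 k) ht ht1 ?_ ?_⟩
  · refine Finset.sum_nonneg fun a _ => sub_nonneg.2 (Finset.prod_le_one (fun k _ => norm_nonneg _)
      fun k _ => (hχ k).norm_le_one symplForm_zero_right symplForm_zero_left symplForm_self _)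
  · set x : Fin 3 → ι → ℝ := fun k a => ‖χ k (t • modePart k (z a))‖ with hx
    have hx1 : ∀ k a, x k a ≤ 1 := fun k a =>
      (hχ k).norm_le_one symplForm_zero_right symplForm_zero_left symplForm_self _
    have hx0 : ∀ k a, 0 ≤ x k a := fun k a => norm_nonneg _
    set S := ∑ a, (1 - ∏ k, x k a) with hS
    have hprod : ∀ k a, ∏ k, x k a ≤ x k a := by
      intro k a
      have h1 := mul_le_one₀ (hx1 0 a) (hx0 1 a) (hx1 1 a)
      have h2 := mul_le_one₀ (hx1 0 a) (hx0 2 a) (hx1 2 a)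
      have h3 := mul_le_one₀ (hx1 1 a) (hx0 2 a) (hx1 2 a)
      rw [Fin.prod_univ_three]
      fin_cases k
      · have := mul_le_mul_of_nonneg_left h3 (hx0 0 a); simp only [Fin.zero_eta]; linarith
      · have := mul_le_mul_of_nonneg_left h2 (hx0 1 a); simp only [Fin.mk_one]; linarith
      · have := mul_le_mul_of_nonneg_left h1 (hx0 2 a); simp only [Fin.reduceFinMk]; linarith
    have hSk : ∀ k, ∑ a, (1 - x k a) ≤ S := fun k =>
      Finset.sum_le_sum fun a _ => by linarith [hprod k a]
    have hSk0 : ∀ k, 0 ≤ ∑ a, (1 - x k a) := fun k =>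
      Finset.sum_nonneg fun a _ => by linarith [hx1 k a]
    have hk : ∀ k, t ^ 2 * (2 * symplForm (∑ a, p k a • modePart k (z a))
        (∑ a, q k a • modePart k (z a)) - C k * (√S + t ^ 2)) ≤ 2 * ∑ a, (1 - x k a) := by
      intro k
      refine le_trans ?_ (hC k (χ k) (hχ k) t)
      have := Real.sqrt_le_sqrt (hSk k)
      refine mul_le_mul_of_nonneg_left ?_ (sq_nonneg t)
      have := mul_le_mul_of_nonneg_left (add_le_add_left this (t ^ 2)) (hC0 k)
      linarith
    have hsum := Finset.sum_le_sum fun k (_ : k ∈ Finset.univ) => hk k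
    rw [← Finset.mul_sum, Finset.sum_sub_distrib, ← Finset.sum_mul] at hsum
    refine (hsum.trans_eq (Finset.mul_sum _ _ _).symm).trans ?_
    set Y := ∑ k, ∑ a, (1 - x k a) with hY
    have hY3 : Y ≤ 3 * S := by
      rw [hY, Fin.sum_univ_three]; linarith [hSk 0, hSk 1, hSk 2]
    have hY0 : 0 ≤ Y := Finset.sum_nonneg fun k _ => hSk0 k
    have hYa : Y = ∑ a, ((1 - x 0 a) + (1 - x 1 a) + (1 - x 2 a)) := by
      rw [hY, Fin.sum_univ_three, Finset.sum_add_distrib, Finset.sum_add_distrib]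
    have hsq : ∑ a, ((1 - x 0 a) + (1 - x 1 a) + (1 - x 2 a)) ^ 2 ≤ Y ^ 2 := by
      rw [hYa]
      exact Finset.sum_sq_le_sq_sum_of_nonneg fun a _ => by
        linarith [hx1 0 a, hx1 1 a, hx1 2 a]
    have hSY : Y - Y ^ 2 ≤ S := by
      have : ∑ a, (((1 - x 0 a) + (1 - x 1 a) + (1 - x 2 a)) -
          ((1 - x 0 a) + (1 - x 1 a) + (1 - x 2 a)) ^ 2) ≤ S :=
        Finset.sum_le_sum fun a _ => by
          rw [Fin.prod_univ_three]
          exact one_sub_mul_mul_ge (hx1 0 a) (hx1 1 a) (hx1 2 a)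
      rw [Finset.sum_sub_distrib, ← hYa] at this
      linarith
    -- `Y ≤ S + Y²` together with `Y ≤ 3 S` gives `2 Y ≤ 2 S + 18 S²`, which explains the constant
    -- 18.
    nlinarith

/-! ### Linear inequalities for correlation matrices of Gaussian states -/

lemma ModeState.IsGaussian.norm_charFn {n : ℕ} {ρ : ModeState n}
    {γ : Matrix (PhaseIdx n) (PhaseIdx n) ℝ} {d : PhaseIdx n → ℝ} (h : ρ.IsGaussian γ d)
    (x : PhaseIdx n → ℝ) : ‖ρ.charFn x‖ = Real.exp (-(x ⬝ᵥ γ *ᵥ x) / 4) := by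
  rw [h.2 x, Complex.norm_exp]
  congr 1
  simp

lemma one_sub_exp_quadForm_le {n : ℕ} (γ : Matrix (PhaseIdx n) (PhaseIdx n) ℝ)
    (x : PhaseIdx n → ℝ) (t : ℝ) :
    1 - Real.exp (-((t • x) ⬝ᵥ γ *ᵥ (t • x)) / 4) ≤ t ^ 2 * (x ⬝ᵥ γ *ᵥ x) / 4 := by
  rw [Matrix.mulVec_smul, smul_dotProduct, dotProduct_smul, smul_eq_mul, smul_eq_mul]
  have := Real.add_one_le_exp (-(t * (t * (x ⬝ᵥ γ *ᵥ x))) / 4)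
  nlinarith

lemma le_of_forall_sub_mul_le {a b D : ℝ} (h : ∀ t : ℝ, 0 < t → t ≤ 1 → a - t * D ≤ b) :
    a ≤ b := by
  by_contra hab
  push Not at hab
  have h1 := h 1 one_pos le_rfl
  have hD : 0 < D := by linarith
  have := h (min 1 ((a - b) / (2 * D))) (lt_min one_pos (div_pos (by linarith) (by linarith)))
    (min_le_left _ _)
  have h2 : min 1 ((a - b) / (2 * D)) * D ≤ (a - b) / (2 * D) * D :=
    mul_le_mul_of_nonneg_right (min_le_right _ _) hD.le
  have h3 : (a - b) / (2 * D) * D = (a - b) / 2 := by field_simp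
  linarith

/-- The uncertainty relation for the correlation matrix of a Gaussian state. -/
theorem ModeState.IsGaussian.uncertainty {n : ℕ} {ρ : ModeState n}
    {γ : Matrix (PhaseIdx n) (PhaseIdx n) ℝ} {d : PhaseIdx n → ℝ} (h : ρ.IsGaussian γ d)
    (x y : PhaseIdx n → ℝ) : 2 * symplForm x y ≤ x ⬝ᵥ γ *ᵥ x + y ⬝ᵥ γ *ᵥ y := by
  have h2 : (√2)⁻¹ ^ 2 = (1 / 2 : ℝ) := by rw [inv_pow, Real.sq_sqrt (by norm_num)]; norm_num
  obtain ⟨C, hC0, hC⟩ := IsTwistedPos.uncertainty_scaled ![x, y] ![(√2)⁻¹, 0] ![0, (√2)⁻¹]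
    (by simp [Fin.sum_univ_two, h2]; norm_num)
  have e : 2 * symplForm (∑ a : Fin 2, (![(√2)⁻¹, 0] : Fin 2 → ℝ) a • (![x, y] : Fin 2 → _) a)
      (∑ a : Fin 2, (![0, (√2)⁻¹] : Fin 2 → ℝ) a • (![x, y] : Fin 2 → _) a) = symplForm x y := by
    simp only [Fin.sum_univ_two, Matrix.cons_val_zero, Matrix.cons_val_one, zero_smul, add_zero,
      zero_add, symplForm_smul_left, symplForm_smul_right]
    linear_combination 2 * symplForm x y * h2
  rw [e] at hC
  suffices symplForm x y ≤ (x ⬝ᵥ γ *ᵥ x + y ⬝ᵥ γ *ᵥ y) / 2 by linarith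
  refine le_of_forall_sub_mul_le
    (D := C * (√(symplForm x y) + 1) + 5 * symplForm x y ^ 2) fun t ht ht1 => ?_
  have h1 := hC _ ρ.isTwistedPos_charFn t
  have hS0 : 0 ≤ ∑ a : Fin 2, (1 - ‖ρ.charFn (t • (![x, y] : Fin 2 → _) a)‖) :=
    Finset.sum_nonneg fun a _ => sub_nonneg.2 (ρ.norm_charFn_le_one _)
  have h3 := le_of_quadratic_remainder hC0 ht ht1 hS0
    (h1.trans (by linarith [sq_nonneg (∑ a : Fin 2, (1 - ‖ρ.charFn (t • (![x, y] : Fin 2 → _) a)‖))]))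
  rw [Fin.sum_univ_two] at h3
  simp only [Matrix.cons_val_zero, Matrix.cons_val_one, h.norm_charFn] at h3
  have h4 := one_sub_exp_quadForm_le γ x t
  have h5 := one_sub_exp_quadForm_le γ y t
  refine le_of_mul_le_mul_left (h3.trans ?_) (pow_pos ht 2)
  linarith

/-- The bound for the correlation matrix of a fully separable Gaussian state. -/
theorem ModeState.IsGaussian.le_of_isFullySeparable {ρ : ModeState 3}
    {γ : Matrix (PhaseIdx 3) (PhaseIdx 3) ℝ} {d : PhaseIdx 3 → ℝ} (h : ρ.IsGaussian γ d)
    (hsep : ρ.IsFullySeparable) {ι : Type} [Fintype ι] (z : ι → PhaseIdx 3 → ℝ)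
    (p q : Fin 3 → ι → ℝ) (hpq : ∀ k, ∑ a, (p k a ^ 2 + q k a ^ 2) ≤ 1) :
    ∑ k, 4 * symplForm (∑ a, p k a • modePart k (z a)) (∑ a, q k a • modePart k (z a)) ≤
      ∑ a, z a ⬝ᵥ γ *ᵥ z a := by
  obtain ⟨Ω, _, μ, _, σ, hσ, hχ⟩ := hsep
  obtain ⟨D, hD⟩ := product_uncertainty z p q hpq
  have e : ∑ k, 4 * symplForm (∑ a, p k a • modePart k (z a)) (∑ a, q k a • modePart k (z a)) =
      2 * ∑ k, 2 * symplForm (∑ a, p k a • modePart k (z a)) (∑ a, q k a • modePart k (z a)) := by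
    rw [Finset.mul_sum]; exact Finset.sum_congr rfl fun k _ => by ring
  rw [e]
  set R := ∑ k, 2 * symplForm (∑ a, p k a • modePart k (z a)) (∑ a, q k a • modePart k (z a))
  suffices R ≤ (∑ a, z a ⬝ᵥ γ *ᵥ z a) / 2 by linarith
  refine le_of_forall_sub_mul_le (D := D) fun t ht ht1 => ?_
  have hmeas : ∀ a, Measurable fun ω => ∏ k, ‖(σ k ω).charFn (t • modePart k (z a))‖ := fun a =>
    Finset.measurable_prod _ fun k _ => (hσ k _).norm
  have hint : ∀ a, Integrable (fun ω => ∏ k, ‖(σ k ω).charFn (t • modePart k (z a))‖) μ := by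
    intro a
    refine Integrable.of_bound (hmeas a).aestronglyMeasurable 1 (.of_forall fun ω => ?_)
    rw [Real.norm_of_nonneg (Finset.prod_nonneg fun k _ => norm_nonneg _)]
    exact Finset.prod_le_one (fun k _ => norm_nonneg _) fun k _ => (σ k ω).norm_charFn_le_one _
  -- Taking moduli removes the displacement on the left and the phases of the components on the
  -- right.
  have h1 : ∀ a, Real.exp (-((t • z a) ⬝ᵥ γ *ᵥ (t • z a)) / 4) ≤
      ∫ ω, ∏ k, ‖(σ k ω).charFn (t • modePart k (z a))‖ ∂μ := by
    intro a
    rw [← h.norm_charFn, hχ]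
    refine (norm_integral_le_integral_norm _).trans (le_of_eq ?_)
    refine integral_congr_ae (.of_forall fun ω => ?_)
    simp only [norm_prod]
    rfl
  have h2 : ∑ a, (1 - ∫ ω, ∏ k, ‖(σ k ω).charFn (t • modePart k (z a))‖ ∂μ) =
      ∫ ω, ∑ a, (1 - ∏ k, ‖(σ k ω).charFn (t • modePart k (z a))‖) ∂μ := by
    have h3 : ∀ a, Integrable
        (fun ω => 1 - ∏ k, ‖(σ k ω).charFn (t • modePart k (z a))‖) μ := fun a =>
      (integrable_const _).sub (hint a)
    rw [integral_finsetSum _ fun a _ => h3 a]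
    refine Finset.sum_congr rfl fun a _ => ?_
    rw [integral_sub (integrable_const _) (hint a)]
    simp
  -- The bound holds for each `ω` with the same `D`, hence for the average.
  have h3 : t ^ 2 * (R - t * D) / 2 ≤
      ∫ ω, ∑ a, (1 - ∏ k, ‖(σ k ω).charFn (t • modePart k (z a))‖) ∂μ := by
    have : t ^ 2 * (R - t * D) / 2 = ∫ _ω, t ^ 2 * (R - t * D) / 2 ∂μ := by simp
    rw [this]
    refine integral_mono (integrable_const _)
      (integrable_finsetSum _ fun a _ => (integrable_const _).sub (hint a)) fun ω => ?_
    have := hD (fun k => (σ k ω).charFn) (fun k => (σ k ω).isTwistedPos_charFn) t ht ht1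
    show t ^ 2 * (R - t * D) / 2 ≤ ∑ a, (1 - ∏ k, ‖(σ k ω).charFn (t • modePart k (z a))‖)
    linarith
  have h4 : ∑ a, (1 - ∫ ω, ∏ k, ‖(σ k ω).charFn (t • modePart k (z a))‖ ∂μ) ≤
      ∑ a, t ^ 2 * (z a ⬝ᵥ γ *ᵥ z a) / 4 :=
    Finset.sum_le_sum fun a _ => by
      have := one_sub_exp_quadForm_le γ (z a) t
      linarith [h1 a]
  rw [← Finset.sum_div, ← Finset.mul_sum] at h4
  refine le_of_mul_le_mul_left ?_ (pow_pos ht 2)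
  linarith

/-! ### Duality for correlation matrices of products -/

/-- One-mode correlation matrices: real symmetric matrices `g ≥ iJ₁`. -/
def IsCM (g : Matrix (Fin 2) (Fin 2) ℝ) : Prop :=
  g.IsSymm ∧ ∀ x y : Fin 2 → ℝ,
    2 * (x 0 * y 1 - x 1 * y 0) ≤ x ⬝ᵥ g *ᵥ x + y ⬝ᵥ g *ᵥ y

/-- The direct sum of one-mode matrices. -/
def modeSum {n : ℕ} (g : Fin n → Matrix (Fin 2) (Fin 2) ℝ) :
    Matrix (PhaseIdx n) (PhaseIdx n) ℝ :=
  Matrix.of fun j l => if j.1 = l.1 then g j.1 j.2 l.2 else 0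

lemma quadForm_fin_two (g : Matrix (Fin 2) (Fin 2) ℝ) (x : Fin 2 → ℝ) :
    x ⬝ᵥ g *ᵥ x = g 0 0 * x 0 ^ 2 + (g 0 1 + g 1 0) * (x 0 * x 1) + g 1 1 * x 1 ^ 2 := by
  simp [dotProduct, Matrix.mulVec, Fin.sum_univ_two]
  ring

/-- Multiplied by `g 0 0`, the form of `g - iJ₁` becomes two squares plus `(det g - 1)(x₁² + y₁²)`.
Both squares vanish at `x = (1, 0)`, `y = (-g₀₁, g₀₀)`, which makes the determinant condition
necessary. -/
lemma isCM_iff (g : Matrix (Fin 2) (Fin 2) ℝ) :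
    IsCM g ↔ g 0 1 = g 1 0 ∧ 0 < g 0 0 ∧ 1 ≤ g 0 0 * g 1 1 - g 0 1 ^ 2 := by
  constructor
  · rintro ⟨hs, h⟩
    have hs' : g 0 1 = g 1 0 := (hs.apply 0 1).symm
    have ha : 0 < g 0 0 := by
      have h1 := h ![1, 0] ![0, 0]
      have h2 := h ![|g 1 1| + 1, 0] ![0, 1]
      simp at h1 h2
      rcases h1.lt_or_eq with h3 | h3
      · exact h3
      · rw [← h3] at h2
        linarith [le_abs_self (g 1 1), abs_nonneg (g 1 1)]
    refine ⟨hs', ha, ?_⟩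
    have h1 := h ![1, 0] ![-g 0 1, g 0 0]
    simp [← hs'] at h1
    refine le_of_mul_le_mul_left ?_ ha
    linarith
  · rintro ⟨hs, ha, hd⟩
    refine ⟨by ext i j; fin_cases i <;> fin_cases j <;> simp [hs], fun x y => ?_⟩
    rw [quadForm_fin_two, quadForm_fin_two, ← hs]
    refine le_of_mul_le_mul_left ?_ ha
    have := mul_nonneg (sub_nonneg.2 hd) (add_nonneg (sq_nonneg (x 1)) (sq_nonneg (y 1)))
    nlinarith [sq_nonneg (g 0 0 * x 0 + g 0 1 * x 1 - y 1),
      sq_nonneg (g 0 0 * y 0 + g 0 1 * y 1 + x 1)]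

lemma IsCM.quadForm_nonneg {g : Matrix (Fin 2) (Fin 2) ℝ} (h : IsCM g) (x : Fin 2 → ℝ) :
    0 ≤ x ⬝ᵥ g *ᵥ x := by
  simpa using h.2 x 0

lemma isCM_one : IsCM 1 := (isCM_iff _).2 (by simp)

lemma quadForm_add {m : Type} [Fintype m] (M N : Matrix m m ℝ) (x : m → ℝ) :
    x ⬝ᵥ (M + N) *ᵥ x = x ⬝ᵥ M *ᵥ x + x ⬝ᵥ N *ᵥ x := by
  rw [Matrix.add_mulVec, dotProduct_add]

lemma quadForm_sub {m : Type} [Fintype m] (M N : Matrix m m ℝ) (x : m → ℝ) :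
    x ⬝ᵥ (M - N) *ᵥ x = x ⬝ᵥ M *ᵥ x - x ⬝ᵥ N *ᵥ x := by
  rw [Matrix.sub_mulVec, dotProduct_sub]

lemma quadForm_smul {m : Type} [Fintype m] (t : ℝ) (M : Matrix m m ℝ) (x : m → ℝ) :
    x ⬝ᵥ (t • M) *ᵥ x = t * (x ⬝ᵥ M *ᵥ x) := by
  rw [Matrix.smul_mulVec, dotProduct_smul, smul_eq_mul]

lemma posSemidef_real_iff {m : Type} [Fintype m] (M : Matrix m m ℝ) :
    M.PosSemidef ↔ M.IsSymm ∧ ∀ x, 0 ≤ x ⬝ᵥ M *ᵥ x := by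
  rw [Matrix.posSemidef_iff_dotProduct_mulVec]
  rfl

lemma convex_isCM : Convex ℝ {g | IsCM g} := by
  rintro g hg h hh a b ha hb hab
  refine ⟨(hg.1.smul a).add (hh.1.smul b), fun x y => ?_⟩
  simp only [quadForm_add, quadForm_smul]
  have h1 := mul_le_mul_of_nonneg_left (hg.2 x y) ha
  have h2 := mul_le_mul_of_nonneg_left (hh.2 x y) hb
  have : 2 * (x 0 * y 1 - x 1 * y 0) = (a + b) * (2 * (x 0 * y 1 - x 1 * y 0)) := by
    rw [hab, one_mul]
  rw [this]
  linarith

lemma isClosed_isSymm {m : Type} : IsClosed {M : Matrix m m ℝ | M.IsSymm} :=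
  isClosed_eq (Continuous.matrix_transpose continuous_id) continuous_id

lemma continuous_quadForm {m : Type} [Fintype m] (x : m → ℝ) :
    Continuous fun M : Matrix m m ℝ => x ⬝ᵥ M *ᵥ x :=
  continuous_const.dotProduct (continuous_id.matrix_mulVec continuous_const)

lemma isClosed_isCM : IsClosed {g | IsCM g} := by
  have : {g | IsCM g} = {g | g.IsSymm} ∩ ⋂ x : Fin 2 → ℝ, ⋂ y : Fin 2 → ℝ,
      {g | 2 * (x 0 * y 1 - x 1 * y 0) ≤ x ⬝ᵥ g *ᵥ x + y ⬝ᵥ g *ᵥ y} := by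
    ext g; simp [IsCM]
  rw [this]
  exact isClosed_isSymm.inter (isClosed_iInter fun x => isClosed_iInter fun y =>
    isClosed_le continuous_const ((continuous_quadForm x).add (continuous_quadForm y)))

lemma isClosed_posSemidef {m : Type} [Fintype m] : IsClosed {M : Matrix m m ℝ | M.PosSemidef} := by
  have : {M : Matrix m m ℝ | M.PosSemidef} = {M | M.IsSymm} ∩ ⋂ x : m → ℝ,
      {M | 0 ≤ x ⬝ᵥ M *ᵥ x} := by
    ext g; simp [posSemidef_real_iff]
  rw [this]
  exact isClosed_isSymm.inter (isClosed_iInter fun x =>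
    isClosed_le continuous_const (continuous_quadForm x))

lemma continuous_modeSum {n : ℕ} :
    Continuous (modeSum : (Fin n → Matrix (Fin 2) (Fin 2) ℝ) → _) := by
  refine continuous_matrix fun i j => ?_
  simp only [modeSum, Matrix.of_apply]
  split_ifs
  · exact (continuous_apply i.1).matrix_elem _ _
  · exact continuous_const

lemma modeSum_add {n : ℕ} (g h : Fin n → Matrix (Fin 2) (Fin 2) ℝ) :
    modeSum (g + h) = modeSum g + modeSum h := by
  ext i j
  simp only [modeSum, Matrix.of_apply, Matrix.add_apply, Pi.add_apply]
  split_ifs <;> simp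

lemma modeSum_smul {n : ℕ} (t : ℝ) (g : Fin n → Matrix (Fin 2) (Fin 2) ℝ) :
    modeSum (t • g) = t • modeSum g := by
  ext i j
  simp only [modeSum, Matrix.of_apply, Matrix.smul_apply, Pi.smul_apply]
  split_ifs <;> simp

lemma quadForm_modeSum {n : ℕ} (g : Fin n → Matrix (Fin 2) (Fin 2) ℝ) (x : PhaseIdx n → ℝ) :
    x ⬝ᵥ modeSum g *ᵥ x = ∑ k, (fun i => x (k, i)) ⬝ᵥ g k *ᵥ (fun i => x (k, i)) := by
  simp only [dotProduct, Matrix.mulVec, modeSum, Matrix.of_apply, Fintype.sum_prod_type]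
  refine Finset.sum_congr rfl fun k _ => Finset.sum_congr rfl fun i _ => ?_
  congr 1
  rw [Finset.sum_eq_single k]
  · simp
  · intro l _ hl
    simp [hl.symm]
  · simp

/-- The matrices bounded below by the correlation matrix of a product state. -/
def aboveProduct (n : ℕ) : Set (Matrix (PhaseIdx n) (PhaseIdx n) ℝ) :=
  {X | ∃ g : Fin n → Matrix (Fin 2) (Fin 2) ℝ, (∀ k, IsCM (g k)) ∧ (X - modeSum g).PosSemidef}

lemma convex_aboveProduct (n : ℕ) : Convex ℝ (aboveProduct n) := by
  rintro X ⟨g, hg, hX⟩ Y ⟨h, hh, hY⟩ a b ha hb hab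
  refine ⟨a • g + b • h, fun k => convex_isCM (hg k) (hh k) ha hb hab, ?_⟩
  have : a • X + b • Y - modeSum (a • g + b • h) = a • (X - modeSum g) + b • (Y - modeSum h) := by
    rw [modeSum_add, modeSum_smul, modeSum_smul, smul_sub, smul_sub]; abel
  rw [this]
  exact (hX.smul ha).add (hY.smul hb)

/-- The product matrices below a convergent sequence stay bounded: their diagonals lie between zero
and those of the sequence, and the determinant condition controls the off-diagonal entries. A
convergent subsequence gives a product matrix below the limit. -/
lemma isClosed_aboveProduct (n : ℕ) : IsClosed (aboveProduct n) := by
  have : FirstCountableTopology (Matrix (PhaseIdx n) (PhaseIdx n) ℝ) :=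
    inferInstanceAs (FirstCountableTopology (PhaseIdx n → PhaseIdx n → ℝ))
  have : FirstCountableTopology (Matrix (Fin 2) (Fin 2) ℝ) :=
    inferInstanceAs (FirstCountableTopology (Fin 2 → Fin 2 → ℝ))
  refine IsSeqClosed.isClosed fun X Y hX hXY => ?_
  choose g hg hP using hX
  obtain ⟨M, hM⟩ : ∃ M : ℝ, ∀ r j, X r j j ≤ M := by
    have h1 : ∀ j, ∃ M, ∀ r, X r j j ≤ M := by
      intro j
      have : Filter.Tendsto (fun r => X r j j) Filter.atTop (nhds (Y j j)) :=
        ((continuous_id.matrix_elem j j).tendsto Y).comp hXY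
      obtain ⟨M, hM⟩ := this.bddAbove_range
      exact ⟨M, fun r => hM ⟨r, rfl⟩⟩
    choose M hM using h1
    refine ⟨∑ j, |M j|, fun r j => (hM j r).trans ((le_abs_self _).trans ?_)⟩
    exact Finset.single_le_sum (f := fun j => |M j|) (fun _ _ => abs_nonneg _) (Finset.mem_univ j)
  have hdiag : ∀ r k i, 0 ≤ g r k i i ∧ g r k i i ≤ M := by
    intro r k i
    have h1 := (hg r k).quadForm_nonneg (Pi.single i 1)
    have h2 : 0 ≤ (X r - modeSum (g r)) (k, i) (k, i) := (hP r).diag_nonneg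
    have h3 := hM r (k, i)
    simp [modeSum] at h1 h2
    exact ⟨h1, by linarith⟩
  have hbd : ∀ r k i j, g r k i j ∈ Set.Icc (-M) M := by
    intro r k
    have h1 := ((isCM_iff _).1 (hg r k))
    have h0 := hdiag r k 0
    have h2 := hdiag r k 1
    have h3 : |g r k 0 1| ≤ M := abs_le_of_sq_le_sq (by nlinarith) (by linarith)
    rw [abs_le] at h3
    intro i j
    fin_cases i <;> fin_cases j
    · exact ⟨by simp; linarith, h0.2⟩
    · exact h3
    · simp only [Fin.mk_one, Fin.zero_eta, ← h1.1]; exact h3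
    · exact ⟨by simp; linarith, h2.2⟩
  have hcomp : IsCompact {h : Fin n → Matrix (Fin 2) (Fin 2) ℝ |
      ∀ k i j, h k i j ∈ Set.Icc (-M) M} := by
    have : IsCompact (Set.pi Set.univ fun _ : Fin n => Set.pi Set.univ fun _ : Fin 2 =>
        Set.pi Set.univ fun _ : Fin 2 => Set.Icc (-M) M) :=
      isCompact_univ_pi fun _ => isCompact_univ_pi fun _ => isCompact_univ_pi fun _ =>
        isCompact_Icc
    have heq : {h : Fin n → Matrix (Fin 2) (Fin 2) ℝ | ∀ k i j, h k i j ∈ Set.Icc (-M) M} =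
        (Set.pi Set.univ fun _ : Fin n => Set.pi Set.univ fun _ : Fin 2 =>
        Set.pi Set.univ fun _ : Fin 2 => Set.Icc (-M) M : Set (Fin n → Fin 2 → Fin 2 → ℝ)) :=
      Set.ext fun h => ⟨fun hh k _ i _ j _ => hh k i j,
        fun hh k i j => hh k trivial i trivial j trivial⟩
    rw [heq]
    exact this
  obtain ⟨h, -, φ, hφ, hlim⟩ := hcomp.tendsto_subseq (x := g) fun r => hbd r
  refine ⟨h, fun k => ?_, ?_⟩
  · exact isClosed_isCM.mem_of_tendsto (((continuous_apply k).tendsto h).comp hlim)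
      (.of_forall fun r => hg (φ r) k)
  · exact isClosed_posSemidef.mem_of_tendsto
      ((hXY.comp hφ.tendsto_atTop).sub ((continuous_modeSum.tendsto h).comp hlim))
      (.of_forall fun r => hP (φ r))

/-- Let `Z = (r s; s u)` be the Gram matrix of the two coordinate vectors of `y`. The infimum of `tr
(g Z)` over correlation matrices is `2 √(det Z)`, attained at `adj Z / √(det Z)` when `det Z > 0`.
The same number is `4 s(∑ p y, ∑ q y)` for suitable `p`, `q`. If `det Z = 0` the infimum need not be
attained, hence the `ε`. -/
lemma exists_isCM_trace_le {ι : Type} [Fintype ι] (y : ι → PhaseIdx 1 → ℝ) {ε : ℝ} (hε : 0 < ε) :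
    ∃ (g : Matrix (Fin 2) (Fin 2) ℝ) (p q : ι → ℝ), IsCM g ∧ ∑ a, (p a ^ 2 + q a ^ 2) ≤ 1 ∧
      ∑ a, (fun i => y a (0, i)) ⬝ᵥ g *ᵥ (fun i => y a (0, i)) ≤
        4 * symplForm (∑ a, p a • y a) (∑ a, q a • y a) + ε := by
  set r := ∑ a, y a (0, 0) ^ 2 with hr
  set s := ∑ a, y a (0, 0) * y a (0, 1) with hs
  set u := ∑ a, y a (0, 1) ^ 2 with hu
  have hr0 : 0 ≤ r := Finset.sum_nonneg fun a _ => sq_nonneg _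
  have hu0 : 0 ≤ u := Finset.sum_nonneg fun a _ => sq_nonneg _
  have hD : 0 ≤ r * u - s ^ 2 :=
    sub_nonneg.2 (Finset.sum_mul_sq_le_sq_mul_sq _ _ _)
  have htr : ∀ g : Matrix (Fin 2) (Fin 2) ℝ,
      ∑ a, (fun i => y a (0, i)) ⬝ᵥ g *ᵥ (fun i => y a (0, i)) =
        g 0 0 * r + (g 0 1 + g 1 0) * s + g 1 1 * u := by
    intro g
    simp only [quadForm_fin_two, hr, hs, hu, Finset.mul_sum, ← Finset.sum_add_distrib]
  have hsum : ∀ A B C : ℝ, ∑ a, (A * y a (0, 0) ^ 2 + B * (y a (0, 0) * y a (0, 1)) +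
      C * y a (0, 1) ^ 2) = A * r + B * s + C * u := by
    intro A B C
    simp only [hr, hs, hu, Finset.mul_sum, ← Finset.sum_add_distrib]
  rcases hD.lt_or_eq with hD | hD
  · obtain ⟨E, hE⟩ : ∃ E, E = √(r * u - s ^ 2) := ⟨_, rfl⟩
    have hE2 : E ^ 2 = r * u - s ^ 2 := by rw [hE, Real.sq_sqrt hD.le]
    have hE0 : 0 < E := by rw [hE]; exact Real.sqrt_pos.2 hD
    have hrp : 0 < r := by
      rcases hr0.lt_or_eq with h | h
      · exact h
      · rw [← h] at hD; nlinarith [sq_nonneg s]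
    have hup : 0 < u := by
      rcases hu0.lt_or_eq with h | h
      · exact h
      · rw [← h] at hD; nlinarith [sq_nonneg s]
    obtain ⟨c, hc0, hc⟩ : ∃ c : ℝ, 0 < c ∧ c ^ 2 * (2 * r) = 1 :=
      ⟨√((2 * r)⁻¹), Real.sqrt_pos.2 (by positivity), by
        rw [Real.sq_sqrt (by positivity)]; field_simp⟩
    -- Gram-Schmidt: `p` is along the first coordinate vector and `q` along the part of the second
    -- orthogonal to it; `c` gives each the squared length 1/2.
    refine ⟨!![u / E, -s / E; -s / E, r / E], fun a => c * y a (0, 0),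
      fun a => c / E * (r * y a (0, 1) - s * y a (0, 0)), ?_, ?_, ?_⟩
    · rw [isCM_iff]
      refine ⟨by simp, by simp; positivity, ?_⟩
      simp
      apply le_of_eq
      field_simp
      linarith
    · have e : ∑ a, ((c * y a (0, 0)) ^ 2 + (c / E * (r * y a (0, 1) - s * y a (0, 0))) ^ 2) =
          (c ^ 2 + (c / E * s) ^ 2) * r + (-2 * (c / E) ^ 2 * r * s) * s + (c / E * r) ^ 2 * u := by
        rw [← hsum]
        exact Finset.sum_congr rfl fun a _ => by ring
      rw [e]
      have e2 : (c ^ 2 + (c / E * s) ^ 2) * r + (-2 * (c / E) ^ 2 * r * s) * s +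
          (c / E * r) ^ 2 * u = c ^ 2 * r * (1 + (r * u - s ^ 2) / E ^ 2) := by
        field_simp; ring
      rw [e2, ← hE2, div_self (pow_pos hE0 2).ne']
      linarith
    · have e1 : (∑ a, (c * y a (0, 0)) • y a) (0, 0) = c * r := by
        have := hsum c 0 0
        rw [Finset.sum_apply, show c * r = c * r + 0 * s + 0 * u by ring, ← this]
        exact Finset.sum_congr rfl fun a _ => by simp; ring
      have e2 : (∑ a, (c / E * (r * y a (0, 1) - s * y a (0, 0))) • y a) (0, 0) = 0 := by
        have := hsum (-(c / E * s)) (c / E * r) 0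
        rw [Finset.sum_apply,
          show (0 : ℝ) = -(c / E * s) * r + c / E * r * s + 0 * u by ring, ← this]
        exact Finset.sum_congr rfl fun a _ => by simp; ring
      have e3 : (∑ a, (c / E * (r * y a (0, 1) - s * y a (0, 0))) • y a) (0, 1) = c * E := by
        have := hsum 0 (-(c / E * s)) (c / E * r)
        rw [Finset.sum_apply, show c * E = 0 * r + -(c / E * s) * s + c / E * r * u by
          field_simp; linear_combination c * hE2, ← this]
        exact Finset.sum_congr rfl fun a _ => by simp; ring
      have e4 : symplForm (∑ a, (c * y a (0, 0)) • y a)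
          (∑ a, (c / E * (r * y a (0, 1) - s * y a (0, 0))) • y a) = E / 2 := by
        rw [symplForm, Fin.sum_univ_one, e1, e2, e3]
        linear_combination E / 2 * hc
      rw [htr, e4]
      simp only [Matrix.of_apply, Matrix.cons_val_zero, Matrix.cons_val_one, Matrix.cons_val',
        Matrix.cons_val_fin_one]
      have : u / E * r + (-s / E + -s / E) * s + r / E * u = 2 * E := by
        field_simp; linarith
      linarith
  -- Singular `Z` is replaced by `Z + δ`, of determinant `E² = δ² + δ(r + u)`. Then `adj (Z + δ) /
  -- E` has the value `δ(r + u) / E ≤ 2E ≤ ε`, and `p = q = 0` suffices.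
  · obtain ⟨δ, hδ0, hδ⟩ : ∃ δ : ℝ, 0 < δ ∧ 4 * (δ ^ 2 + δ * (r + u)) ≤ ε ^ 2 := by
      refine ⟨min 1 (ε ^ 2 / (4 * (1 + (r + u)))), by positivity, ?_⟩
      have h1 := min_le_left 1 (ε ^ 2 / (4 * (1 + (r + u))))
      have h2 := min_le_right 1 (ε ^ 2 / (4 * (1 + (r + u))))
      have h0 : 0 < min 1 (ε ^ 2 / (4 * (1 + (r + u)))) := by positivity
      generalize min 1 (ε ^ 2 / (4 * (1 + (r + u)))) = δ at *
      rw [le_div_iff₀ (by positivity)] at h2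
      nlinarith
    obtain ⟨E, hE⟩ : ∃ E, E = √(δ ^ 2 + δ * (r + u)) := ⟨_, rfl⟩
    have hE2 : E ^ 2 = δ ^ 2 + δ * (r + u) := by rw [hE, Real.sq_sqrt (by positivity)]
    have hE0 : 0 < E := by rw [hE]; exact Real.sqrt_pos.2 (by positivity)
    refine ⟨!![(u + δ) / E, -s / E; -s / E, (r + δ) / E], 0, 0, ?_, by simp, ?_⟩
    · rw [isCM_iff]
      refine ⟨by simp, by simp; positivity, ?_⟩
      simp
      apply le_of_eq
      field_simp
      linarith
    · rw [htr]
      simp [symplForm_zero_left]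
      have h2E : 2 * E ≤ ε := by
        refine le_of_sq_le_sq ?_ hε.le
        nlinarith
      refine le_trans ?_ h2E
      have : (u + δ) / E * r + (-s / E + -s / E) * s + (r + δ) / E * u =
          (2 * (r * u - s ^ 2) + δ * (r + u)) / E := by field_simp; ring
      rw [this, ← hD, div_le_iff₀ hE0]
      nlinarith

/-- A real symmetric matrix lies above the correlation matrix of a product state if it satisfies
all the linear inequalities valid for those matrices. -/
theorem mem_aboveProduct {n : ℕ} {γ : Matrix (PhaseIdx n) (PhaseIdx n) ℝ} (hγ : γ.IsSymm)
    (H : ∀ (m : ℕ) (z : Fin m → PhaseIdx n → ℝ) (p q : Fin n → Fin m → ℝ),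
      (∀ k, ∑ a, (p k a ^ 2 + q k a ^ 2) ≤ 1) →
      ∑ k, 4 * symplForm (∑ a, p k a • modePart k (z a)) (∑ a, q k a • modePart k (z a)) ≤
        ∑ a, z a ⬝ᵥ γ *ᵥ z a) : γ ∈ aboveProduct n := by
  classical
  have : LocallyConvexSpace ℝ (Matrix (PhaseIdx n) (PhaseIdx n) ℝ) :=
    inferInstanceAs (LocallyConvexSpace ℝ (PhaseIdx n → PhaseIdx n → ℝ))
  by_contra hmem
  obtain ⟨f, u, hfγ, hf⟩ := geometric_hahn_banach_point_closed (convex_aboveProduct n)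
    (isClosed_aboveProduct n) hmem
  let Z : Matrix (PhaseIdx n) (PhaseIdx n) ℝ := Matrix.of fun i j =>
    (f (Matrix.single i j 1) + f (Matrix.single j i 1)) / 2
  have hfsum : ∀ X, f X = ∑ i, ∑ j, X i j * f (Matrix.single i j 1) := by
    intro X
    conv_lhs => rw [Matrix.matrix_eq_sum_single X]
    simp only [map_sum]
    refine Finset.sum_congr rfl fun i _ => Finset.sum_congr rfl fun j _ => ?_
    rw [← smul_eq_mul, ← map_smul, Matrix.smul_single, smul_eq_mul, mul_one]
  have hfZ : ∀ X : Matrix (PhaseIdx n) (PhaseIdx n) ℝ, X.IsSymm →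
      f X = ∑ i, ∑ j, X i j * Z i j := by
    intro X hX
    have h1 := hfsum X
    have h2 : f X = ∑ i, ∑ j, X i j * f (Matrix.single j i 1) := by
      rw [h1, Finset.sum_comm]
      refine Finset.sum_congr rfl fun i _ => Finset.sum_congr rfl fun j _ => ?_
      rw [hX.apply]
    have h3 : f X = (f X + f X) / 2 := by ring
    rw [h3]
    nth_rewrite 1 [h1]
    rw [h2, ← Finset.sum_add_distrib, Finset.sum_div]
    refine Finset.sum_congr rfl fun i _ => ?_
    rw [← Finset.sum_add_distrib, Finset.sum_div]
    refine Finset.sum_congr rfl fun j _ => ?_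
    simp only [Z, Matrix.of_apply]; ring
  have hZsymm : Z.IsSymm := by
    ext i j; simp only [Z, Matrix.transpose_apply, Matrix.of_apply]; ring
  have hone : modeSum (fun _ : Fin n => (1 : Matrix (Fin 2) (Fin 2) ℝ)) ∈ aboveProduct n :=
    ⟨_, fun _ => isCM_one, by rw [sub_self]; exact Matrix.PosSemidef.zero⟩
  -- `aboveProduct n` is stable under adding positive matrices, so a functional bounded below on it
  -- cannot be negative on any `v vᵀ`.
  have hZ : Z.PosSemidef := by
    rw [posSemidef_real_iff]
    refine ⟨hZsymm, fun v => ?_⟩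
    have hvv : (Matrix.vecMulVec v v).PosSemidef := by
      have := Matrix.posSemidef_vecMulVec_self_star v
      simpa using this
    have h1 : f (Matrix.vecMulVec v v) = v ⬝ᵥ Z *ᵥ v := by
      rw [hfZ (Matrix.vecMulVec v v) ((posSemidef_real_iff _).1 hvv).1]
      simp only [dotProduct, Matrix.mulVec, Finset.mul_sum, Matrix.vecMulVec_apply]
      refine Finset.sum_congr rfl fun i _ => Finset.sum_congr rfl fun j _ => by ring
    rw [← h1]
    by_contra hneg
    push Not at hneg
    obtain ⟨X₀, hX₀⟩ : ∃ X₀, X₀ ∈ aboveProduct n := ⟨_, hone⟩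
    have h2 : ∀ t : ℝ, 0 ≤ t → u < f X₀ + t * f (Matrix.vecMulVec v v) := by
      intro t ht
      have := hf (X₀ + t • Matrix.vecMulVec v v) (by
        obtain ⟨g, hg, hP⟩ := hX₀
        refine ⟨g, hg, ?_⟩
        rw [add_sub_right_comm]
        exact hP.add (hvv.smul ht))
      rwa [map_add, map_smul, smul_eq_mul] at this
    have h3 := h2 0 le_rfl
    have h4 := h2 ((u - f X₀) / f (Matrix.vecMulVec v v))
      (div_nonneg_of_nonpos (by linarith) hneg.le)
    rw [div_mul_cancel₀ _ hneg.ne] at h4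
    linarith
  obtain ⟨m, z, hz⟩ := Matrix.posSemidef_iff_eq_sum_vecMulVec.1 hZ
  have hfz : ∀ X : Matrix (PhaseIdx n) (PhaseIdx n) ℝ, X.IsSymm →
      f X = ∑ a, z a ⬝ᵥ X *ᵥ z a := by
    intro X hX
    rw [hfZ X hX, hz]
    simp only [Matrix.sum_apply, Matrix.vecMulVec_apply, star_trivial, dotProduct, Matrix.mulVec,
      Finset.mul_sum]
    rw [Finset.sum_comm_cycle]
    refine Finset.sum_congr rfl fun a _ => Finset.sum_congr rfl fun i _ =>
      Finset.sum_congr rfl fun j _ => by ring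
  -- The gap of the strict separation is shared among the modes, each of which is minimized
  -- separately up to `ε`.
  obtain ⟨ε, hε, hεn⟩ : ∃ ε : ℝ, 0 < ε ∧ n * ε ≤ u - f γ := by
    refine ⟨(u - f γ) / (n + 1), div_pos (by linarith) (by positivity), ?_⟩
    rw [mul_div_assoc', div_le_iff₀ (by positivity)]
    nlinarith
  choose g p q hg hpq hle using fun k => exists_isCM_trace_le (fun a => modePart k (z a)) hε
  have h1 := H m z p q hpq
  rw [← hfz γ hγ] at h1
  have hgs : (modeSum g).IsSymm := by
    ext i j
    simp only [modeSum, Matrix.transpose_apply, Matrix.of_apply]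
    by_cases h : i.1 = j.1
    · rw [if_pos h, if_pos h.symm, ← h, (hg i.1).1.apply]
    · rw [if_neg h, if_neg (Ne.symm h)]
  have h2 := hf (modeSum g) ⟨g, hg, by rw [sub_self]; exact Matrix.PosSemidef.zero⟩
  have h3 : f (modeSum g) ≤ f γ + n * ε := by
    rw [hfz _ hgs]
    simp only [quadForm_modeSum]
    rw [Finset.sum_comm]
    refine (Finset.sum_le_sum fun k _ => hle k).trans ?_
    rw [Finset.sum_add_distrib]
    simp
    exact h1
  linarith

/-! ### Displaced pure Gaussian states and their mixtures -/

/-- Needed because the vectors of a state are classes in `Lp`, whose representatives equal a given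
wave function only almost everywhere. -/
lemma weylExp_congr_ae {n : ℕ} {f g : (Fin n → ℝ) → ℂ} (h : f =ᵐ[volume] g)
    (x : PhaseIdx n → ℝ) : weylExp f x = weylExp g x := by
  refine integral_congr_ae ?_
  have h2 : (fun s : Fin n → ℝ => f (s - fun k => x (k, 1))) =ᵐ[volume]
      fun s => g (s - fun k => x (k, 1)) :=
    (measurePreserving_sub_right volume _).quasiMeasurePreserving.ae_eq_comp h
  filter_upwards [h, h2] with s hs hs2
  have hs2' : f (fun k => s k - x (k, 1)) = g (fun k => s k - x (k, 1)) := hs2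
  simp only [weylOp, hs, hs2']

/-- The pure state given by a normalized wave function. -/
noncomputable def ModeState.pure {n : ℕ} (ψ : (Fin n → ℝ) → ℂ) (hψ : MemLp ψ 2)
    (h1 : weylExp ψ 0 = 1) : ModeState n where
  weight j := if j = 0 then 1 else 0
  vec _ := hψ.toLp ψ
  weight_nonneg j := by positivity
  weight_hasSum := hasSum_ite_eq 0 1
  norm_vec _ := by
    have h := L2.inner_def (𝕜 := ℂ) (hψ.toLp ψ) (hψ.toLp ψ)
    have h2 : ∫ s, inner ℂ (hψ.toLp ψ s) (hψ.toLp ψ s) = weylExp ψ 0 := by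
      rw [weylExp, weylOp_zero]
      refine integral_congr_ae ?_
      filter_upwards [hψ.coeFn_toLp] with s hs
      rw [hs, RCLike.inner_apply, mul_comm]
    rw [h2, h1] at h
    have h3 := norm_sq_eq_re_inner (𝕜 := ℂ) (hψ.toLp ψ)
    rw [h] at h3
    have h4 : ‖hψ.toLp ψ‖ ^ 2 = 1 := by simpa using h3
    exact (pow_eq_one_iff_of_nonneg (norm_nonneg _) two_ne_zero).1 h4

lemma ModeState.charFn_pure {n : ℕ} (ψ : (Fin n → ℝ) → ℂ) (hψ : MemLp ψ 2)
    (h1 : weylExp ψ 0 = 1) (x : PhaseIdx n → ℝ) :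
    (ModeState.pure ψ hψ h1).charFn x = weylExp ψ x := by
  rw [ModeState.charFn_eq, tsum_eq_single 0]
  · simp only [ModeState.pure, if_true, Complex.ofReal_one, one_mul]
    exact weylExp_congr_ae hψ.coeFn_toLp x
  · intro j hj
    simp [ModeState.pure, hj]

lemma weylOp_weylOp {n : ℕ} (x u : PhaseIdx n → ℝ) (ψ : (Fin n → ℝ) → ℂ) (s : Fin n → ℝ) :
    weylOp x (weylOp u ψ) s =
      Complex.exp (-(Complex.I * (symplForm x u : ℝ) / 2)) * weylOp (x + u) ψ s := by
  have e2 : (fun k => (fun k => s k - x (k, 1)) k - u (k, 1)) = fun k => s k - (x + u) (k, 1) := by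
    funext k; simp; ring
  rw [weylOp, weylOp, weylOp, e2, ← mul_assoc, ← mul_assoc, ← Complex.exp_add, ← Complex.exp_add]
  congr 2
  simp only [symplForm, Pi.add_apply]
  have key : -(∑ k, x (k, 0) * s k) + (1/2) * (∑ k, x (k, 0) * x (k, 1))
      - (∑ k, u (k, 0) * (s k - x (k, 1))) + (1/2) * (∑ k, u (k, 0) * u (k, 1)) =
      -(1/2) * (∑ k, (x (k, 0) * u (k, 1) - x (k, 1) * u (k, 0)))
      - (∑ k, (x (k, 0) + u (k, 0)) * s k)
      + (1/2) * ∑ k, (x (k, 0) + u (k, 0)) * (x (k, 1) + u (k, 1)) := by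
    simp only [Finset.mul_sum, ← Finset.sum_neg_distrib, ← Finset.sum_add_distrib,
      ← Finset.sum_sub_distrib]
    exact Finset.sum_congr rfl fun k _ => by ring
  have key' := congrArg (fun r : ℝ => Complex.I * (r : ℂ)) key
  simp only [Complex.ofReal_add, Complex.ofReal_sub, Complex.ofReal_mul, Complex.ofReal_neg,
    Complex.ofReal_one, Complex.ofReal_div, Complex.ofReal_ofNat] at key'
  linear_combination key'

/-- `D(u)* D(x) D(u) = exp (i s(u,x)) D(x)`: a displacement acts on characteristic functions by a
phase. -/
lemma weylExp_weylOp {n : ℕ} (u x : PhaseIdx n → ℝ) (ψ : (Fin n → ℝ) → ℂ) :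
    weylExp (weylOp u ψ) x = Complex.exp (Complex.I * (symplForm u x : ℝ)) * weylExp ψ x := by
  have h : ∀ s, conj (weylOp u ψ s) * weylOp x (weylOp u ψ) s =
      Complex.exp (-(Complex.I * (symplForm x u : ℝ) / 2)) *
        (conj (weylOp u ψ s) * weylOp (x + u) ψ s) := fun s => by
    rw [weylOp_weylOp]; ring
  rw [weylExp]
  simp_rw [h]
  rw [integral_const_mul, integral_conj_weylOp_mul, add_sub_cancel_right, ← mul_assoc,
    ← Complex.exp_add]
  congr 2
  rw [symplForm_add_right, symplForm_self, symplForm_swap x u]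
  push_cast; ring

/-- A Gaussian wave function of one mode. -/
noncomputable def gaussWave (a b : ℝ) (s : Fin 1 → ℝ) : ℂ :=
  ((√(√(Real.pi * a)))⁻¹ : ℝ) * Complex.exp (-((1 - Complex.I * b) / (2 * a)) * (s 0 : ℂ) ^ 2)

lemma continuous_gaussWave (a b : ℝ) : Continuous (gaussWave a b) := by
  unfold gaussWave
  fun_prop

lemma memLp_gaussWave {a : ℝ} (ha : 0 < a) (b : ℝ) : MemLp (gaussWave a b) 2 := by
  rw [memLp_two_iff_integrable_sq_norm (continuous_gaussWave a b).aestronglyMeasurable]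
  have h : ∀ s, ‖gaussWave a b s‖ ^ 2 =
      ((√(√(Real.pi * a)))⁻¹) ^ 2 * Real.exp (-(1 / a) * (s 0) ^ 2) := by
    intro s
    rw [gaussWave, norm_mul, mul_pow, Complex.norm_real, Complex.norm_exp, ← Real.exp_nat_mul,
      Real.norm_eq_abs, sq_abs]
    congr 2
    have : (-((1 - Complex.I * b) / (2 * a)) * (s 0 : ℂ) ^ 2) =
        ((-(1 / (2 * a)) * s 0 ^ 2 : ℝ) : ℂ) + ((b / (2 * a) * s 0 ^ 2 : ℝ) : ℂ) * Complex.I := by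
      push_cast
      field_simp
      ring
    rw [this, Complex.add_re, Complex.ofReal_re, Complex.re_ofReal_mul, Complex.I_re]
    push_cast
    field_simp
    ring
  simp_rw [h]
  refine Integrable.const_mul ?_ _
  have := integrable_exp_neg_mul_sq (b := 1 / a) (by positivity)
  exact ((volume_preserving_funUnique (Fin 1) ℝ).integrable_comp_emb
    (MeasurableEquiv.measurableEmbedding _)).2 this

/-- A Gaussian integral. The resulting matrix `(a b; b (1 + b²)/a)` is the general positive
symmetric matrix of determinant one. -/
lemma weylExp_gaussWave {a : ℝ} (ha : 0 < a) (b : ℝ) (x : PhaseIdx 1 → ℝ) :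
    weylExp (gaussWave a b) x = Complex.exp (-((a * x (0, 0) ^ 2 + 2 * b * (x (0, 0) * x (0, 1)) +
      (1 + b ^ 2) / a * x (0, 1) ^ 2 : ℝ) : ℂ) / 4) := by
  have ha' : (a : ℂ) ≠ 0 := by exact_mod_cast ha.ne'
  set K : ℝ := (√(√(Real.pi * a)))⁻¹ with hK
  have hK2 : (K : ℂ) ^ 2 * (Real.pi * a : ℂ) ^ (1 / 2 : ℂ) = 1 := by
    have h1 : (Real.pi * a : ℂ) ^ (1 / 2 : ℂ) = ((√(Real.pi * a) : ℝ) : ℂ) := by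
      rw [Real.sqrt_eq_rpow, Complex.ofReal_cpow (by positivity)]
      push_cast; rfl
    rw [h1]
    have h2 : K ^ 2 * √(Real.pi * a) = 1 := by
      rw [hK, inv_pow, Real.sq_sqrt (Real.sqrt_nonneg _)]
      exact inv_mul_cancel₀ (Real.sqrt_pos.2 (by positivity)).ne'
    exact_mod_cast h2
  have h : ∀ s : Fin 1 → ℝ, conj (gaussWave a b s) * weylOp x (gaussWave a b) s =
      (K : ℂ) ^ 2 * Complex.exp ((-(1 / a) : ℂ) * (s 0 : ℂ) ^ 2 +
        (-Complex.I * x (0, 0) + (1 - Complex.I * b) * x (0, 1) / a) * (s 0 : ℂ) +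
        (Complex.I * x (0, 0) * x (0, 1) / 2 - (1 - Complex.I * b) * x (0, 1) ^ 2 / (2 * a))) := by
    intro s
    simp only [gaussWave, weylOp, Fin.sum_univ_one, ← hK]
    rw [map_mul, Complex.conj_ofReal, ← Complex.exp_conj]
    rw [show ∀ p q r t : ℂ, p * q * (r * (p * t)) = p ^ 2 * (q * (r * t)) by intros; ring,
      ← Complex.exp_add, ← Complex.exp_add]
    congr 2
    simp only [map_mul, map_neg, map_div₀, map_sub, map_one, Complex.conj_I, Complex.conj_ofReal,
      map_pow, map_ofNat]
    push_cast
    field_simp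
    ring
  have h0 : ∀ F : ℝ → ℂ, ∫ s : Fin 1 → ℝ, F (s 0) = ∫ s, F s := fun F =>
    (volume_preserving_funUnique (Fin 1) ℝ).integral_comp
      (MeasurableEquiv.measurableEmbedding _) F
  rw [weylExp]
  simp_rw [h]
  rw [integral_const_mul, h0 fun s => Complex.exp ((-(1 / a) : ℂ) * (s : ℂ) ^ 2 +
        (-Complex.I * x (0, 0) + (1 - Complex.I * b) * x (0, 1) / a) * (s : ℂ) +
        (Complex.I * x (0, 0) * x (0, 1) / 2 - (1 - Complex.I * b) * x (0, 1) ^ 2 / (2 * a))),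
    integral_cexp_quadratic (by
      rw [show (-(1 / (a : ℂ))) = ((-(1 / a) : ℝ) : ℂ) by push_cast; rfl, Complex.ofReal_re]
      simp only [Left.neg_neg_iff]; positivity)]
  rw [show (Real.pi : ℂ) / -(-(1 / (a : ℂ))) = Real.pi * a by field_simp, ← mul_assoc, hK2, one_mul]
  congr 1
  push_cast
  field_simp
  ring_nf
  simp only [Complex.I_sq]
  ring

/-- The displaced pure Gaussian state of one mode. -/
noncomputable def gaussState {a : ℝ} (ha : 0 < a) (b : ℝ) (u : PhaseIdx 1 → ℝ) : ModeState 1 :=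
  ModeState.pure (weylOp u (gaussWave a b)) (memLp_weylOp u (memLp_gaussWave ha b)) (by
    rw [weylExp_weylOp, weylExp_gaussWave ha]
    simp [symplForm_zero_right])

lemma charFn_gaussState {g : Matrix (Fin 2) (Fin 2) ℝ} (hs : g 0 1 = g 1 0) (ha : 0 < g 0 0)
    (hd : g 0 0 * g 1 1 - g 0 1 ^ 2 = 1) (u x : PhaseIdx 1 → ℝ) :
    (gaussState ha (g 0 1) u).charFn x = Complex.exp (Complex.I * (symplForm u x : ℝ)) *
      Complex.exp (-(((fun i => x (0, i)) ⬝ᵥ g *ᵥ (fun i => x (0, i)) : ℝ) : ℂ) / 4) := by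
  rw [gaussState, ModeState.charFn_pure, weylExp_weylOp, weylExp_gaussWave ha, quadForm_fin_two]
  congr 5
  rw [← hs]
  have : g 1 1 = (1 + g 0 1 ^ 2) / g 0 0 := by field_simp; linarith
  rw [this]; ring

/-- The variance 1/2 fits the normalization `exp (-xᵀγx/4)`: a random displacement along `z` with
this law adds `z zᵀ` to the correlation matrix. -/
lemma integral_gaussian_pi {m : ℕ} (y : Fin m → ℝ) :
    ∫ ω : Fin m → ℝ, Complex.exp (-Complex.I * ((∑ a, ω a * y a : ℝ) : ℂ))
      ∂(Measure.pi fun _ => ProbabilityTheory.gaussianReal 0 (1 / 2)) =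
      Complex.exp (-((∑ a, y a ^ 2 : ℝ) : ℂ) / 4) := by
  have h : ∀ ω : Fin m → ℝ, Complex.exp (-Complex.I * ((∑ a, ω a * y a : ℝ) : ℂ)) =
      ∏ a, Complex.exp (-Complex.I * (ω a * y a : ℝ)) := by
    intro ω
    rw [← Complex.exp_sum]
    push_cast
    rw [Finset.mul_sum]
  simp_rw [h]
  rw [integral_fintype_prod_eq_prod (𝕜 := ℂ)
    (fun a (r : ℝ) => Complex.exp (-Complex.I * (r * y a : ℝ)))]
  have h2 : ∀ a, ∫ r : ℝ, Complex.exp (-Complex.I * (r * y a : ℝ))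
      ∂(ProbabilityTheory.gaussianReal 0 (1 / 2)) = Complex.exp (-((y a ^ 2 : ℝ) : ℂ) / 4) := by
    intro a
    have := ProbabilityTheory.charFun_gaussianReal (μ := 0) (v := 1 / 2) (-y a)
    rw [charFun_apply_real] at this
    convert this using 1
    · refine integral_congr_ae (.of_forall fun r => ?_)
      simp only
      congr 1
      push_cast; ring
    · congr 1
      push_cast; ring
  simp_rw [h2]
  rw [← Complex.exp_sum, ← Finset.sum_div, Finset.sum_neg_distrib]
  push_cast; rfl

lemma exists_det_eq_one {g : Matrix (Fin 2) (Fin 2) ℝ} (hg : IsCM g) :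
    ∃ h : Matrix (Fin 2) (Fin 2) ℝ, h 0 1 = h 1 0 ∧ 0 < h 0 0 ∧ h 0 0 * h 1 1 - h 0 1 ^ 2 = 1 ∧
      (g - h).PosSemidef := by
  obtain ⟨hs, ha, hd⟩ := (isCM_iff g).1 hg
  obtain ⟨E, hE⟩ : ∃ E, E = √(g 0 0 * g 1 1 - g 0 1 ^ 2) := ⟨_, rfl⟩
  have hE1 : 1 ≤ E := by rw [hE]; exact Real.one_le_sqrt.2 hd
  have hE2 : E ^ 2 = g 0 0 * g 1 1 - g 0 1 ^ 2 := by rw [hE, Real.sq_sqrt (by linarith)]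
  have hE0 : 0 < E := by linarith
  refine ⟨E⁻¹ • g, by simp [hs], by simp; positivity, ?_, ?_⟩
  · simp
    field_simp
    linarith
  · rw [posSemidef_real_iff]
    refine ⟨hg.1.sub (hg.1.smul _), fun x => ?_⟩
    rw [quadForm_sub, quadForm_smul]
    have := hg.quadForm_nonneg x
    have h1 : E⁻¹ ≤ 1 := inv_le_one_of_one_le₀ hE1
    nlinarith

/-- A Gaussian state whose correlation matrix lies above that of a product state is fully
separable. -/
theorem ModeState.IsGaussian.isFullySeparable {n : ℕ} {ρ : ModeState n}
    {γ : Matrix (PhaseIdx n) (PhaseIdx n) ℝ} {d : PhaseIdx n → ℝ} (h : ρ.IsGaussian γ d)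
    (hγ : γ ∈ aboveProduct n) : ρ.IsFullySeparable := by
  obtain ⟨g₀, hg₀, hP₀⟩ := hγ
  choose g hs ha hd hgP using fun k => exists_det_eq_one (hg₀ k)
  have hP : (γ - modeSum g).PosSemidef := by
    have h1 : (modeSum (fun k => g₀ k - g k)).PosSemidef := by
      rw [posSemidef_real_iff]
      refine ⟨?_, fun x => ?_⟩
      · ext i j
        simp only [modeSum, Matrix.transpose_apply, Matrix.of_apply]
        by_cases h : i.1 = j.1
        · rw [if_pos h, if_pos h.symm, ← h, ((posSemidef_real_iff _).1 (hgP i.1)).1.apply]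
        · rw [if_neg h, if_neg (Ne.symm h)]
      · rw [quadForm_modeSum]
        exact Finset.sum_nonneg fun k _ => ((posSemidef_real_iff _).1 (hgP k)).2 _
    have h2 : γ - modeSum g = (γ - modeSum g₀) + modeSum (fun k => g₀ k - g k) := by
      have : modeSum g₀ = modeSum (fun k => g₀ k - g k) + modeSum g := by
        rw [← modeSum_add]; congr 1; funext k; simp
      rw [this]; abel
    rw [h2]
    exact hP₀.add h1
  obtain ⟨m, z, hz⟩ := Matrix.posSemidef_iff_eq_sum_vecMulVec.1 hP
  have hquad : ∀ x : PhaseIdx n → ℝ, x ⬝ᵥ γ *ᵥ x =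
      ∑ a, (z a ⬝ᵥ x) ^ 2 + ∑ k, (fun i => x (k, i)) ⬝ᵥ g k *ᵥ (fun i => x (k, i)) := by
    intro x
    rw [← quadForm_modeSum, ← sub_eq_iff_eq_add, ← quadForm_sub, hz, Matrix.sum_mulVec,
      dotProduct_sum]
    refine Finset.sum_congr rfl fun a _ => ?_
    rw [Matrix.vecMulVec_mulVec]
    simp [dotProduct_comm x, sq]
  let v : (Fin m → ℝ) → PhaseIdx n → ℝ := fun ω => (∑ a, ω a • z a) + d
  -- `u` is `v` rotated by a quarter turn in each mode, so that `s(u, x)` summed over the modes is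
  -- `-v·x`.
  let u : Fin n → (Fin m → ℝ) → PhaseIdx 1 → ℝ := fun k ω j =>
    if j.2 = 0 then -v ω (k, 1) else v ω (k, 0)
  have hu : ∀ ω x, ∑ k, symplForm (u k ω) (modePart k x) = -∑ a, ω a * (z a ⬝ᵥ x) - d ⬝ᵥ x := by
    intro ω x
    have h1 : ∑ k, symplForm (u k ω) (modePart k x) = -(v ω ⬝ᵥ x) := by
      simp only [dotProduct, Fintype.sum_prod_type, symplForm, Fin.sum_univ_one, u, modePart,
        Fin.sum_univ_two, ← Finset.sum_neg_distrib]
      refine Finset.sum_congr rfl fun k _ => ?_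
      simp; ring
    rw [h1]
    simp only [v, add_dotProduct, sum_dotProduct, smul_dotProduct, smul_eq_mul]
    ring
  refine ⟨Fin m → ℝ, inferInstance, Measure.pi fun _ => ProbabilityTheory.gaussianReal 0 (1 / 2),
    inferInstance, fun k ω => gaussState (ha k) (g k 0 1) (u k ω), fun k y => ?_, fun x => ?_⟩
  · simp only [charFn_gaussState (hs k) (ha k) (hd k)]
    refine Continuous.measurable ?_
    have hv : Continuous v := by fun_prop
    have hv' : ∀ j, Continuous fun ω => v ω j := fun j => (continuous_apply j).comp hv
    have : Continuous fun ω => symplForm (u k ω) y := by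
      simp only [symplForm, Fin.sum_univ_one, u]
      have := hv' (k, 0)
      have := hv' (k, 1)
      simp
      fun_prop
    fun_prop
  · rw [h.2 x]
    have h1 : ∀ ω : Fin m → ℝ, ∏ k, (gaussState (ha k) (g k 0 1) (u k ω)).charFn (modePart k x) =
        Complex.exp (-(((∑ k, (fun i => x (k, i)) ⬝ᵥ g k *ᵥ (fun i => x (k, i)) : ℝ)) : ℂ) / 4
          - Complex.I * ((d ⬝ᵥ x : ℝ) : ℂ)) *
        Complex.exp (-Complex.I * ((∑ a, ω a * (z a ⬝ᵥ x) : ℝ) : ℂ)) := by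
      intro ω
      simp only [charFn_gaussState (hs _) (ha _) (hd _)]
      rw [Finset.prod_mul_distrib, ← Complex.exp_sum, ← Complex.exp_sum, ← Complex.exp_add,
        ← Complex.exp_add]
      congr 1
      rw [← Finset.mul_sum, ← Complex.ofReal_sum, hu]
      simp only [modePart]
      rw [← Finset.sum_div, Finset.sum_neg_distrib, ← Complex.ofReal_sum]
      push_cast; ring
    refine Eq.trans ?_ (integral_congr_ae (.of_forall fun ω => (h1 ω).symm))
    rw [integral_const_mul, integral_gaussian_pi, ← Complex.exp_add, hquad]
    congr 1
    push_cast; ring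

/-! ### Schur complements with generalized inverses -/

/-- Zero eigenvalues cause no harm in `B G B = B`, since `0 · 0⁻¹ · 0 = 0`. Hermiticity and this
identity are all that the Schur complement criterion uses. -/
lemma Matrix.IsHermitian.exists_generalizedInverse {𝕜 m : Type} [RCLike 𝕜] [Fintype m]
    [DecidableEq m] {B : Matrix m m 𝕜} (hB : B.IsHermitian) :
    ((hB.eigenvectorUnitary : Matrix m m 𝕜)
      * Matrix.diagonal (fun i => (((hB.eigenvalues i)⁻¹ : ℝ) : 𝕜))
      * star (hB.eigenvectorUnitary : Matrix m m 𝕜)).IsHermitian ∧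
    B * ((hB.eigenvectorUnitary : Matrix m m 𝕜)
      * Matrix.diagonal (fun i => (((hB.eigenvalues i)⁻¹ : ℝ) : 𝕜))
      * star (hB.eigenvectorUnitary : Matrix m m 𝕜)) * B = B := by
  have hs := hB.spectral_theorem
  rw [Unitary.conjStarAlgAut_apply] at hs
  have hU : star (hB.eigenvectorUnitary : Matrix m m 𝕜) * (hB.eigenvectorUnitary : Matrix m m 𝕜) = 1 :=
    Unitary.coe_star_mul_self _
  generalize (hB.eigenvectorUnitary : Matrix m m 𝕜) = U at *
  generalize hB.eigenvalues = l at *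
  constructor
  · rw [Matrix.IsHermitian, Matrix.conjTranspose_mul, Matrix.conjTranspose_mul,
      Matrix.star_eq_conjTranspose, Matrix.conjTranspose_conjTranspose,
      Matrix.diagonal_conjTranspose, Matrix.mul_assoc]
    congr 3
    funext i
    simp
  · rw [hs]
    have : ∀ D₁ D₂ D₃ : Matrix m m 𝕜, U * D₁ * star U * (U * D₂ * star U) * (U * D₃ * star U) =
        U * (D₁ * D₂ * D₃) * star U := by
      intro D₁ D₂ D₃
      calc _ = U * D₁ * (star U * U) * D₂ * (star U * U) * D₃ * star U := by
            simp only [Matrix.mul_assoc]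
        _ = _ := by rw [hU]; simp only [Matrix.mul_assoc, Matrix.mul_one]
    rw [this, Matrix.diagonal_mul_diagonal, Matrix.diagonal_mul_diagonal]
    congr 3
    funext i
    simp only [Function.comp]
    by_cases h : l i = 0
    · simp [h]
    · have : ((l i : ℝ) : 𝕜) ≠ 0 := by exact_mod_cast h
      push_cast
      field_simp

lemma isHermitian_hermPinv {m : Type} [Fintype m] [DecidableEq m] {B : Matrix m m ℂ}
    (hB : B.IsHermitian) : (hermPinv B).IsHermitian := by
  rw [hermPinv, dif_pos hB]
  exact hB.exists_generalizedInverse.1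

lemma mul_hermPinv_mul {m : Type} [Fintype m] [DecidableEq m] {B : Matrix m m ℂ}
    (hB : B.IsHermitian) : B * hermPinv B * B = B := by
  rw [hermPinv, dif_pos hB]
  exact hB.exists_generalizedInverse.2

/-- The Schur complement criterion for positive semidefinite block matrices, with a generalized
inverse `G` of the lower right block. -/
theorem posSemidef_fromBlocks_iff {𝕜 m n : Type} [RCLike 𝕜] [Fintype m] [Fintype n]
    [DecidableEq m] [DecidableEq n] (A : Matrix m m 𝕜) (C : Matrix m n 𝕜) {B G : Matrix n n 𝕜}
    (hG : G.IsHermitian) (hBG : B * G * B = B) :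
    (Matrix.fromBlocks A C Cᴴ B).PosSemidef ↔
      B.PosSemidef ∧ C * G * B = C ∧ (A - C * G * Cᴴ).PosSemidef := by
  constructor
  · intro h
    have hB : B.PosSemidef := by
      have := h.submatrix (Sum.inr : n → m ⊕ n)
      exact this
    have hC : C * G * B = C := by
      have h1 : C - C * G * B = 0 := by
        have h2 : ∀ v, (C - C * G * B) *ᵥ v = 0 := by
          intro v
          -- With `w = v - G B v` in the kernel of `B`, the block form vanishes at `(0, w)`; by
          -- positivity the block matrix annihilates this vector, so `C w = 0`.
          have hw : B *ᵥ (v - (G * B) *ᵥ v) = 0 := by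
            rw [Matrix.mulVec_sub, Matrix.mulVec_mulVec, ← Matrix.mul_assoc, hBG, sub_self]
          have h3 := (h.dotProduct_mulVec_zero_iff (Sum.elim 0 (v - (G * B) *ᵥ v))).1 (by
            rw [Matrix.fromBlocks_mulVec]
            simp [hw, dotProduct, Fintype.sum_sum_type])
          rw [Matrix.fromBlocks_mulVec] at h3
          have h4 := congrArg (fun f => f ∘ Sum.inl) h3
          simp only [Sum.elim_comp_inl, Sum.elim_comp_inr, Matrix.mulVec_zero, zero_add] at h4
          rw [Matrix.sub_mulVec, Matrix.mul_assoc, ← Matrix.mulVec_mulVec, ← Matrix.mulVec_sub, h4]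
          rfl
        exact Matrix.ext_of_mulVec_single fun i => by rw [h2, Matrix.zero_mulVec]
      exact (sub_eq_zero.1 h1).symm
    refine ⟨hB, hC, ?_⟩
    have h5 := h.mul_mul_conjTranspose_same (Matrix.fromCols (1 : Matrix m m 𝕜) (-(C * G)))
    have h6 : Matrix.fromCols (1 : Matrix m m 𝕜) (-(C * G)) * Matrix.fromBlocks A C Cᴴ B *
        (Matrix.fromCols (1 : Matrix m m 𝕜) (-(C * G)))ᴴ = A - C * G * Cᴴ := by
      rw [Matrix.fromCols_mul_fromBlocks, Matrix.conjTranspose_fromCols_eq_fromRows_conjTranspose,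
        Matrix.fromCols_mul_fromRows]
      simp only [Matrix.one_mul, Matrix.neg_mul, hC, add_neg_cancel, Matrix.zero_mul, add_zero,
        Matrix.conjTranspose_one, Matrix.mul_one, sub_eq_add_neg]
    rwa [h6] at h5
  · rintro ⟨hB, hC, hA⟩
    -- The block matrix is the Schur complement placed in the upper left corner plus `(CG; 1) B (CG;
    -- 1)ᴴ`.
    have h1 := hA.mul_mul_conjTranspose_same (Matrix.fromRows (1 : Matrix m m 𝕜) (0 : Matrix n m 𝕜))
    have h2 := hB.mul_mul_conjTranspose_same (Matrix.fromRows (C * G) (1 : Matrix n n 𝕜))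
    have hC' : B * (G * Cᴴ) = Cᴴ := by
      have := congrArg Matrix.conjTranspose hC
      rwa [Matrix.conjTranspose_mul, Matrix.conjTranspose_mul, hG.eq, hB.1.eq] at this
    have h3 := h1.add h2
    convert h3 using 1
    simp only [Matrix.conjTranspose_fromRows_eq_fromCols_conjTranspose, Matrix.fromRows_mul,
      Matrix.mul_fromCols]
    simp only [Matrix.one_mul, Matrix.conjTranspose_one, Matrix.mul_one, Matrix.zero_mul,
      Matrix.conjTranspose_zero, Matrix.mul_zero, hC, Matrix.conjTranspose_mul, hG.eq,
      hC']
    rw [← Matrix.mul_assoc, Matrix.fromCols_fromRows_eq_fromBlocks,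
      Matrix.fromCols_fromRows_eq_fromBlocks, Matrix.fromBlocks_add, sub_add_cancel, zero_add,
      zero_add, zero_add]

/-! ### Complex positivity in real terms -/

lemma re_star_dotProduct_map {m : Type} [Fintype m] (M : Matrix m m ℝ) (x y : m → ℝ) :
    (star (fun i => (⟨x i, y i⟩ : ℂ)) ⬝ᵥ M.map Complex.ofReal *ᵥ (fun i => (⟨x i, y i⟩ : ℂ))) =
      ⟨x ⬝ᵥ M *ᵥ x + y ⬝ᵥ M *ᵥ y, x ⬝ᵥ M *ᵥ y - y ⬝ᵥ M *ᵥ x⟩ := by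
  apply Complex.ext
  · simp only [dotProduct, Matrix.mulVec, Finset.mul_sum, Complex.re_sum,
      ← Finset.sum_add_distrib]
    refine Finset.sum_congr rfl fun i _ => Finset.sum_congr rfl fun j _ => ?_
    simp
  · simp only [dotProduct, Matrix.mulVec, Finset.mul_sum, Complex.im_sum,
      ← Finset.sum_sub_distrib]
    refine Finset.sum_congr rfl fun i _ => Finset.sum_congr rfl fun j _ => ?_
    simp
    ring

lemma dotProduct_mulVec_swap {m n : Type} [Fintype m] [Fintype n] (K : Matrix m n ℝ) (x : m → ℝ)
    (y : n → ℝ) : x ⬝ᵥ K *ᵥ y = y ⬝ᵥ Kᵀ *ᵥ x := by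
  rw [Matrix.dotProduct_mulVec, dotProduct_comm, Matrix.mulVec_transpose]

lemma isHermitian_subI {m : Type} {M K : Matrix m m ℝ} (hM : M.IsSymm) (hK : Kᵀ = -K) :
    (subI M K).IsHermitian := by
  ext i j
  have h1 := hM.apply i j
  have h2 := congrFun (congrFun hK i) j
  simp only [Matrix.transpose_apply, Matrix.neg_apply] at h2
  simp [subI, h1, h2]
  ring

/-- At the vector `x + iy` the cross terms of the symmetric `M` cancel, and those of the
antisymmetric `K` combine to `2 xᵀKy`. -/
lemma posSemidef_subI_iff {m : Type} [Fintype m] {M K : Matrix m m ℝ} (hM : M.IsSymm)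
    (hK : Kᵀ = -K) : (subI M K).PosSemidef ↔
      ∀ x y : m → ℝ, 0 ≤ x ⬝ᵥ M *ᵥ x + y ⬝ᵥ M *ᵥ y + 2 * (x ⬝ᵥ K *ᵥ y) := by
  rw [Matrix.posSemidef_iff_dotProduct_mulVec, and_iff_right (isHermitian_subI hM hK)]
  have key : ∀ x y : m → ℝ, star (fun i => (⟨x i, y i⟩ : ℂ)) ⬝ᵥ subI M K *ᵥ
      (fun i => (⟨x i, y i⟩ : ℂ)) =
      ((x ⬝ᵥ M *ᵥ x + y ⬝ᵥ M *ᵥ y + 2 * (x ⬝ᵥ K *ᵥ y) : ℝ) : ℂ) := by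
    intro x y
    have h1 : y ⬝ᵥ M *ᵥ x = x ⬝ᵥ M *ᵥ y := by rw [dotProduct_mulVec_swap, hM.eq]
    have h2 : ∀ x y, y ⬝ᵥ K *ᵥ x = -(x ⬝ᵥ K *ᵥ y) := fun x y => by
      rw [dotProduct_mulVec_swap, hK, Matrix.neg_mulVec, dotProduct_neg]
    have h3 : ∀ x, x ⬝ᵥ K *ᵥ x = 0 := fun x => by linarith [h2 x x]
    rw [subI, Matrix.sub_mulVec, dotProduct_sub, Matrix.smul_mulVec, dotProduct_smul,
      re_star_dotProduct_map, re_star_dotProduct_map, h1, h2 x y, h3, h3]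
    apply Complex.ext <;> simp
    ring
  constructor
  · intro h x y
    have := h (fun i => ⟨x i, y i⟩)
    rw [key] at this
    exact Complex.zero_le_real.1 this
  · intro h v
    have := key (fun i => (v i).re) (fun i => (v i).im)
    simp only [Complex.eta] at this
    rw [this]
    exact Complex.zero_le_real.2 (h _ _)

/-- The quadratic form of the block matrix `(A C; Cᵀ B)`. -/
def blockForm {m n : Type} [Fintype m] [Fintype n] (A : Matrix m m ℝ) (C : Matrix m n ℝ)
    (B : Matrix n n ℝ) (x : m → ℝ) (y : n → ℝ) : ℝ :=
  x ⬝ᵥ A *ᵥ x + 2 * (x ⬝ᵥ C *ᵥ y) + y ⬝ᵥ B *ᵥ y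

lemma quadForm_fromBlocks {m n : Type} [Fintype m] [Fintype n] (A : Matrix m m ℝ)
    (C : Matrix m n ℝ) (B : Matrix n n ℝ) (x : m → ℝ) (y : n → ℝ) :
    Sum.elim x y ⬝ᵥ Matrix.fromBlocks A C Cᵀ B *ᵥ Sum.elim x y = blockForm A C B x y := by
  rw [Matrix.fromBlocks_mulVec, sumElim_dotProduct_sumElim, blockForm]
  simp only [Sum.elim_comp_inl, Sum.elim_comp_inr, dotProduct_add]
  rw [dotProduct_mulVec_swap Cᵀ, Matrix.transpose_transpose]
  ring

lemma subI_fromBlocks {m n : Type} (A : Matrix m m ℝ) (C : Matrix m n ℝ) (B : Matrix n n ℝ)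
    (K₁ : Matrix m m ℝ) (K : Matrix n n ℝ) :
    subI (Matrix.fromBlocks A C Cᵀ B) (Matrix.fromBlocks K₁ 0 0 K) =
      Matrix.fromBlocks (subI A K₁) (C.map Complex.ofReal) (C.map Complex.ofReal)ᴴ (subI B K) := by
  ext i j
  rcases i with i | i <;> rcases j with j | j <;> simp [subI]

section Blocks

variable {m n : Type} [Fintype m] [Fintype n] {A : Matrix m m ℝ} {C : Matrix m n ℝ}
  {B : Matrix n n ℝ} {K₁ : Matrix m m ℝ} {K : Matrix n n ℝ}

lemma posSemidef_blocks_iff (hA : A.IsSymm) (hB : B.IsSymm) (hK₁ : K₁ᵀ = -K₁) (hK : Kᵀ = -K) :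
    (Matrix.fromBlocks (subI A K₁) (C.map Complex.ofReal) (C.map Complex.ofReal)ᴴ
      (subI B K)).PosSemidef ↔
    ∀ (x y : m → ℝ) (u v : n → ℝ), 0 ≤ blockForm A C B x u + blockForm A C B y v +
      2 * (x ⬝ᵥ K₁ *ᵥ y) + 2 * (u ⬝ᵥ K *ᵥ v) := by
  have e : ∀ (x y : m → ℝ) (u v : n → ℝ), Sum.elim x u ⬝ᵥ Matrix.fromBlocks K₁ 0 0 K *ᵥ
      Sum.elim y v = x ⬝ᵥ K₁ *ᵥ y + u ⬝ᵥ K *ᵥ v := by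
    intro x y u v
    rw [Matrix.fromBlocks_mulVec, sumElim_dotProduct_sumElim]
    simp
  rw [← subI_fromBlocks, posSemidef_subI_iff
    (by rw [Matrix.IsSymm, Matrix.fromBlocks_transpose, hA.eq, hB.eq, Matrix.transpose_transpose])
    (by rw [Matrix.fromBlocks_transpose, hK₁, hK, Matrix.fromBlocks_neg]; simp)]
  constructor
  · intro h x y u v
    have := h (Sum.elim x u) (Sum.elim y v)
    rw [quadForm_fromBlocks, quadForm_fromBlocks, e] at this
    linarith
  · intro h x y
    have := h (x ∘ Sum.inl) (y ∘ Sum.inl) (x ∘ Sum.inr) (y ∘ Sum.inr)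
    rw [← Sum.elim_comp_inl_inr x, ← Sum.elim_comp_inl_inr y, quadForm_fromBlocks,
      quadForm_fromBlocks, e]
    linarith

variable [DecidableEq m] [DecidableEq n]

/-- Positivity of a block matrix in terms of the Schur complement with the pseudoinverse of the
lower block. -/
lemma posSemidef_schur_of_form (hA : A.IsSymm) (hB : B.IsSymm) (hK₁ : K₁ᵀ = -K₁) (hK : Kᵀ = -K)
    (h : ∀ (x y : m → ℝ) (u v : n → ℝ), 0 ≤ blockForm A C B x u + blockForm A C B y v +
      2 * (x ⬝ᵥ K₁ *ᵥ y) + 2 * (u ⬝ᵥ K *ᵥ v)) :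
    (subI A K₁ - C.map Complex.ofReal * hermPinv (subI B K) *
      (C.map Complex.ofReal)ᵀ).PosSemidef := by
  have h1 := (posSemidef_blocks_iff hA hB hK₁ hK).2 h
  rw [posSemidef_fromBlocks_iff _ _ (isHermitian_hermPinv (isHermitian_subI hB hK))
    (mul_hermPinv_mul (isHermitian_subI hB hK))] at h1
  have : (C.map Complex.ofReal)ᴴ = (C.map Complex.ofReal)ᵀ := by ext i j; simp
  rw [← this]
  exact h1.2.2

/-- With a pseudoinverse, positivity of the Schur complement is not enough: `B - iK` must be
positive and `C` must vanish on its kernel. Neither condition involves the upper left block, so both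
are taken from `h₀`, where that block is `A₀ - iK₀`. -/
lemma form_of_posSemidef_schur {A₀ K₀ : Matrix m m ℝ} (hA₀ : A₀.IsSymm) (hK₀ : K₀ᵀ = -K₀)
    (hA : A.IsSymm) (hB : B.IsSymm) (hK₁ : K₁ᵀ = -K₁) (hK : Kᵀ = -K)
    (h₀ : ∀ (x y : m → ℝ) (u v : n → ℝ), 0 ≤ blockForm A₀ C B x u + blockForm A₀ C B y v +
      2 * (x ⬝ᵥ K₀ *ᵥ y) + 2 * (u ⬝ᵥ K *ᵥ v))
    (h : (subI A K₁ - C.map Complex.ofReal * hermPinv (subI B K) *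
      (C.map Complex.ofReal)ᵀ).PosSemidef) (x y : m → ℝ) (u v : n → ℝ) :
    0 ≤ blockForm A C B x u + blockForm A C B y v + 2 * (x ⬝ᵥ K₁ *ᵥ y) + 2 * (u ⬝ᵥ K *ᵥ v) := by
  have h1 := (posSemidef_blocks_iff hA₀ hB hK₀ hK).2 h₀
  rw [posSemidef_fromBlocks_iff _ _ (isHermitian_hermPinv (isHermitian_subI hB hK))
    (mul_hermPinv_mul (isHermitian_subI hB hK))] at h1
  have : (C.map Complex.ofReal)ᴴ = (C.map Complex.ofReal)ᵀ := by ext i j; simp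
  rw [← this] at h
  have h2 := (posSemidef_fromBlocks_iff _ _ (isHermitian_hermPinv (isHermitian_subI hB hK))
    (mul_hermPinv_mul (isHermitian_subI hB hK))).2 ⟨h1.1, h1.2.1, h⟩
  exact (posSemidef_blocks_iff hA hB hK₁ hK).1 h2 x y u v

/-- The real Schur complement of the upper block. -/
lemma exists_lower_complement (hA : A.IsSymm) (hB : B.IsSymm)
    (h₀ : ∀ x u, 0 ≤ blockForm A C B x u) :
    ∃ B' : Matrix n n ℝ, B'.IsSymm ∧ (∀ x u, u ⬝ᵥ B' *ᵥ u ≤ blockForm A C B x u) ∧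
      ∃ X : Matrix m n ℝ, ∀ u, blockForm A C B (X *ᵥ u) u = u ⬝ᵥ B' *ᵥ u := by
  have hP : (Matrix.fromBlocks B Cᵀ Cᵀᴴ A).PosSemidef := by
    rw [posSemidef_real_iff]
    have e : (Cᵀᴴ : Matrix m n ℝ) = Cᵀᵀ := by ext i j; simp
    rw [e]
    refine ⟨by rw [Matrix.IsSymm, Matrix.fromBlocks_transpose, hA.eq, hB.eq,
      Matrix.transpose_transpose], fun z => ?_⟩
    rw [← Sum.elim_comp_inl_inr z, quadForm_fromBlocks]
    have := h₀ (z ∘ Sum.inr) (z ∘ Sum.inl)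
    rw [blockForm] at *
    rw [dotProduct_mulVec_swap Cᵀ, Matrix.transpose_transpose]
    linarith
  have hAH : A.IsHermitian := by
    rw [Matrix.IsHermitian, Matrix.conjTranspose_eq_transpose_of_trivial]; exact hA
  obtain ⟨G, hG, hGA⟩ : ∃ G : Matrix m m ℝ, G.IsHermitian ∧ A * G * A = A :=
    ⟨_, hAH.exists_generalizedInverse⟩
  obtain ⟨hAP, hC, -⟩ := (posSemidef_fromBlocks_iff _ _ hG hGA).1 hP
  have hGs : Gᵀ = G := by
    have := hG.eq; rwa [Matrix.conjTranspose_eq_transpose_of_trivial] at this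
  -- The stationarity condition: for fixed `u`, the form is minimized over `x` at `x = -G C u`.
  have hX : A * (-(G * C)) = -C := by
    have := congrArg Matrix.transpose hC
    rw [Matrix.transpose_mul, Matrix.transpose_mul, Matrix.transpose_transpose, hGs, hA.eq] at this
    rw [Matrix.mul_neg, this]
  generalize -(G * C) = X at hX
  have hs : (Cᵀ * X).IsSymm := by
    have h1 : Cᵀ * X = -(Xᵀ * A * X) := by
      have := congrArg Matrix.transpose hX
      rw [Matrix.transpose_mul, hA.eq, Matrix.transpose_neg] at this
      rw [this, Matrix.neg_mul, neg_neg]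
    rw [h1, Matrix.IsSymm, Matrix.transpose_neg, Matrix.transpose_mul, Matrix.transpose_mul,
      Matrix.transpose_transpose, hA.eq, Matrix.mul_assoc]
  have hXC : ∀ x u, x ⬝ᵥ A *ᵥ (X *ᵥ u) = -(x ⬝ᵥ C *ᵥ u) := fun x u => by
    rw [Matrix.mulVec_mulVec, hX, Matrix.neg_mulVec, dotProduct_neg]
  have hCX : ∀ u, u ⬝ᵥ (Cᵀ * X) *ᵥ u = (X *ᵥ u) ⬝ᵥ C *ᵥ u := fun u => by
    rw [← Matrix.mulVec_mulVec, dotProduct_mulVec_swap, Matrix.transpose_transpose]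
  refine ⟨B + Cᵀ * X, hB.add hs, fun x u => ?_, X, fun u => ?_⟩
  · have h1 := ((posSemidef_real_iff A).1 hAP).2 (x - X *ᵥ u)
    rw [Matrix.mulVec_sub, dotProduct_sub, sub_dotProduct, sub_dotProduct, hXC, hXC,
      dotProduct_mulVec_swap A (X *ᵥ u), hA.eq, hXC] at h1
    rw [quadForm_add, hCX, blockForm]
    linarith
  · rw [blockForm, hXC, quadForm_add, hCX]; ring

end Blocks

/-! ### Plane geometry of the disk and the two ellipses -/

/-- The function `√(1 + ‖ξ‖²) - l·ξ - c`, whose zero set is a branch of a conic. -/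
noncomputable def conicFn (l : Fin 2 → ℝ) (c : ℝ) (ξ : Fin 2 → ℝ) : ℝ :=
  √(1 + ξ ⬝ᵥ ξ) - l ⬝ᵥ ξ - c

lemma continuous_conicFn (l : Fin 2 → ℝ) (c : ℝ) : Continuous (conicFn l c) := by
  unfold conicFn dotProduct
  fun_prop

lemma dotProduct_fin_two (u v : Fin 2 → ℝ) : u ⬝ᵥ v = u 0 * v 0 + u 1 * v 1 := by
  simp [dotProduct]

lemma one_add_dotProduct_self_pos (ξ : Fin 2 → ℝ) : 0 < 1 + ξ ⬝ᵥ ξ := by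
  rw [dotProduct_fin_two]
  nlinarith [sq_nonneg (ξ 0), sq_nonneg (ξ 1)]

lemma sq_sqrt_one_add (ξ : Fin 2 → ℝ) : √(1 + ξ ⬝ᵥ ξ) ^ 2 = 1 + ξ ⬝ᵥ ξ :=
  Real.sq_sqrt (one_add_dotProduct_self_pos ξ).le

lemma dotProduct_lt_sqrt (l ξ : Fin 2 → ℝ) (hl : l ⬝ᵥ l ≤ 1) :
    l ⬝ᵥ ξ < √(1 + ξ ⬝ᵥ ξ) := by
  apply Real.lt_sqrt_of_sq_lt
  rw [dotProduct_fin_two] at *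
  rw [dotProduct_fin_two] at *
  nlinarith [sq_nonneg (l 0 * ξ 1 - l 1 * ξ 0), sq_nonneg (ξ 0), sq_nonneg (ξ 1)]

/-- Since `‖l‖ ≤ 1` and `c ≥ 0`, always `l·ξ + c > -√(1 + ‖ξ‖²)`; squaring therefore introduces no
second branch. -/
lemma conicFn_le_zero_iff {l : Fin 2 → ℝ} {c : ℝ} (hl : l ⬝ᵥ l ≤ 1) (hc : 0 ≤ c)
    (ξ : Fin 2 → ℝ) : conicFn l c ξ ≤ 0 ↔ 1 + ξ ⬝ᵥ ξ ≤ (l ⬝ᵥ ξ + c) ^ 2 := by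
  have h0 : 0 < √(1 + ξ ⬝ᵥ ξ) := Real.sqrt_pos.2 (one_add_dotProduct_self_pos ξ)
  have h1 : √(1 + ξ ⬝ᵥ ξ) ^ 2 = 1 + ξ ⬝ᵥ ξ := sq_sqrt_one_add ξ
  have h2 : -(l ⬝ᵥ ξ) < √(1 + ξ ⬝ᵥ ξ) := by
    have := dotProduct_lt_sqrt l (-ξ) hl
    simpa using this
  unfold conicFn
  constructor
  · intro h; nlinarith
  · intro h
    rw [← h1] at h
    nlinarith

lemma conicFn_eq_zero_iff {l : Fin 2 → ℝ} {c : ℝ} (hl : l ⬝ᵥ l ≤ 1) (hc : 0 ≤ c)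
    (ξ : Fin 2 → ℝ) : conicFn l c ξ = 0 ↔ 1 + ξ ⬝ᵥ ξ = (l ⬝ᵥ ξ + c) ^ 2 := by
  have h0 : 0 < √(1 + ξ ⬝ᵥ ξ) := Real.sqrt_pos.2 (one_add_dotProduct_self_pos ξ)
  have h1 : √(1 + ξ ⬝ᵥ ξ) ^ 2 = 1 + ξ ⬝ᵥ ξ := sq_sqrt_one_add ξ
  constructor
  · intro h
    rw [← h1]
    unfold conicFn at h
    rw [show √(1 + ξ ⬝ᵥ ξ) = l ⬝ᵥ ξ + c by linarith]
  · intro h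
    have h2 := (conicFn_le_zero_iff hl hc ξ).2 h.le
    rw [← h1] at h
    unfold conicFn at *
    nlinarith

/-- `√(1 + ‖ξ‖²)` is the Euclidean norm of `(1, ξ)`, hence convex; `hXY` is Cauchy-Schwarz for two
such vectors. -/
lemma convex_conicFn_le (l : Fin 2 → ℝ) (c : ℝ) : Convex ℝ {ξ | conicFn l c ξ ≤ 0} := by
  intro x hx y hy a b ha hb hab
  simp only [Set.mem_ofPred_eq, conicFn] at *
  have hX : √(1 + x ⬝ᵥ x) ^ 2 = 1 + x ⬝ᵥ x := sq_sqrt_one_add x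
  have hY : √(1 + y ⬝ᵥ y) ^ 2 = 1 + y ⬝ᵥ y := sq_sqrt_one_add y
  have hX0 := Real.sqrt_nonneg (1 + x ⬝ᵥ x)
  have hY0 := Real.sqrt_nonneg (1 + y ⬝ᵥ y)
  set X := √(1 + x ⬝ᵥ x)
  set Y := √(1 + y ⬝ᵥ y)
  have hXY : 1 + x ⬝ᵥ y ≤ X * Y := by
    refine le_of_abs_le (abs_le_of_sq_le_sq ?_ (by positivity))
    rw [mul_pow, hX, hY]
    simp only [dotProduct_fin_two]
    nlinarith [sq_nonneg (x 0 - y 0), sq_nonneg (x 1 - y 1), sq_nonneg (x 0 * y 1 - x 1 * y 0)]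
  have key : √(1 + (a • x + b • y) ⬝ᵥ (a • x + b • y)) ≤ a * X + b * Y := by
    apply Real.sqrt_le_iff.2 ⟨by positivity, ?_⟩
    have : (a * X + b * Y) ^ 2 = a ^ 2 * X ^ 2 + b ^ 2 * Y ^ 2 + 2 * (a * b) * (X * Y) := by ring
    rw [this, hX, hY]
    have h3 := mul_le_mul_of_nonneg_left hXY (mul_nonneg ha hb)
    have h4 : (a + b) ^ 2 = 1 := by rw [hab]; norm_num
    simp only [dotProduct_fin_two, Pi.add_apply, Pi.smul_apply, smul_eq_mul] at *
    nlinarith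
  have e : l ⬝ᵥ (a • x + b • y) = a * (l ⬝ᵥ x) + b * (l ⬝ᵥ y) := by
    simp [dotProduct_add]
  rw [e]
  have hc : c = a * c + b * c := by rw [← add_mul, hab, one_mul]
  rw [hc]
  have := mul_le_mul_of_nonneg_left hx ha
  have := mul_le_mul_of_nonneg_left hy hb
  linarith

/-- The centre of the conic. -/
noncomputable def conicCenter (l : Fin 2 → ℝ) (c : ℝ) : Fin 2 → ℝ := (c / (1 - l ⬝ᵥ l)) • l

/-- The squared equation is that of a conic with centre `conicCenter l c`. Thus the centre is the
midpoint of two border points whenever the border is nonempty. -/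
lemma conicFn_reflect {l : Fin 2 → ℝ} {c : ℝ} (hl : l ⬝ᵥ l < 1) (hc : 0 ≤ c)
    {ξ : Fin 2 → ℝ} (h : conicFn l c ξ = 0) :
    conicFn l c ((2 : ℝ) • conicCenter l c - ξ) = 0 := by
  rw [conicFn_eq_zero_iff hl.le hc] at *
  have hk : 1 - l ⬝ᵥ l ≠ 0 := by linarith
  obtain ⟨κ, hκ⟩ : ∃ κ, κ = c / (1 - l ⬝ᵥ l) := ⟨_, rfl⟩
  have hκ' : κ * (1 - l ⬝ᵥ l) = c := by rw [hκ]; field_simp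
  rw [conicCenter, ← hκ]
  simp only [dotProduct_fin_two, Pi.sub_apply, Pi.smul_apply, smul_eq_mul] at *
  subst hκ'
  linear_combination h

/-- The zero set of `conicFn` is connected. -/
lemma isPreconnected_conic {l : Fin 2 → ℝ} {c : ℝ} (hl : l ⬝ᵥ l < 1) (hc : 0 ≤ c) :
    IsPreconnected {ξ | conicFn l c ξ = 0} := by
  obtain ⟨u, t, hu, rfl⟩ : ∃ (u : Fin 2 → ℝ) (t : ℝ), u ⬝ᵥ u = 1 ∧ l = t • u := by
    by_cases h : l = 0
    · exact ⟨![1, 0], 0, by simp, by simp [h]⟩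
    · have h2 : l ⬝ᵥ l ≠ 0 := fun h' => h (dotProduct_self_eq_zero.1 h')
      have h3 : 0 ≤ l ⬝ᵥ l := by rw [dotProduct_fin_two]; nlinarith [sq_nonneg (l 0), sq_nonneg (l 1)]
      have h4 : √(l ⬝ᵥ l) ≠ 0 := (Real.sqrt_pos.2 (lt_of_le_of_ne h3 h2.symm)).ne'
      refine ⟨(√(l ⬝ᵥ l))⁻¹ • l, √(l ⬝ᵥ l), ?_, ?_⟩
      · rw [smul_dotProduct, dotProduct_smul, smul_eq_mul, smul_eq_mul]
        nth_rewrite 3 [← Real.mul_self_sqrt h3]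
        field_simp
      · rw [smul_smul, mul_inv_cancel₀ h4, one_smul]
  have ht : t ^ 2 < 1 := by
    rw [smul_dotProduct, dotProduct_smul, hu] at hl
    simpa [sq] using hl
  have hk : 0 < 1 - t ^ 2 := by linarith
  obtain ⟨κ, hκ⟩ : ∃ κ, κ = c / (1 - t ^ 2) := ⟨_, rfl⟩
  have hκ' : c = κ * (1 - t ^ 2) := by rw [hκ]; field_simp
  -- In the axes `u`, `perp u` the border is `F² (p - κ t)² + q² = E²` with `F² = 1 - t²` and `E² =
  -- c²/(1 - t²) - 1`: empty if the latter is negative, otherwise an affine image of the unit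
  -- circle.
  rcases lt_or_ge (c ^ 2 / (1 - t ^ 2) - 1) 0 with hE | hE
  · have : {ξ | conicFn (t • u) c ξ = 0} = ∅ := by
      ext ξ
      simp only [Set.mem_ofPred_eq, Set.mem_empty_iff_false, iff_false]
      rw [conicFn_eq_zero_iff hl.le hc]
      intro h
      have h2 : c ^ 2 < 1 - t ^ 2 := by
        rw [sub_neg, div_lt_one hk] at hE; exact hE
      rw [smul_dotProduct, smul_eq_mul] at h
      have h3 : ξ ⬝ᵥ ξ = (u ⬝ᵥ ξ) ^ 2 + (u 0 * ξ 1 - u 1 * ξ 0) ^ 2 := by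
        have : ξ ⬝ᵥ ξ = (u ⬝ᵥ u) * (ξ ⬝ᵥ ξ) := by rw [hu, one_mul]
        rw [this]; simp only [dotProduct_fin_two]; ring
      rw [h3] at h
      generalize u ⬝ᵥ ξ = p at *
      nlinarith [sq_nonneg ((1 - t ^ 2) * p - t * c), sq_nonneg (u 0 * ξ 1 - u 1 * ξ 0)]
    rw [this]; exact isPreconnected_empty
  · obtain ⟨E, hEq⟩ : ∃ E, E = √(c ^ 2 / (1 - t ^ 2) - 1) := ⟨_, rfl⟩
    obtain ⟨F, hFq⟩ : ∃ F, F = √(1 - t ^ 2) := ⟨_, rfl⟩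
    have hE2 : E ^ 2 = c ^ 2 / (1 - t ^ 2) - 1 := by rw [hEq, Real.sq_sqrt hE]
    have hF2 : F ^ 2 = 1 - t ^ 2 := by rw [hFq, Real.sq_sqrt hk.le]
    have hF0 : 0 < F := by rw [hFq]; exact Real.sqrt_pos.2 hk
    have himg : {ξ | conicFn (t • u) c ξ = 0} =
        (fun z : ℂ => (κ * t + E / F * z.re) • u + (E * z.im) • perp u) '' Metric.sphere 0 1 := by
      have hdec : ∀ ξ : Fin 2 → ℝ, ξ = (u ⬝ᵥ ξ) • u + (perp u ⬝ᵥ ξ) • perp u := by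
        intro ξ
        rw [dotProduct_fin_two] at hu
        ext i
        simp only [dotProduct_fin_two, Pi.add_apply, Pi.smul_apply, smul_eq_mul]
        fin_cases i <;> simp [perp]
        · linear_combination (-ξ 0) * hu
        · linear_combination (-ξ 1) * hu
      have hmem : ∀ p q : ℝ, conicFn (t • u) c (p • u + q • perp u) = 0 ↔
          F ^ 2 * (p - κ * t) ^ 2 + q ^ 2 = E ^ 2 := by
        intro p q
        rw [conicFn_eq_zero_iff hl.le hc]
        have e1 : (p • u + q • perp u) ⬝ᵥ (p • u + q • perp u) = p ^ 2 + q ^ 2 := by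
          rw [dotProduct_fin_two] at *
          simp [perp]
          linear_combination (p ^ 2 + q ^ 2) * hu
        have e2 : (t • u) ⬝ᵥ (p • u + q • perp u) = t * p := by
          rw [dotProduct_fin_two] at *
          simp [perp]
          linear_combination t * p * hu
        have e3 : c ^ 2 / (1 - t ^ 2) = κ ^ 2 * (1 - t ^ 2) := by
          rw [hκ']; field_simp
        rw [e1, e2, hE2, hF2, e3, hκ']
        constructor <;> intro h <;> linear_combination h
      ext ξ
      simp only [Set.mem_ofPred_eq, Set.mem_image, mem_sphere_zero_iff_norm]
      constructor
      · intro h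
        rw [hdec ξ, hmem] at h
        rcases eq_or_ne E 0 with hE0 | hE0
        · refine ⟨1, by simp, ?_⟩
          rw [hE0] at h ⊢
          have h1 : perp u ⬝ᵥ ξ = 0 := by nlinarith [sq_nonneg (F * (u ⬝ᵥ ξ - κ * t))]
          have h2 : F * (u ⬝ᵥ ξ - κ * t) = 0 := by
            rw [h1] at h
            exact pow_eq_zero_iff (two_ne_zero) |>.1 (by linear_combination h)
          have h3 : u ⬝ᵥ ξ = κ * t := by
            have := (mul_eq_zero.1 h2).resolve_left hF0.ne'
            linarith
          conv_rhs => rw [hdec ξ, h1, h3]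
          simp
        · refine ⟨⟨F * (u ⬝ᵥ ξ - κ * t) / E, (perp u ⬝ᵥ ξ) / E⟩, ?_, ?_⟩
          · rw [← sq_eq_sq₀ (norm_nonneg _) zero_le_one, ← Complex.normSq_eq_norm_sq,
              Complex.normSq_mk]
            field_simp
            linear_combination h
          · conv_rhs => rw [hdec ξ]
            congr 2
            · field_simp
              ring
            · field_simp
      · rintro ⟨z, hz, rfl⟩
        rw [hmem]
        have hz2 : z.re ^ 2 + z.im ^ 2 = 1 := by
          have := Complex.normSq_eq_norm_sq z
          rw [hz, Complex.normSq_apply] at this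
          linear_combination this
        field_simp
        linear_combination E ^ 2 * hz2
    rw [himg]
    refine (isPreconnected_sphere ?_ 0 1).image _ ?_
    · rw [Complex.rank_real_complex]; norm_num
    · apply Continuous.continuousOn
      fun_prop

/-- If finitely many filled conics have a common point, then they share the centre of one of them,
or a point on the borders of two of them with different linear parts. -/
theorem exists_conicCenter_or_corner {ι : Type} [Fintype ι] [Nonempty ι] (l : ι → Fin 2 → ℝ)
    (c : ι → ℝ) (hl : ∀ i, l i ⬝ᵥ l i < 1) (hc : ∀ i, 0 ≤ c i) (h0 : ∃ i, l i = 0)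
    (ξ₀ : Fin 2 → ℝ) (hξ₀ : ∀ i, conicFn (l i) (c i) ξ₀ ≤ 0) :
    (∃ i, ∀ j, conicFn (l j) (c j) (conicCenter (l i) (c i)) ≤ 0) ∨
    ∃ q, (∀ j, conicFn (l j) (c j) q ≤ 0) ∧
      ∃ i j, l i ≠ l j ∧ conicFn (l i) (c i) q = 0 ∧ conicFn (l j) (c j) q = 0 := by
  classical
  obtain ⟨i₀, hi₀⟩ := h0
  -- A common origin is the centre belonging to `i₀`. Otherwise the largest of the functions is
  -- nonpositive at `ξ₀` and positive at the origin, so it vanishes somewhere.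
  by_cases h0K : ∀ j, conicFn (l j) (c j) 0 ≤ 0
  · left
    refine ⟨i₀, ?_⟩
    simpa [conicCenter, hi₀] using h0K
  push Not at h0K
  have hne : (Finset.univ : Finset ι).Nonempty := Finset.univ_nonempty
  obtain ⟨p, i, hpK, hpi⟩ : ∃ p i, (∀ j, conicFn (l j) (c j) p ≤ 0) ∧
      conicFn (l i) (c i) p = 0 := by
    obtain ⟨j, hj⟩ := h0K
    have hcont : Continuous fun ξ => Finset.univ.sup' hne fun j => conicFn (l j) (c j) ξ :=
      Continuous.finset_sup'_apply _ fun j _ => continuous_conicFn _ _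
    obtain ⟨p, -, hp⟩ := isPreconnected_univ.intermediate_value (Set.mem_univ ξ₀)
      (Set.mem_univ (0 : Fin 2 → ℝ)) hcont.continuousOn
      (show (0 : ℝ) ∈ Set.Icc _ _ from ⟨Finset.sup'_le _ _ fun j _ => hξ₀ j,
        hj.le.trans (Finset.le_sup' (fun j => conicFn (l j) (c j) 0) (Finset.mem_univ j))⟩)
    obtain ⟨i, -, hi⟩ := Finset.exists_mem_eq_sup' hne fun j => conicFn (l j) (c j) p
    refine ⟨p, i, fun j => ?_, ?_⟩
    · rw [← hp]
      exact Finset.le_sup' (fun j => conicFn (l j) (c j) p) (Finset.mem_univ j)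
    · rw [← hi]; exact hp
  -- If the whole border `i` is common to all sets, so are `p` and its opposite point, hence by
  -- convexity the centre between them.
  by_cases hS : ∀ q, conicFn (l i) (c i) q = 0 → ∀ j, conicFn (l j) (c j) q ≤ 0
  · left
    refine ⟨i, fun j => ?_⟩
    have h1 := hS p hpi j
    have h2 := hS _ (conicFn_reflect (hl i) (hc i) hpi) j
    have h3 := convex_conicFn_le (l j) (c j) h1 h2 (by norm_num : (0 : ℝ) ≤ 1 / 2)
      (by norm_num : (0 : ℝ) ≤ 1 / 2) (by norm_num)
    have e : (1 / 2 : ℝ) • p + (1 / 2 : ℝ) • ((2 : ℝ) • conicCenter (l i) (c i) - p) =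
        conicCenter (l i) (c i) := by
      module
    rw [e] at h3
    exact h3
  · right
    push Not at hS
    obtain ⟨q', hq', j', hj'⟩ := hS
    -- Functions identical to the `i`-th vanish all along its border and would hide the crossing
    -- with another curve; the constant `-1` takes their place.
    let g : ι → (Fin 2 → ℝ) → ℝ := fun j =>
      if conicFn (l j) (c j) = conicFn (l i) (c i) then fun _ => -1 else conicFn (l j) (c j)
    have hg : ∀ j, Continuous (g j) := by
      intro j
      by_cases h : conicFn (l j) (c j) = conicFn (l i) (c i)
      · simp only [g, if_pos h]; exact continuous_const
      · simp only [g, if_neg h]; exact continuous_conicFn _ _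
    have hcont : Continuous fun ξ => Finset.univ.sup' hne fun j => g j ξ :=
      Continuous.finset_sup'_apply _ fun j _ => hg j
    have hpg : ∀ j, g j p ≤ 0 := by
      intro j
      by_cases h : conicFn (l j) (c j) = conicFn (l i) (c i)
      · simp only [g, if_pos h]; norm_num
      · simp only [g, if_neg h]; exact hpK j
    have hqg : 0 < g j' q' := by
      have h : conicFn (l j') (c j') ≠ conicFn (l i) (c i) := fun h => by
        rw [h, hq'] at hj'; exact lt_irrefl _ hj'
      simp only [g, if_neg h]; exact hj'
    obtain ⟨q, hqS, hq⟩ := (isPreconnected_conic (hl i) (hc i)).intermediate_value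
      (show p ∈ _ from hpi) (show q' ∈ _ from hq') hcont.continuousOn
      (show (0 : ℝ) ∈ Set.Icc _ _ from ⟨Finset.sup'_le _ _ fun j _ => hpg j,
        hqg.le.trans (Finset.le_sup' (fun j => g j q') (Finset.mem_univ j'))⟩)
    have hqS' : conicFn (l i) (c i) q = 0 := hqS
    obtain ⟨j, -, hj⟩ := Finset.exists_mem_eq_sup' hne fun j => g j q
    have hjq : g j q = 0 := by rw [← hj]; exact hq
    have hjne : conicFn (l j) (c j) ≠ conicFn (l i) (c i) := fun h => by
      simp only [g, if_pos h] at hjq; norm_num at hjq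
    have hjq' : conicFn (l j) (c j) q = 0 := by simpa only [g, if_neg hjne] using hjq
    refine ⟨q, fun k => ?_, i, j, ?_, hqS', hjq'⟩
    · by_cases h : conicFn (l k) (c k) = conicFn (l i) (c i)
      · rw [h]; exact hqS'.le
      · have h2 : g k q ≤ 0 := by
          rw [← hq]; exact Finset.le_sup' (fun j => g j q) (Finset.mem_univ k)
        simpa only [g, if_neg h] using h2
    -- At a common zero, equal linear parts force equal constants, hence identical functions.
    · intro hlij
      apply hjne
      have : c i = c j := by
        unfold conicFn at hqS' hjq'
        rw [hlij] at hqS'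
        linarith
      rw [hlij, this]

/-! ### Separability conditions and candidate points -/

lemma detR_eq {R : Matrix (Fin 2) (Fin 2) ℂ} (hR : R.IsHermitian) :
    detR R = (R 0 0).re * (R 1 1).re - (R 0 1).re ^ 2 - (R 0 1).im ^ 2 := by
  have h0 : (R 0 0).im = 0 := by
    have := congrArg Complex.im (hR.apply 0 0); simp at this; linarith
  have h1 : (R 1 1).im = 0 := by
    have := congrArg Complex.im (hR.apply 1 1); simp at this; linarith
  have h10 : R 1 0 = conj (R 0 1) := (hR.apply 1 0).symm
  rw [detR, Matrix.det_fin_two, h10]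
  simp [h0, h1]
  ring

lemma trR_eq (R : Matrix (Fin 2) (Fin 2) ℂ) : trR R = (R 0 0).re + (R 1 1).re := by
  simp [trR, Matrix.trace_fin_two]

/-- For positive determinant this gives `‖L‖ < |tr R|`, so that the border is an ellipse; it also
identifies the denominator `k₁` of the centre. -/
lemma trR_sq_sub {R : Matrix (Fin 2) (Fin 2) ℂ} (hR : R.IsHermitian) :
    trR R ^ 2 - vecL R ⬝ᵥ vecL R = 4 * (detR R + (R 0 1).im ^ 2) := by
  rw [detR_eq hR, trR_eq, dotProduct_fin_two]
  simp [vecL]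
  ring

lemma eq_smul_add_smul_perp {v ξ : Fin 2 → ℝ} (hv : v ≠ 0) {t : ℝ} (h : v ⬝ᵥ ξ = t) :
    ∃ s : ℝ, ξ = (t / (v ⬝ᵥ v)) • v + s • perp v := by
  have h2 : v ⬝ᵥ v ≠ 0 := fun h' => hv (dotProduct_self_eq_zero.1 h')
  refine ⟨(perp v ⬝ᵥ ξ) / (v ⬝ᵥ v), ?_⟩
  subst h
  rw [div_eq_mul_inv, div_eq_mul_inv]
  have h3 : (v ⬝ᵥ v) * (v ⬝ᵥ v)⁻¹ = 1 := mul_inv_cancel₀ h2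
  generalize (v ⬝ᵥ v)⁻¹ = w at *
  ext i
  simp only [dotProduct_fin_two, Pi.add_apply, Pi.smul_apply, smul_eq_mul] at *
  fin_cases i <;> simp [perp]
  · linear_combination (-ξ 0) * h3
  · linear_combination (-ξ 1) * h3

/-- On the circle the square root is constant, so the border equation becomes linear and fixes the
component of ξ along `L`. -/
lemma mem_circleEllipsePoints {R : Matrix (Fin 2) (Fin 2) ℂ} {r : ℝ} {ξ : Fin 2 → ℝ}
    (hL : vecL R ≠ 0) (hr : r ^ 2 = ξ ⬝ᵥ ξ)
    (h : trR R * √(1 + ξ ⬝ᵥ ξ) = detR R + 1 + vecL R ⬝ᵥ ξ) : ξ ∈ circleEllipsePoints r R := by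
  refine ⟨hL, ?_⟩
  obtain ⟨s, hs⟩ := eq_smul_add_smul_perp hL
    (show vecL R ⬝ᵥ ξ = trR R * √(r ^ 2 + 1) - detR R - 1 by rw [hr, add_comm (ξ ⬝ᵥ ξ)]; linarith)
  exact ⟨s, hs, by rw [hr, sub_self]⟩

/-- Dividing both border equations by their traces and subtracting eliminates the square root; what
remains is a line with normal `L'`. -/
lemma mem_ellipseEllipsePoints {R S : Matrix (Fin 2) (Fin 2) ℂ} {ξ : Fin 2 → ℝ}
    (hL : vecL' R S ≠ 0) (hR0 : trR R ≠ 0) (hS0 : trR S ≠ 0)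
    (h : trR R * √(1 + ξ ⬝ᵥ ξ) = detR R + 1 + vecL R ⬝ᵥ ξ)
    (h' : trR S * √(1 + ξ ⬝ᵥ ξ) = detR S + 1 + vecL S ⬝ᵥ ξ) : ξ ∈ ellipseEllipsePoints R S := by
  refine ⟨hL, ?_⟩
  have e : vecL' R S ⬝ᵥ ξ = (detR R + 1) / trR R - (detR S + 1) / trR S := by
    rw [vecL', sub_dotProduct, smul_dotProduct, smul_dotProduct, smul_eq_mul, smul_eq_mul]
    field_simp
    linear_combination trR S * h - trR R * h'
  obtain ⟨s, hs⟩ := eq_smul_add_smul_perp hL e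
  refine ⟨s, hs, ?_⟩
  rw [← sq_sqrt_one_add ξ]
  linear_combination (-(trR R * √(1 + ξ ⬝ᵥ ξ)) - (detR R + 1 + vecL R ⬝ᵥ ξ)) * h

/-- If some point satisfies the three inequalities, then so does a candidate point. -/
theorem exists_candidatePoint {R S : Matrix (Fin 2) (Fin 2) ℂ} (hR : R.IsHermitian)
    (hS : S.IsHermitian) (hR0 : 0 < detR R) (hS0 : 0 < detR S) {ξ₀ : Fin 2 → ℝ}
    (h : SepCond R S ξ₀) : ∃ ξ ∈ candidatePoints R S, SepCond R S ξ := by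
  have h1 : 1 ≤ √(1 + ξ₀ ⬝ᵥ ξ₀) := Real.one_le_sqrt.2 (by
    rw [dotProduct_fin_two]; nlinarith [sq_nonneg (ξ₀ 0), sq_nonneg (ξ₀ 1)])
  -- Both traces are at least 2, so neither radius is the square root of a negative number.
  have hm : 2 ≤ min (trR R) (trR S) := by linarith [h.1]
  have htR : 0 < trR R := by linarith [min_le_left (trR R) (trR S)]
  have htS : 0 < trR S := by linarith [min_le_right (trR R) (trR S)]
  have hcirc : circleRadius R S ^ 2 + 1 = (min (trR R) (trR S) / 2) ^ 2 := by
    rw [circleRadius]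
    rcases le_total (trR R) (trR S) with hle | hle
    · have : trR R ^ 2 / 4 - 1 ≤ trR S ^ 2 / 4 - 1 := by nlinarith
      rw [min_eq_left hle] at *
      rw [min_eq_left (Real.sqrt_le_sqrt this), Real.sq_sqrt (by nlinarith)]
      ring
    · have : trR S ^ 2 / 4 - 1 ≤ trR R ^ 2 / 4 - 1 := by nlinarith
      rw [min_eq_right hle] at *
      rw [min_eq_right (Real.sqrt_le_sqrt this), Real.sq_sqrt (by nlinarith)]
      ring
  -- After division by the factors of the square root, all three inequalities read `conicFn ≤ 0`;
  -- the disk is the case `l = 0`.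
  let l : Fin 3 → Fin 2 → ℝ := ![0, (trR R)⁻¹ • vecL R, (trR S)⁻¹ • vecL S]
  let c : Fin 3 → ℝ := ![min (trR R) (trR S) / 2, (detR R + 1) / trR R, (detR S + 1) / trR S]
  have hlt : ∀ T : Matrix (Fin 2) (Fin 2) ℂ, T.IsHermitian → 0 < trR T → 0 < detR T →
      ((trR T)⁻¹ • vecL T) ⬝ᵥ ((trR T)⁻¹ • vecL T) < 1 := by
    intro T hT ht hd
    rw [smul_dotProduct, dotProduct_smul, smul_eq_mul, smul_eq_mul, ← mul_assoc, ← mul_inv,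
      inv_mul_lt_one₀ (by positivity)]
    nlinarith [trR_sq_sub hT, sq_nonneg (T 0 1).im]
  have hle : ∀ (T : Matrix (Fin 2) (Fin 2) ℂ) (ξ : Fin 2 → ℝ), 0 < trR T →
      (conicFn ((trR T)⁻¹ • vecL T) ((detR T + 1) / trR T) ξ ≤ 0 ↔
        trR T * √(1 + ξ ⬝ᵥ ξ) ≤ detR T + 1 + vecL T ⬝ᵥ ξ) := by
    intro T ξ ht
    have : conicFn ((trR T)⁻¹ • vecL T) ((detR T + 1) / trR T) ξ =
        (trR T * √(1 + ξ ⬝ᵥ ξ) - (detR T + 1 + vecL T ⬝ᵥ ξ)) / trR T := by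
      rw [conicFn, smul_dotProduct, smul_eq_mul]; field_simp; ring
    rw [this, div_le_iff₀ ht, zero_mul, sub_nonpos]
  have heq : ∀ (T : Matrix (Fin 2) (Fin 2) ℂ) (ξ : Fin 2 → ℝ), 0 < trR T →
      conicFn ((trR T)⁻¹ • vecL T) ((detR T + 1) / trR T) ξ = 0 →
        trR T * √(1 + ξ ⬝ᵥ ξ) = detR T + 1 + vecL T ⬝ᵥ ξ := by
    intro T ξ ht h
    rw [conicFn, smul_dotProduct, smul_eq_mul] at h
    field_simp at h
    linarith
  have hsep : ∀ ξ, SepCond R S ξ ↔ ∀ i, conicFn (l i) (c i) ξ ≤ 0 := by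
    intro ξ
    rw [Fin.forall_fin_succ, Fin.forall_fin_two]
    refine and_congr ?_ (and_congr (hle R ξ htR).symm (hle S ξ htS).symm)
    simp only [l, c, conicFn, Matrix.cons_val_zero, zero_dotProduct]
    constructor <;> intro h <;> linarith
  have hcen : ∀ T : Matrix (Fin 2) (Fin 2) ℂ, T.IsHermitian → 0 < trR T → 0 < detR T →
      conicCenter ((trR T)⁻¹ • vecL T) ((detR T + 1) / trR T) = ellipseCenter T := by
    intro T hT ht hd
    have hk : trR T ^ 2 - vecL T ⬝ᵥ vecL T ≠ 0 := by
      rw [trR_sq_sub hT]; positivity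
    rw [conicCenter, ellipseCenter, ← trR_sq_sub hT, smul_smul, smul_dotProduct, dotProduct_smul,
      smul_eq_mul, smul_eq_mul]
    congr 1
    have : 1 - (trR T)⁻¹ * ((trR T)⁻¹ * (vecL T ⬝ᵥ vecL T)) =
        (trR T ^ 2 - vecL T ⬝ᵥ vecL T) / trR T ^ 2 := by field_simp
    rw [this]
    field_simp
  have hcircle : ∀ (T : Matrix (Fin 2) (Fin 2) ℂ) (ξ : Fin 2 → ℝ), 0 < trR T →
      (0 : Fin 2 → ℝ) ≠ (trR T)⁻¹ • vecL T → conicFn 0 (min (trR R) (trR S) / 2) ξ = 0 →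
      conicFn ((trR T)⁻¹ • vecL T) ((detR T + 1) / trR T) ξ = 0 →
      ξ ∈ circleEllipsePoints (circleRadius R S) T := by
    intro T ξ ht hne h0 h1
    refine mem_circleEllipsePoints (fun h => hne (by rw [h, smul_zero])) ?_ (heq T ξ ht h1)
    have h2 : √(1 + ξ ⬝ᵥ ξ) = min (trR R) (trR S) / 2 := by
      rw [conicFn, zero_dotProduct] at h0; linarith
    have h3 := sq_sqrt_one_add ξ
    rw [h2, ← hcirc] at h3
    linarith
  have hee : ∀ ξ : Fin 2 → ℝ, (trR R)⁻¹ • vecL R ≠ (trR S)⁻¹ • vecL S →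
      conicFn ((trR R)⁻¹ • vecL R) ((detR R + 1) / trR R) ξ = 0 →
      conicFn ((trR S)⁻¹ • vecL S) ((detR S + 1) / trR S) ξ = 0 →
      ξ ∈ ellipseEllipsePoints R S := fun ξ hne h1 h2 =>
    mem_ellipseEllipsePoints (fun h => hne (sub_eq_zero.1 h).symm) htR.ne' htS.ne'
      (heq R ξ htR h1) (heq S ξ htS h2)
  rcases exists_conicCenter_or_corner l c
      (by
        rw [Fin.forall_fin_succ, Fin.forall_fin_two]
        exact ⟨by simp [l], hlt R hR htR hR0, hlt S hS htS hS0⟩)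
      (by
        rw [Fin.forall_fin_succ, Fin.forall_fin_two]
        refine ⟨?_, ?_, ?_⟩
        · show 0 ≤ min (trR R) (trR S) / 2
          linarith
        · show 0 ≤ (detR R + 1) / trR R
          positivity
        · show 0 ≤ (detR S + 1) / trR S
          positivity)
      ⟨0, rfl⟩ ξ₀ ((hsep ξ₀).1 h) with ⟨i, hi⟩ | ⟨q, hq, i, j, hij, hqi, hqj⟩
  · refine ⟨_, ?_, (hsep _).2 hi⟩
    left; left; left
    fin_cases i
    · left
      simp [l, conicCenter]
    · right; left
      exact hcen R hR htR hR0
    · right; right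
      exact hcen S hS htS hS0
  · refine ⟨q, ?_, (hsep q).2 hq⟩
    fin_cases i <;> fin_cases j
    · exact absurd rfl hij
    · left; right
      exact hcircle R q htR hij hqi hqj
    · right
      exact hcircle S q htS hij hqi hqj
    · left; right
      exact hcircle R q htR hij.symm hqj hqi
    · exact absurd rfl hij
    · left; left; right
      exact hee q hij hqi hqj
    · right
      exact hcircle S q htS hij.symm hqj hqi
    · left; left; right
      exact hee q hij.symm hqj hqi
    · exact absurd rfl hij

/-! ### Product bounds from partial transposes -/

/-- The antisymmetric matrix of one mode. -/
def matJ₁ : Matrix (Fin 2) (Fin 2) ℝ := !![0, -1; 1, 0]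

lemma matJ₁_transpose : matJ₁ᵀ = -matJ₁ := by
  ext i j; fin_cases i <;> fin_cases j <;> simp [matJ₁]

lemma matJ₁_form (x y : Fin 2 → ℝ) : x ⬝ᵥ matJ₁ *ᵥ y = x 1 * y 0 - x 0 * y 1 := by
  simp [matJ₁, dotProduct, Matrix.mulVec, Fin.sum_univ_two]
  ring

lemma isCM_of_form {g : Matrix (Fin 2) (Fin 2) ℝ} (hs : g.IsSymm)
    (h : ∀ x y, 0 ≤ x ⬝ᵥ g *ᵥ x + y ⬝ᵥ g *ᵥ y + 2 * (x ⬝ᵥ matJ₁ *ᵥ y)) : IsCM g :=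
  ⟨hs, fun x y => by have := h x y; rw [matJ₁_form] at this; linarith⟩

lemma eq_subI_matJ₁ {N : Matrix (Fin 2) (Fin 2) ℂ} (hN : N.IsHermitian) :
    N = subI (N.map Complex.re) ((N 0 1).im • matJ₁) := by
  have h0 : (N 0 0).im = 0 := by
    have := congrArg Complex.im (hN.apply 0 0); simp at this; linarith
  have h1 : (N 1 1).im = 0 := by
    have := congrArg Complex.im (hN.apply 1 1); simp at this; linarith
  have h10 : (N 1 0).im = -(N 0 1).im := by
    have := congrArg Complex.im (hN.apply 1 0); simp at this; linarith
  ext i j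
  apply Complex.ext <;> fin_cases i <;> fin_cases j <;> simp [subI, matJ₁, h0, h1, h10]

lemma isSymm_map_re {m : Type} {N : Matrix m m ℂ} (hN : N.IsHermitian) :
    (N.map Complex.re).IsSymm := by
  ext i j
  have := congrArg Complex.re (hN.apply i j)
  simpa using this

/-- If a real two-mode matrix and its partial transpose are physical, then it lies above the
correlation matrix of a product state. -/
theorem exists_product_le {P Y Q : Matrix (Fin 2) (Fin 2) ℝ} (hP : P.IsSymm) (hQ : Q.IsSymm)
    (h₁ : ∀ x y u v, 0 ≤ blockForm P Y Q x u + blockForm P Y Q y v +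
      2 * (x ⬝ᵥ matJ₁ *ᵥ y) + 2 * (u ⬝ᵥ matJ₁ *ᵥ v))
    (h₂ : ∀ x y u v, 0 ≤ blockForm P Y Q x u + blockForm P Y Q y v -
      2 * (x ⬝ᵥ matJ₁ *ᵥ y) + 2 * (u ⬝ᵥ matJ₁ *ᵥ v)) :
    ∃ g g' : Matrix (Fin 2) (Fin 2) ℝ, IsCM g ∧ IsCM g' ∧
      ∀ x u, x ⬝ᵥ g *ᵥ x + u ⬝ᵥ g' *ᵥ u ≤ blockForm P Y Q x u := by
  have hJneg : (-matJ₁)ᵀ = -(-matJ₁) := by rw [Matrix.transpose_neg, matJ₁_transpose]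
  have hs₁ := posSemidef_schur_of_form hP hQ matJ₁_transpose matJ₁_transpose h₁
  have hs₂ := posSemidef_schur_of_form hP hQ hJneg matJ₁_transpose
    (fun x y u v => by have := h₂ x y u v; rw [Matrix.neg_mulVec, dotProduct_neg]; linarith)
  set X := Y.map Complex.ofReal * hermPinv (subI Q matJ₁) * (Y.map Complex.ofReal)ᵀ with hX
  set N := subI P 0 - X with hN
  have hXH : X.IsHermitian := by
    have : (Y.map Complex.ofReal)ᵀ = (Y.map Complex.ofReal)ᴴ := by ext i j; simp
    rw [hX, this]
    exact Matrix.isHermitian_mul_mul_conjTranspose _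
      (isHermitian_hermPinv (isHermitian_subI hQ matJ₁_transpose))
  have hNH : N.IsHermitian := (isHermitian_subI hP (by simp)).sub hXH
  have hR := isSymm_map_re hNH
  have hNeq := eq_subI_matJ₁ hNH
  set R := N.map Complex.re
  set μ := (N 0 1).im
  have hsmul : ∀ t : ℝ, (t • matJ₁)ᵀ = -(t • matJ₁) := fun t => by
    rw [Matrix.transpose_smul, matJ₁_transpose, smul_neg]
  have hshift : ∀ K : Matrix (Fin 2) (Fin 2) ℝ, subI P K - X = subI R (μ • matJ₁ + K) := by
    intro K
    have h1 : subI P K - X = N - Complex.I • K.map Complex.ofReal := by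
      rw [hN]; ext i j; simp [subI]; ring
    rw [h1, hNeq]
    ext i j; simp [subI]; ring
  rw [hshift] at hs₁ hs₂
  have hf₁ := (posSemidef_subI_iff hR (by
    rw [Matrix.transpose_add, hsmul, matJ₁_transpose, neg_add])).1 hs₁
  have hf₂ := (posSemidef_subI_iff hR (by
    rw [Matrix.transpose_add, hsmul, hJneg, neg_add])).1 hs₂
  -- The hypotheses give `R ≥ i(μ + 1)J₁` and `R ≥ i(μ - 1)J₁`; with their complex conjugates
  -- (exchange of `x` and `y`) this is `R ≥ ± i(1 + |μ|)J₁`.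
  have hform : ∀ x y, 2 * (1 + |μ|) * |x ⬝ᵥ matJ₁ *ᵥ y| ≤ x ⬝ᵥ R *ᵥ x + y ⬝ᵥ R *ᵥ y := by
    intro x y
    have a1 := hf₁ x y
    have a2 := hf₂ x y
    have a3 := hf₁ y x
    have a4 := hf₂ y x
    simp only [Matrix.add_mulVec, dotProduct_add, Matrix.neg_mulVec, dotProduct_neg,
      Matrix.smul_mulVec, dotProduct_smul, smul_eq_mul] at a1 a2 a3 a4
    have a5 : y ⬝ᵥ matJ₁ *ᵥ x = -(x ⬝ᵥ matJ₁ *ᵥ y) := by rw [matJ₁_form, matJ₁_form]; ring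
    rw [a5] at a3 a4
    rcases abs_cases μ with ⟨h, _⟩ | ⟨h, _⟩ <;>
      rcases abs_cases (x ⬝ᵥ matJ₁ *ᵥ y) with ⟨h', _⟩ | ⟨h', _⟩ <;> rw [h, h'] <;> linarith
  have hpos : 0 < 1 + |μ| := by positivity
  -- This splits `R` so that `g ≥ iJ₁` and `R - g = |μ| g ≥ iμJ₁`. The second bound keeps the Schur
  -- complement positive after `g` is subtracted from `P`.
  set g := (1 + |μ|)⁻¹ • R with hg
  have hgs : g.IsSymm := hR.smul _
  have hgCM : IsCM g := by
    refine isCM_of_form hgs fun x y => ?_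
    have h1 := hform x y
    have h2 := neg_abs_le (x ⬝ᵥ matJ₁ *ᵥ y)
    rw [hg, quadForm_smul, quadForm_smul]
    have h3 : 2 * |x ⬝ᵥ matJ₁ *ᵥ y| ≤ (1 + |μ|)⁻¹ * (x ⬝ᵥ R *ᵥ x + y ⬝ᵥ R *ᵥ y) := by
      rw [le_inv_mul_iff₀ hpos]; linarith
    linarith
  have hschur : (subI (P - g) 0 - X).PosSemidef := by
    have h1 : subI (P - g) 0 - X = subI (R - g) (μ • matJ₁) := by
      have h2 : subI (P - g) 0 - X = N - g.map Complex.ofReal := by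
        rw [hN]; ext i j; simp [subI]; ring
      rw [h2, hNeq]
      ext i j; simp [subI]; ring
    rw [h1, posSemidef_subI_iff (hR.sub hgs) (hsmul μ)]
    intro x y
    rw [quadForm_sub, quadForm_sub, hg, quadForm_smul, quadForm_smul, Matrix.smul_mulVec,
      dotProduct_smul, smul_eq_mul]
    have h1 := hform x y
    have h2 : -(|μ| * |x ⬝ᵥ matJ₁ *ᵥ y|) ≤ μ * (x ⬝ᵥ matJ₁ *ᵥ y) := by
      rw [← abs_mul]; exact neg_abs_le _
    have h3 : 2 * (|μ| * |x ⬝ᵥ matJ₁ *ᵥ y|) ≤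
        (1 - (1 + |μ|)⁻¹) * (x ⬝ᵥ R *ᵥ x + y ⬝ᵥ R *ᵥ y) := by
      have h4 : 1 - (1 + |μ|)⁻¹ = |μ| * (1 + |μ|)⁻¹ := by field_simp; ring
      rw [h4, mul_assoc, ← mul_left_comm]
      refine mul_le_mul_of_nonneg_left ?_ (abs_nonneg _)
      rw [le_inv_mul_iff₀ hpos]; linarith
    linarith
  have hfin := form_of_posSemidef_schur hP matJ₁_transpose (hP.sub hgs) hQ (by simp)
    matJ₁_transpose h₁ hschur
  obtain ⟨g', hg's, hle, Z, hZ⟩ := exists_lower_complement (hP.sub hgs) hQ (fun x u => by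
    have := hfin x 0 u 0
    simpa [blockForm] using this)
  refine ⟨g, g', hgCM, isCM_of_form hg's fun u v => ?_, fun x u => ?_⟩
  · have := hfin (Z *ᵥ u) (Z *ᵥ v) u v
    rw [hZ, hZ] at this
    simpa using this
  · have := hle x u
    rw [blockForm, quadForm_sub] at this
    rw [blockForm]
    linarith

/-! ### Three-mode correlation matrices in blocks -/

/-- The coordinates of the last two of three modes. -/
def tailPart (x : PhaseIdx 3 → ℝ) : PhaseIdx 2 → ℝ := fun j => x (j.1.succ, j.2)

lemma sum_phaseIdx_three (f : PhaseIdx 3 → ℝ) :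
    ∑ j, f j = ∑ i, f (0, i) + ∑ j : PhaseIdx 2, f (j.1.succ, j.2) := by
  rw [Fintype.sum_prod_type, Fintype.sum_prod_type, Fin.sum_univ_succ]

lemma quadForm_three {γ : Matrix (PhaseIdx 3) (PhaseIdx 3) ℝ} (hγ : γ.IsSymm)
    (x : PhaseIdx 3 → ℝ) : x ⬝ᵥ γ *ᵥ x =
      blockForm (blockA γ) (blockC γ) (blockB γ) (fun i => x (0, i)) (tailPart x) := by
  have h1 : ∀ i : Fin 2, ∀ j : PhaseIdx 2, γ (j.1.succ, j.2) (0, i) = γ (0, i) (j.1.succ, j.2) :=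
    fun i j => hγ.apply _ _
  simp only [blockForm, dotProduct, Matrix.mulVec, sum_phaseIdx_three, mul_add,
    Finset.sum_add_distrib, blockA, blockB, blockC, Matrix.submatrix_apply, tailPart, h1]
  have h2 : ∑ j : PhaseIdx 2, x (j.1.succ, j.2) * ∑ i, γ (0, i) (j.1.succ, j.2) * x (0, i) =
      ∑ i, x (0, i) * ∑ j : PhaseIdx 2, γ (0, i) (j.1.succ, j.2) * x (j.1.succ, j.2) := by
    simp only [Finset.mul_sum]
    rw [Finset.sum_comm]
    exact Finset.sum_congr rfl fun i _ => Finset.sum_congr rfl fun j _ => by ring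
  rw [h2]; ring

lemma quadForm_two {M : Matrix (PhaseIdx 2) (PhaseIdx 2) ℝ} (hM : M.IsSymm)
    (x : PhaseIdx 2 → ℝ) : x ⬝ᵥ M *ᵥ x =
      blockForm (M.submatrix (fun i => (0, i)) (fun i => (0, i)))
        (M.submatrix (fun i => (0, i)) (fun i => (1, i)))
        (M.submatrix (fun i => (1, i)) (fun i => (1, i)))
        (fun i => x (0, i)) (fun i => x (1, i)) := by
  have h1 : ∀ i j : Fin 2, M (1, j) (0, i) = M (0, i) (1, j) := fun i j => hM.apply _ _
  simp only [blockForm, dotProduct, Matrix.mulVec, Fintype.sum_prod_type, Fin.sum_univ_two,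
    Matrix.submatrix_apply, h1]
  ring

lemma signedJ_form {n : ℕ} (ε : Fin n → ℝ) (x y : PhaseIdx n → ℝ) :
    x ⬝ᵥ signedJ ε *ᵥ y = ∑ k, ε k * (x (k, 1) * y (k, 0) - x (k, 0) * y (k, 1)) := by
  simp only [dotProduct, Matrix.mulVec, signedJ, Fintype.sum_prod_type]
  refine Finset.sum_congr rfl fun k _ => ?_
  simp only [Fin.sum_univ_two]
  simp
  ring

lemma signedJ_transpose {n : ℕ} (ε : Fin n → ℝ) : (signedJ ε)ᵀ = -signedJ ε := by
  ext ⟨k, i⟩ ⟨l, j⟩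
  simp only [Matrix.transpose_apply, Matrix.neg_apply, signedJ]
  by_cases h : k = l
  · subst h
    simp only [if_true]
    fin_cases i <;> fin_cases j <;> simp
  · rw [if_neg h, if_neg (Ne.symm h), neg_zero]

lemma isSymm_blockA {γ : Matrix (PhaseIdx 3) (PhaseIdx 3) ℝ} (hγ : γ.IsSymm) :
    (blockA γ).IsSymm := hγ.submatrix _

lemma isSymm_blockB {γ : Matrix (PhaseIdx 3) (PhaseIdx 3) ℝ} (hγ : γ.IsSymm) :
    (blockB γ).IsSymm := hγ.submatrix _

lemma flipP_mulVec_apply {n : ℕ} (k : Fin n) (x : PhaseIdx n → ℝ) (j : PhaseIdx n) :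
    (flipP k *ᵥ x) j = (if j = (k, 1) then -1 else 1) * x j := by
  rw [flipP, Matrix.mulVec_diagonal]

/-- The flip is moved from γ to `J`, where it reverses the sign of the `k`-th summand. -/
lemma isPPT_form {γ : Matrix (PhaseIdx 3) (PhaseIdx 3) ℝ} (hγ : γ.IsSymm) (h : IsPPT γ)
    (k : Fin 3) (x y : PhaseIdx 3 → ℝ) : 0 ≤ x ⬝ᵥ γ *ᵥ x + y ⬝ᵥ γ *ᵥ y +
      2 * (x ⬝ᵥ signedJ (fun l => if l = k then -1 else 1) *ᵥ y) := by
  have hsT : (flipP k)ᵀ = flipP k := by rw [flipP, Matrix.diagonal_transpose]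
  have hs : (partialTranspose k γ).IsSymm := by
    rw [partialTranspose, Matrix.IsSymm, Matrix.transpose_mul, Matrix.transpose_mul, hsT, hγ.eq,
      Matrix.mul_assoc]
  have hff : ∀ x : PhaseIdx 3 → ℝ, flipP k *ᵥ flipP k *ᵥ x = x := by
    intro x
    funext j
    rw [flipP_mulVec_apply, flipP_mulVec_apply]
    split_ifs <;> ring
  have hq : ∀ x : PhaseIdx 3 → ℝ,
      (flipP k *ᵥ x) ⬝ᵥ partialTranspose k γ *ᵥ (flipP k *ᵥ x) = x ⬝ᵥ γ *ᵥ x := by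
    intro x
    rw [partialTranspose, ← Matrix.mulVec_mulVec, hff, ← Matrix.mulVec_mulVec,
      dotProduct_mulVec_swap, hsT, hff, dotProduct_comm]
  have h1 := (posSemidef_subI_iff hs (signedJ_transpose _)).1 (h k) (flipP k *ᵥ x) (flipP k *ᵥ y)
  rw [hq, hq] at h1
  refine h1.trans_eq ?_
  congr 2
  rw [signedJ_form, signedJ_form]
  refine Finset.sum_congr rfl fun l _ => ?_
  simp only [flipP_mulVec_apply, Prod.mk.injEq, zero_ne_one, and_false, if_false, and_true]
  split_ifs <;> ring

lemma symplForm_eq_signedJ {n : ℕ} (x y : PhaseIdx n → ℝ) :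
    symplForm x y = -(x ⬝ᵥ signedJ (fun _ => 1) *ᵥ y) := by
  rw [signedJ_form, symplForm, ← Finset.sum_neg_distrib]
  exact Finset.sum_congr rfl fun k _ => by ring

section ThreeModes

variable {γ : Matrix (PhaseIdx 3) (PhaseIdx 3) ℝ}

lemma exists_parts (x : Fin 2 → ℝ) (u : PhaseIdx 2 → ℝ) : ∃ z : PhaseIdx 3 → ℝ,
    (fun i => z (0, i)) = x ∧ tailPart z = u := by
  refine ⟨fun j => Fin.cases (x j.2) (fun k => u (k, j.2)) j.1, ?_, ?_⟩
  · funext i; simp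
  · funext j; simp [tailPart]

/-- Two bounds are averaged so that the first mode cancels: the signs `(+,+,+)` and `(-,+,+)` leave
`(0,+,+)`; `(+,+,-)` and `(-,+,-)`, the conjugate of `(+,-,+)`, leave `(0,+,-)`. -/
lemma blockForm_nonneg_of_ppt (hγ : γ.IsSymm)
    (hunc : ∀ x y, 2 * symplForm x y ≤ x ⬝ᵥ γ *ᵥ x + y ⬝ᵥ γ *ᵥ y) (hPPT : IsPPT γ)
    (x y : Fin 2 → ℝ) (u v : PhaseIdx 2 → ℝ) :
    (0 ≤ blockForm (blockA γ) (blockC γ) (blockB γ) x u +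
      blockForm (blockA γ) (blockC γ) (blockB γ) y v + 2 * (x ⬝ᵥ (0 : Matrix _ _ ℝ) *ᵥ y) +
      2 * (u ⬝ᵥ symplJ 2 *ᵥ v)) ∧
    (0 ≤ blockForm (blockA γ) (blockC γ) (blockB γ) x u +
      blockForm (blockA γ) (blockC γ) (blockB γ) y v + 2 * (x ⬝ᵥ (0 : Matrix _ _ ℝ) *ᵥ y) +
      2 * (u ⬝ᵥ symplJTilde *ᵥ v)) := by
  obtain ⟨x, rfl, rfl⟩ := exists_parts x u
  obtain ⟨y, rfl, rfl⟩ := exists_parts y v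
  rw [← quadForm_three hγ, ← quadForm_three hγ]
  have h0 := hunc x y
  have h1 := isPPT_form hγ hPPT 0 x y
  have h2 := isPPT_form hγ hPPT 1 y x
  have h3 := isPPT_form hγ hPPT 2 x y
  rw [symplForm_eq_signedJ] at h0
  simp only [signedJ_form, Fin.sum_univ_three] at h0 h1 h2 h3
  simp only [symplJ, symplJTilde, signedJ_form, Fin.sum_univ_two, tailPart]
  simp at h0 h1 h2 h3 ⊢
  constructor <;> linarith

lemma subI_zero {m : Type} (M : Matrix m m ℝ) : subI M 0 = M.map Complex.ofReal := by
  ext i j; simp [subI]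

lemma schurN_sub (D : Matrix (Fin 2) (Fin 2) ℝ) (K : Matrix (PhaseIdx 2) (PhaseIdx 2) ℝ) :
    schurN γ K - D.map Complex.ofReal = subI (blockA γ - D) 0 -
      (blockC γ).map Complex.ofReal * hermPinv (subI (blockB γ) K) *
        ((blockC γ).map Complex.ofReal)ᵀ := by
  rw [schurN, subI_zero]
  ext i j
  simp
  ring

lemma isHermitian_schurN (hγ : γ.IsSymm) {K : Matrix (PhaseIdx 2) (PhaseIdx 2) ℝ} (hK : Kᵀ = -K) :
    (schurN γ K).IsHermitian := by
  have : ((blockC γ).map Complex.ofReal)ᵀ = ((blockC γ).map Complex.ofReal)ᴴ := by ext i j; simp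
  rw [schurN, ← subI_zero, this]
  exact (isHermitian_subI (isSymm_blockA hγ) (by simp)).sub
    (Matrix.isHermitian_mul_mul_conjTranspose _
      (isHermitian_hermPinv (isHermitian_subI (isSymm_blockB hγ) hK)))

lemma blockForm_sub_left {m n : Type} [Fintype m] [Fintype n] (A D : Matrix m m ℝ)
    (C : Matrix m n ℝ) (B : Matrix n n ℝ) (x : m → ℝ) (u : n → ℝ) :
    blockForm (A - D) C B x u = blockForm A C B x u - x ⬝ᵥ D *ᵥ x := by
  rw [blockForm, blockForm, quadForm_sub]; ring

/-- A PPT correlation matrix of three modes lies above that of a product state if and only if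
there is a one-mode correlation matrix below both `N` and `Ñ`. -/
theorem mem_aboveProduct_iff (hγ : γ.IsSymm)
    (hunc : ∀ x y, 2 * symplForm x y ≤ x ⬝ᵥ γ *ᵥ x + y ⬝ᵥ γ *ᵥ y) (hPPT : IsPPT γ) :
    γ ∈ aboveProduct 3 ↔ ∃ D, IsCM D ∧ (matN γ - D.map Complex.ofReal).PosSemidef ∧
      (matNTilde γ - D.map Complex.ofReal).PosSemidef := by
  have hA := isSymm_blockA hγ
  have hB := isSymm_blockB hγ
  have h0 : (0 : Matrix (Fin 2) (Fin 2) ℝ)ᵀ = -0 := by simp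
  have hJ : (symplJ 2)ᵀ = -symplJ 2 := signedJ_transpose _
  have hJt : symplJTildeᵀ = -symplJTilde := signedJ_transpose _
  constructor
  · rintro ⟨g, hg, hP⟩
    have hge : ∀ x, ∑ k, (fun i => x (k, i)) ⬝ᵥ g k *ᵥ (fun i => x (k, i)) ≤ x ⬝ᵥ γ *ᵥ x := by
      intro x
      have := ((posSemidef_real_iff _).1 hP).2 x
      rw [quadForm_sub, quadForm_modeSum] at this
      linarith
    -- `hKle` covers both signs of `J₁` on each of the last two modes; `g 1` and `g 2` dominate all
    -- of these.
    have hform : ∀ K : Matrix (PhaseIdx 2) (PhaseIdx 2) ℝ, Kᵀ = -K →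
        (∀ u v : PhaseIdx 2 → ℝ, -(u ⬝ᵥ K *ᵥ v) ≤
          |u (0, 0) * v (0, 1) - u (0, 1) * v (0, 0)| +
          |u (1, 0) * v (1, 1) - u (1, 1) * v (1, 0)|) →
        (schurN γ K - (g 0).map Complex.ofReal).PosSemidef := by
      intro K hK hKle
      rw [schurN_sub]
      refine posSemidef_schur_of_form (hA.sub (hg 0).1) hB h0 hK fun x y u v => ?_
      obtain ⟨x, rfl, rfl⟩ := exists_parts x u
      obtain ⟨y, rfl, rfl⟩ := exists_parts y v
      rw [blockForm_sub_left, blockForm_sub_left, ← quadForm_three hγ, ← quadForm_three hγ]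
      have hx := hge x
      have hy := hge y
      rw [Fin.sum_univ_three] at hx hy
      have hcm : ∀ k, 2 * |x (k, 0) * y (k, 1) - x (k, 1) * y (k, 0)| ≤
          (fun i => x (k, i)) ⬝ᵥ g k *ᵥ (fun i => x (k, i)) +
          (fun i => y (k, i)) ⬝ᵥ g k *ᵥ (fun i => y (k, i)) := by
        intro k
        have a1 := (hg k).2 (fun i => x (k, i)) (fun i => y (k, i))
        have a2 := (hg k).2 (fun i => y (k, i)) (fun i => x (k, i))
        rcases abs_cases (x (k, 0) * y (k, 1) - x (k, 1) * y (k, 0)) with ⟨h, _⟩ | ⟨h, _⟩ <;>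
          rw [h] <;> linarith
      have h1 := hcm 1
      have h2 := hcm 2
      have h3 := hKle (tailPart x) (tailPart y)
      simp only [tailPart, Fin.succ_zero_eq_one, Fin.succ_one_eq_two] at h3
      simp only [Matrix.zero_mulVec, dotProduct_zero]
      linarith
    refine ⟨g 0, hg 0, hform _ hJ fun u v => ?_, hform _ hJt fun u v => ?_⟩
    · simp only [symplJ, signedJ_form, Fin.sum_univ_two]
      have a1 := le_abs_self (u (0, 0) * v (0, 1) - u (0, 1) * v (0, 0))
      have a2 := le_abs_self (u (1, 0) * v (1, 1) - u (1, 1) * v (1, 0))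
      linarith
    · simp only [symplJTilde, signedJ_form, Fin.sum_univ_two, Matrix.cons_val_zero,
        Matrix.cons_val_one]
      have a1 := le_abs_self (u (0, 0) * v (0, 1) - u (0, 1) * v (0, 0))
      have a2 := neg_abs_le (u (1, 0) * v (1, 1) - u (1, 1) * v (1, 0))
      linarith
  · rintro ⟨D, hD, hN, hNt⟩
    rw [matN, schurN_sub] at hN
    rw [matNTilde, schurN_sub] at hNt
    have hf := form_of_posSemidef_schur hA h0 (hA.sub hD.1) hB h0 hJ
      (fun x y u v => (blockForm_nonneg_of_ppt hγ hunc hPPT x y u v).1) hN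
    have hft := form_of_posSemidef_schur hA h0 (hA.sub hD.1) hB h0 hJt
      (fun x y u v => (blockForm_nonneg_of_ppt hγ hunc hPPT x y u v).2) hNt
    -- Minimizing over the first mode leaves a real two-mode matrix `M` that dominates `iJ` and
    -- `iJ̃`, since the minimizer depends linearly on the other modes.
    obtain ⟨M, hMs, hle, Z, hZ⟩ := exists_lower_complement (hA.sub hD.1) hB (fun x u => by
      have := hf x 0 u 0
      simpa [blockForm] using this)
    have hM : ∀ u v, 0 ≤ u ⬝ᵥ M *ᵥ u + v ⬝ᵥ M *ᵥ v + 2 * (u ⬝ᵥ symplJ 2 *ᵥ v) := by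
      intro u v
      have := hf (Z *ᵥ u) (Z *ᵥ v) u v
      rw [hZ, hZ] at this
      simpa using this
    have hMt : ∀ u v, 0 ≤ u ⬝ᵥ M *ᵥ u + v ⬝ᵥ M *ᵥ v + 2 * (u ⬝ᵥ symplJTilde *ᵥ v) := by
      intro u v
      have := hft (Z *ᵥ u) (Z *ᵥ v) u v
      rw [hZ, hZ] at this
      simpa using this
    have hparts : ∀ x u : Fin 2 → ℝ, ∃ z : PhaseIdx 2 → ℝ,
        (fun i => z (0, i)) = x ∧ (fun i => z (1, i)) = u := fun x u =>
      ⟨fun j => if j.1 = 0 then x j.2 else u j.2, by simp, by simp⟩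
    obtain ⟨g, g', hg, hg', hgg⟩ := exists_product_le
      (P := M.submatrix (fun i => (0, i)) (fun i => (0, i)))
      (Y := M.submatrix (fun i => (0, i)) (fun i => (1, i)))
      (Q := M.submatrix (fun i => (1, i)) (fun i => (1, i)))
      (hMs.submatrix _) (hMs.submatrix _)
      (fun x y u v => by
        obtain ⟨x, rfl, rfl⟩ := hparts x u
        obtain ⟨y, rfl, rfl⟩ := hparts y v
        rw [← quadForm_two hMs, ← quadForm_two hMs, matJ₁_form, matJ₁_form]
        have := hM x y
        simp only [symplJ, signedJ_form, Fin.sum_univ_two] at this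
        linarith)
      (fun x y u v => by
        obtain ⟨x, rfl, rfl⟩ := hparts x u
        obtain ⟨y, rfl, rfl⟩ := hparts y v
        rw [← quadForm_two hMs, ← quadForm_two hMs, matJ₁_form, matJ₁_form]
        -- Exchanging the arguments replaces `J̃` by `-J₁ ⊕ J₁`, the sign pattern of `h₂` in
        -- `exists_product_le`.
        have := hMt y x
        simp only [symplJTilde, signedJ_form, Fin.sum_univ_two, Matrix.cons_val_zero,
          Matrix.cons_val_one] at this
        linarith)
    refine ⟨![D, g, g'], ?_, ?_⟩
    · intro k; fin_cases k
      · exact hD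
      · exact hg
      · exact hg'
    · rw [posSemidef_real_iff]
      refine ⟨?_, fun x => ?_⟩
      · refine hγ.sub ?_
        ext ⟨k, i⟩ ⟨l, j⟩
        simp only [modeSum, Matrix.transpose_apply, Matrix.of_apply]
        by_cases h : k = l
        · subst h
          simp only [if_true]
          fin_cases k
          · exact hD.1.apply _ _
          · exact hg.1.apply _ _
          · exact hg'.1.apply _ _
        · rw [if_neg h, if_neg (Ne.symm h)]
      · rw [quadForm_sub, quadForm_modeSum, quadForm_three hγ, Fin.sum_univ_three]
        have h1 := hle (fun i => x (0, i)) (tailPart x)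
        rw [blockForm_sub_left, quadForm_two hMs] at h1
        have h2 := hgg (fun i => x (1, i)) (fun i => x (2, i))
        have h3 : (fun i => tailPart x (0, i)) = fun i => x (1, i) := rfl
        have h4 : (fun i => tailPart x (1, i)) = fun i => x (2, i) := rfl
        rw [h3, h4] at h1
        show 0 ≤ _ - ((fun i => x (0, i)) ⬝ᵥ D *ᵥ (fun i => x (0, i)) +
          (fun i => x (1, i)) ⬝ᵥ g *ᵥ (fun i => x (1, i)) +
          (fun i => x (2, i)) ⬝ᵥ g' *ᵥ (fun i => x (2, i)))
        linarith

end ThreeModes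

/-! ### One-mode correlation matrices below Hermitian matrices -/

/-- The real symmetric matrix of determinant one with parameters `ξ`. -/
noncomputable def pureCM (ξ : Fin 2 → ℝ) : Matrix (Fin 2) (Fin 2) ℝ :=
  !![√(1 + ξ ⬝ᵥ ξ) + ξ 0, ξ 1; ξ 1, √(1 + ξ ⬝ᵥ ξ) - ξ 0]

lemma posSemidef_fin_two_iff {R : Matrix (Fin 2) (Fin 2) ℂ} (hR : R.IsHermitian) :
    R.PosSemidef ↔ 0 ≤ trR R ∧ 0 ≤ detR R := by
  have h1 : trR R = hR.eigenvalues 0 + hR.eigenvalues 1 := by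
    rw [trR, hR.trace_eq_sum_eigenvalues, Fin.sum_univ_two]; simp
  have h2 : detR R = hR.eigenvalues 0 * hR.eigenvalues 1 := by
    rw [detR, hR.det_eq_prod_eigenvalues, Fin.prod_univ_two]; simp
  rw [hR.posSemidef_iff_eigenvalues_nonneg, h1, h2, Pi.le_def, Fin.forall_fin_two]
  simp only [Pi.zero_apply]
  constructor
  · rintro ⟨ha, hb⟩; exact ⟨add_nonneg ha hb, mul_nonneg ha hb⟩
  · rintro ⟨hs, hp⟩
    constructor <;> by_contra hneg <;> push Not at hneg <;> nlinarith

/-- The two conditions are the signs of trace and determinant of `R - D`, with `det (R - D) = det R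
+ 1 - tr R √(1 + ‖ξ‖²) + L·ξ` because `det D = 1`. -/
lemma posSemidef_sub_pureCM_iff {R : Matrix (Fin 2) (Fin 2) ℂ} (hR : R.IsHermitian)
    (ξ : Fin 2 → ℝ) : (R - (pureCM ξ).map Complex.ofReal).PosSemidef ↔
      2 * √(1 + ξ ⬝ᵥ ξ) ≤ trR R ∧ trR R * √(1 + ξ ⬝ᵥ ξ) ≤ detR R + 1 + vecL R ⬝ᵥ ξ := by
  have hp : ((pureCM ξ).map Complex.ofReal).IsHermitian := by
    ext i j; fin_cases i <;> fin_cases j <;> simp [pureCM]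
  have hx := sq_sqrt_one_add ξ
  rw [posSemidef_fin_two_iff (hR.sub hp), trR_eq, detR_eq (hR.sub hp), trR_eq, detR_eq hR]
  have hL : vecL R ⬝ᵥ ξ = ((R 0 0).re - (R 1 1).re) * ξ 0 + 2 * (R 0 1).re * ξ 1 := by
    rw [dotProduct_fin_two]; simp [vecL]
  rw [hL]
  simp only [pureCM, dotProduct_fin_two ξ ξ] at *
  simp
  generalize √(1 + (ξ 0 * ξ 0 + ξ 1 * ξ 1)) = X at *
  refine and_congr ⟨fun h => by linarith, fun h => by linarith⟩
    ⟨fun h => by nlinarith, fun h => by nlinarith⟩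

lemma isCM_pureCM (ξ : Fin 2 → ℝ) : IsCM (pureCM ξ) := by
  have hx := sq_sqrt_one_add ξ
  have h0 := Real.sqrt_nonneg (1 + ξ ⬝ᵥ ξ)
  rw [isCM_iff]
  simp only [pureCM, dotProduct_fin_two] at *
  simp
  generalize √(1 + (ξ 0 * ξ 0 + ξ 1 * ξ 1)) = X at *
  constructor
  · nlinarith [sq_nonneg (ξ 1), sq_nonneg (X + ξ 0)]
  · nlinarith

lemma exists_eq_pureCM {h : Matrix (Fin 2) (Fin 2) ℝ} (hs : h 0 1 = h 1 0) (ha : 0 < h 0 0)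
    (hd : h 0 0 * h 1 1 - h 0 1 ^ 2 = 1) : ∃ ξ, h = pureCM ξ := by
  refine ⟨![(h 0 0 - h 1 1) / 2, h 0 1], ?_⟩
  have hc : 0 < h 1 1 := by
    by_contra hneg
    nlinarith [sq_nonneg (h 0 1)]
  have : √(1 + ![(h 0 0 - h 1 1) / 2, h 0 1] ⬝ᵥ ![(h 0 0 - h 1 1) / 2, h 0 1]) =
      (h 0 0 + h 1 1) / 2 := by
    rw [Real.sqrt_eq_iff_eq_sq (one_add_dotProduct_self_pos _).le (by linarith),
      dotProduct_fin_two]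
    simp
    linear_combination (-1 : ℝ) * hd
  ext i j
  rw [pureCM, this]
  fin_cases i <;> fin_cases j <;> simp [← hs] <;> ring

lemma posSemidef_map_ofReal {m : Type} [Fintype m] {M : Matrix m m ℝ} (hM : M.PosSemidef) :
    (M.map Complex.ofReal).PosSemidef := by
  have h := (posSemidef_real_iff M).1 hM
  rw [← subI_zero, posSemidef_subI_iff h.1 (by simp)]
  intro x y
  have := h.2 x
  have := h.2 y
  simp
  linarith

/-- There is a one-mode correlation matrix below both `R` and `S` if and only if the three
inequalities have a solution. -/
theorem exists_isCM_le_iff {R S : Matrix (Fin 2) (Fin 2) ℂ} (hR : R.IsHermitian)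
    (hS : S.IsHermitian) : (∃ D, IsCM D ∧ (R - D.map Complex.ofReal).PosSemidef ∧
      (S - D.map Complex.ofReal).PosSemidef) ↔ ∃ ξ, SepCond R S ξ := by
  constructor
  · rintro ⟨D, hD, h1, h2⟩
    -- Lowering `D` to determinant one keeps it below `R` and `S` and makes it a `pureCM ξ`.
    obtain ⟨h, hs, ha, hd, hP⟩ := exists_det_eq_one hD
    obtain ⟨ξ, rfl⟩ := exists_eq_pureCM hs ha hd
    have hle : ∀ T : Matrix (Fin 2) (Fin 2) ℂ, (T - D.map Complex.ofReal).PosSemidef →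
        (T - (pureCM ξ).map Complex.ofReal).PosSemidef := by
      intro T hT
      have := hT.add (posSemidef_map_ofReal hP)
      convert this using 1
      ext i j; simp
    have a1 := (posSemidef_sub_pureCM_iff hR ξ).1 (hle R h1)
    have a2 := (posSemidef_sub_pureCM_iff hS ξ).1 (hle S h2)
    exact ⟨ξ, le_min a1.1 a2.1, a1.2, a2.2⟩
  · rintro ⟨ξ, h1, h2, h3⟩
    exact ⟨pureCM ξ, isCM_pureCM ξ,
      (posSemidef_sub_pureCM_iff hR ξ).2 ⟨h1.trans (min_le_left _ _), h2⟩,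
      (posSemidef_sub_pureCM_iff hS ξ).2 ⟨h1.trans (min_le_right _ _), h3⟩⟩

/-- `R ≥ D > 0`, where `D` is definite because its determinant is at least one. The strict sign is
what makes the conics ellipses. -/
lemma detR_pos_of_isCM_le {R : Matrix (Fin 2) (Fin 2) ℂ} {D : Matrix (Fin 2) (Fin 2) ℝ}
    (hD : IsCM D) (h : (R - D.map Complex.ofReal).PosSemidef) : 0 < detR R := by
  obtain ⟨hs, ha, hd⟩ := (isCM_iff D).1 hD
  have hDP : (D.map Complex.ofReal).PosDef := by
    have hPS : (D.map Complex.ofReal).PosSemidef := posSemidef_map_ofReal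
      ((posSemidef_real_iff D).2 ⟨hD.1, hD.quadForm_nonneg⟩)
    rw [hPS.posDef_iff_det_ne_zero, Matrix.det_fin_two]
    simp only [Matrix.map_apply, ← hs]
    have : D 0 0 * D 1 1 - D 0 1 * D 0 1 ≠ 0 := by nlinarith
    exact_mod_cast this
  have hRP : R.PosDef := by
    have := hDP.posSemidef_add h
    rwa [sub_add_cancel] at this
  have := hRP.det_pos
  exact (Complex.pos_iff.1 this).1

theorem theorem3 (ρ : ModeState 3) (γ : Matrix (PhaseIdx 3) (PhaseIdx 3) ℝ)
    (d : PhaseIdx 3 → ℝ) (hρ : ρ.IsGaussian γ d) (hPPT : IsPPT γ) :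
    ρ.IsFullySeparable ↔
      0 < detR (matN γ) ∧ 0 < detR (matNTilde γ) ∧
        ∃ ξ ∈ candidatePoints (matN γ) (matNTilde γ), SepCond (matN γ) (matNTilde γ) ξ := by
  have hγ : γ.IsSymm := by
    have := hρ.1.1.eq
    rwa [Matrix.conjTranspose_eq_transpose_of_trivial] at this
  have hN : (matN γ).IsHermitian := isHermitian_schurN hγ (signedJ_transpose _)
  have hNt : (matNTilde γ).IsHermitian := isHermitian_schurN hγ (signedJ_transpose _)
  have hiff := mem_aboveProduct_iff hγ hρ.uncertainty hPPT
  constructor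
  · intro hsep
    have hmem := mem_aboveProduct hγ fun m z p q hpq => hρ.le_of_isFullySeparable hsep z p q hpq
    obtain ⟨D, hD, h1, h2⟩ := hiff.1 hmem
    have hd1 := detR_pos_of_isCM_le hD h1
    have hd2 := detR_pos_of_isCM_le hD h2
    obtain ⟨ξ, hξ⟩ := (exists_isCM_le_iff hN hNt).1 ⟨D, hD, h1, h2⟩
    -- Some ξ solves (1); positive determinants allow it to be replaced by a candidate point.
    exact ⟨hd1, hd2, exists_candidatePoint hN hNt hd1 hd2 hξ⟩
  · rintro ⟨-, -, ξ, -, hξ⟩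
    exact hρ.isFullySeparable (hiff.2 ((exists_isCM_le_iff hN hNt).2 ⟨ξ, hξ⟩))
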